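/- Let $\Omega\subset\mathbb R^N$, $N\ge 1$, be a smooth bounded domain (open, connected, nonempty), let $p\in C^1(\overline\Omega)$ with $1<p_-:=\min_{\overline\Omega}p$, let $q\in(1,p_-)$ and $\lambda>0$. Let $A:\Omega\times\mathbb R^N\to[0,\infty)$ be continuous, differentiable in $\xi$, and put $a(x,\xi)=(a_j(x,\xi))_j=\frac1{p(x)}\nabla_\xi A(x,\xi)$. Assume: $(A_0)$ $A(x,t\xi)=t^{p(x)}A(x,\xi)$ for all $t\ge0$, $\xi\in\mathbb R^N$ and a.e. $x\in\Omega$; $(A_1)$ for every $j$, $a_j(x,0)=0$, $a_j\in C^1(\Omega\times(\mathbb R^N\setminus\{0\}))\cap C(\Omega\times\mathbb R^N)$, and there are constants $\gamma,\Gamma>0$ such that for all $x\in\Omega$, $\xi\in\mathbb R^N\setminus\{0\}$, $\eta\in\mathbb R^N$: $\sum_{i,j}\frac{\partial a_j}{\partial\xi_i}(x,\xi)\eta_i\eta_j\ge\gamma|\xi|^{p(x)-2}|\eta|^2$ and $\sum_{i,j}\big|\frac{\partial a_j}{\partial\xi_i}(x,\xi)\big|\le\Gamma|\xi|^{p(x)-2}$;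 $(A_2)$ there is $C>0$ such that $\sum_{i,j}\big|\frac{\partial a_i}{\partial x_j}(x,\xi)\big|\le C|\xi|^{p(x)-1}(1+|\ln|\xi||)$ for all $x\in\Omega$, $\xi\ne0$. Let $f:\overline\Omega\times[0,\infty)\to[0,\infty)$ satisfy: $(f_0)$ $f$ is continuous, $f(x,0)=0$ for all $x$, and $f>0$ on $\Omega\times(0,\infty)$; $(f_1)$ for every $x\in\Omega$, $s\mapsto f(x,s)/s^{q-1}$ is nonincreasing on $(0,\infty)$. Let $h\in L^r(\Omega)$ for some $r\ge2$, $h\ge0$ a.e., and consider the problem $$v^{2q-1}-\lambda\nabla\cdot a(x,\nabla v)=h\,v^{q-1}+\lambda f(x,v)\ \text{ in }\Omega,\qquad v\ge0\ \text{ in }\Omega,\qquad v=0\ \text{ on }\partial\Omega. \tag{$E_1$}$$ Let $\mathbf X=W_0^{1,p(x)}(\Omega)\cap L^{2q}(\Omega)$, where $W_0^{1,p(x)}(\Omega)$ is the closure of $C_c^\infty(\Omega)$ in $W^{1,p(x)}(\Omega)$. A nonnegative $v\in\mathbf X$ is a subsolution (supersolution) of $(E_1)$ if for all $\phi\in\mathbf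 X$ with $\phi\ge0$ a.e. $$\int_\Omega v^{2q-1}\phi\,dx+\lambda\int_\Omega a(x,\nabla v)\cdot\nabla\phi\,dx\ \le\ (\ge)\ \int_\Omega h\,v^{q-1}\phi\,dx+\lambda\int_\Omega f(x,v)\phi\,dx .$$ Theorem (weak comparison principle). Let $\underline v,\overline v\in\mathbf X\cap L^\infty(\Omega)$ be nonnegative functions that are respectively a subsolution and a supersolution of $(E_1)$ for the same $h$, and suppose that $\overline v$ is nontrivial, i.e. not a.e. equal to $0$. Then $\underline v\le\overline v$ a.e. in $\Omega$. -/

import Mathlib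

open Set Filter Topology MeasureTheory
open scoped ENNReal

namespace WeakComparison

/-- The Euclidean space `ℝ^N`. -/
abbrev E (N : ℕ) : Type := EuclideanSpace ℝ (Fin N)

/-- `Ω` is a smooth bounded domain: nonempty, connected, open, bounded, and near every boundary
point it is the sublevel set `{ψ < 0}` of a smooth function `ψ` with nonzero differential at that
point. -/
structure IsSmoothBoundedDomain {N : ℕ} (Ω : Set (E N)) : Prop where
  isOpen : IsOpen Ω
  isConnected : IsConnected Ω
  isBounded : Bornology.IsBounded Ω
  smooth_boundary : ∀ x₀ ∈ frontier Ω, ∃ U : Set (E N), ∃ ψ : E N → ℝ,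
    IsOpen U ∧ x₀ ∈ U ∧ ContDiffOn ℝ ((⊤ : ℕ∞) : WithTop ℕ∞) ψ U ∧ fderiv ℝ ψ x₀ ≠ 0 ∧ Ω ∩ U = {x ∈ U | ψ x < 0}

/-- `p ∈ C¹(closure Ω)`: `p` is continuous up to the boundary, of class `C¹` inside, and its
differential extends continuously up to the boundary. -/
def IsC1Closure {N : ℕ} (Ω : Set (E N)) (p : E N → ℝ) : Prop :=
  ContinuousOn p (closure Ω) ∧ ContDiffOn ℝ 1 p Ω ∧
    ∃ g : E N → (E N →L[ℝ] ℝ), ContinuousOn g (closure Ω) ∧ EqOn g (fderiv ℝ p) Ω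

/-! ### Variable exponent Lebesgue and Sobolev spaces -/

/-- The modular `∫_Ω |g(x)|^{p(x)} dx`, with values in `[0,∞]`. -/
noncomputable def modular {N : ℕ} {F : Type*} [NormedAddCommGroup F] (Ω : Set (E N))
    (p : E N → ℝ) (g : E N → F) : ℝ≥0∞ :=
  ∫⁻ x in Ω, ‖g x‖ₑ ^ p x

/-- `g ∈ L^{p(x)}(Ω)`. For a bounded exponent this is measurability and finiteness of the
modular. -/
def MemLpVar {N : ℕ} {F : Type*} [NormedAddCommGroup F] (Ω : Set (E N))
    (p : E N → ℝ) (g : E N → F) : Prop :=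
  AEStronglyMeasurable g (volume.restrict Ω) ∧ modular Ω p g < ∞

/-- `φ ∈ C_c^∞(Ω)`. -/
def IsTestFunction {N : ℕ} (Ω : Set (E N)) (φ : E N → ℝ) : Prop :=
  ContDiff ℝ ((⊤ : ℕ∞) : WithTop ℕ∞) φ ∧ HasCompactSupport φ ∧ tsupport φ ⊆ Ω

/-- `G` is the weak gradient of `u` in `Ω`:
`∫_Ω u ∂_i φ = - ∫_Ω G_i φ` for all `φ ∈ C_c^∞(Ω)` and all `i`. -/
def IsWeakGradient {N : ℕ} (Ω : Set (E N)) (u : E N → ℝ) (G : E N → E N) : Prop :=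
  LocallyIntegrableOn u Ω ∧ LocallyIntegrableOn G Ω ∧
    ∀ φ : E N → ℝ, IsTestFunction Ω φ → ∀ i : Fin N,
      ∫ x in Ω, u x * gradient φ x i = - ∫ x in Ω, G x i * φ x

/-- `u ∈ W^{1,p(x)}(Ω)` with weak gradient `G`. -/
structure MemW {N : ℕ} (Ω : Set (E N)) (p : E N → ℝ) (u : E N → ℝ) (G : E N → E N) : Prop where
  memLp : MemLpVar Ω p u
  memLp_grad : MemLpVar Ω p G
  weakGradient : IsWeakGradient Ω u G

/-- `u ∈ W_0^{1,p(x)}(Ω)` with weak gradient `G`, where `W_0^{1,p(x)}(Ω)` is the closure of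
`C_c^∞(Ω)` in `W^{1,p(x)}(Ω)`. For a bounded exponent convergence in the Luxemburg norm is the
same as convergence in the modular. -/
structure MemW0 {N : ℕ} (Ω : Set (E N)) (p : E N → ℝ) (u : E N → ℝ) (G : E N → E N) : Prop
    extends MemW Ω p u G where
  approx : ∀ ε : ℝ≥0∞, 0 < ε → ∃ φ : E N → ℝ, IsTestFunction Ω φ ∧
    modular Ω p (fun x => u x - φ x) < ε ∧ modular Ω p (fun x => G x - gradient φ x) < ε

/-- `u ∈ X = W_0^{1,p(x)}(Ω) ∩ L^{2q}(Ω)`, with weak gradient `G`. -/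
structure MemX {N : ℕ} (Ω : Set (E N)) (p : E N → ℝ) (q : ℝ) (u : E N → ℝ) (G : E N → E N) :
    Prop extends MemW0 Ω p u G where
  memLp_two_q : MemLp u (ENNReal.ofReal (2 * q)) (volume.restrict Ω)

/-! ### The operator -/

/-- `a(x,ξ) = (1/p(x)) ∇_ξ A(x,ξ)`. -/
noncomputable def field {N : ℕ} (p : E N → ℝ) (A : E N → E N → ℝ) (x ξ : E N) : E N :=
  (1 / p x) • gradient (A x) ξ

/-- The partial derivative `∂a_j/∂ξ_i (x,ξ)`. -/
noncomputable def dxi {N : ℕ} (a : E N → E N → E N) (j i : Fin N) (x ξ : E N) : ℝ :=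
  fderiv ℝ (fun ζ => a x ζ j) ξ (EuclideanSpace.single i 1)

/-- The partial derivative `∂a_i/∂x_j (x,ξ)`. -/
noncomputable def dx {N : ℕ} (a : E N → E N → E N) (i j : Fin N) (x ξ : E N) : ℝ :=
  fderiv ℝ (fun y => a y ξ i) x (EuclideanSpace.single j 1)

/-- `A : Ω × ℝ^N → ℝ⁺` is continuous, differentiable in `ξ`, and `p(x)`-homogeneous in `ξ`. -/
structure CondA0 {N : ℕ} (Ω : Set (E N)) (p : E N → ℝ) (A : E N → E N → ℝ) : Prop where
  nonneg : ∀ x ∈ Ω, ∀ ξ, 0 ≤ A x ξ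
  continuousOn : ContinuousOn (fun z : E N × E N => A z.1 z.2) (Ω ×ˢ univ)
  differentiable : ∀ x ∈ Ω, Differentiable ℝ (A x)
  homogeneous : ∀ᵐ x ∂(volume.restrict Ω), ∀ t : ℝ, 0 ≤ t → ∀ ξ : E N,
    A x (t • ξ) = t ^ p x * A x ξ

/-- Ellipticity and growth of `a`. -/
structure CondA1 {N : ℕ} (Ω : Set (E N)) (p : E N → ℝ) (a : E N → E N → E N) : Prop where
  map_zero : ∀ x ∈ Ω, ∀ j, a x 0 j = 0
  contDiffOn : ∀ j, ContDiffOn ℝ 1 (fun z : E N × E N => a z.1 z.2 j) (Ω ×ˢ {0}ᶜ)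
  continuousOn : ∀ j, ContinuousOn (fun z : E N × E N => a z.1 z.2 j) (Ω ×ˢ univ)
  bounds : ∃ γ Γ : ℝ, 0 < γ ∧ 0 < Γ ∧ ∀ x ∈ Ω, ∀ ξ : E N, ξ ≠ 0 →
    (∀ η : E N, γ * ‖ξ‖ ^ (p x - 2) * ‖η‖ ^ 2 ≤ ∑ i, ∑ j, dxi a j i x ξ * η i * η j) ∧
    ∑ i, ∑ j, |dxi a j i x ξ| ≤ Γ * ‖ξ‖ ^ (p x - 2)

/-- Growth of the `x`-derivatives of `a`. -/
def CondA2 {N : ℕ} (Ω : Set (E N)) (p : E N → ℝ) (a : E N → E N → E N) : Prop :=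
  ∃ C : ℝ, 0 < C ∧ ∀ x ∈ Ω, ∀ ξ : E N, ξ ≠ 0 →
    ∑ i, ∑ j, |dx a i j x ξ| ≤ C * ‖ξ‖ ^ (p x - 1) * (1 + |Real.log ‖ξ‖|)

/-! ### The nonlinearity -/

/-- `f : closure Ω × ℝ⁺ → ℝ⁺` is continuous, `f(x,0) = 0`, and `f > 0` on `Ω × (0,∞)`. -/
structure CondF0 {N : ℕ} (Ω : Set (E N)) (f : E N → ℝ → ℝ) : Prop where
  nonneg : ∀ x ∈ closure Ω, ∀ s : ℝ, 0 ≤ s → 0 ≤ f x s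
  continuousOn : ContinuousOn (fun z : E N × ℝ => f z.1 z.2) (closure Ω ×ˢ Ici 0)
  map_zero : ∀ x ∈ closure Ω, f x 0 = 0
  pos : ∀ x ∈ Ω, ∀ s : ℝ, 0 < s → 0 < f x s

/-- `s ↦ f(x,s)/s^{q-1}` is nonincreasing on `(0,∞)` for every `x ∈ Ω`. -/
def CondF1 {N : ℕ} (Ω : Set (E N)) (q : ℝ) (f : E N → ℝ → ℝ) : Prop :=
  ∀ x ∈ Ω, AntitoneOn (fun s : ℝ => f x s / s ^ (q - 1)) (Ioi 0)

/-! ### Sub- and supersolutions -/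

/-- `∫_Ω v^{2q-1} φ + lam ∫_Ω a(x,∇v)·∇φ`, where `G = ∇v` and `H = ∇φ`. -/
noncomputable def lhsForm {N : ℕ} (Ω : Set (E N)) (q lam : ℝ) (a : E N → E N → E N)
    (v : E N → ℝ) (G : E N → E N) (φ : E N → ℝ) (H : E N → E N) : ℝ :=
  (∫ x in Ω, v x ^ (2 * q - 1) * φ x) + lam * ∫ x in Ω, inner ℝ (a x (G x)) (H x)

/-- `∫_Ω h v^{q-1} φ + lam ∫_Ω f(x,v) φ`. -/
noncomputable def rhsForm {N : ℕ} (Ω : Set (E N)) (q lam : ℝ) (f : E N → ℝ → ℝ)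
    (h v φ : E N → ℝ) : ℝ :=
  (∫ x in Ω, h x * v x ^ (q - 1) * φ x) + lam * ∫ x in Ω, f x (v x) * φ x

/-- `v ∈ X` is a nonnegative weak subsolution of
`v^{2q-1} - lam div a(x,∇v) = h v^{q-1} + lam f(x,v)` in `Ω`, `v = 0` on `∂Ω`. -/
def IsSubsolution {N : ℕ} (Ω : Set (E N)) (p : E N → ℝ) (q lam : ℝ) (a : E N → E N → E N)
    (f : E N → ℝ → ℝ) (h v : E N → ℝ) : Prop :=
  (∀ᵐ x ∂(volume.restrict Ω), 0 ≤ v x) ∧ ∃ G : E N → E N, MemX Ω p q v G ∧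
    ∀ (φ : E N → ℝ) (H : E N → E N), MemX Ω p q φ H →
      (∀ᵐ x ∂(volume.restrict Ω), 0 ≤ φ x) →
      lhsForm Ω q lam a v G φ H ≤ rhsForm Ω q lam f h v φ

/-- `v ∈ X` is a nonnegative weak supersolution of the same problem. -/
def IsSupersolution {N : ℕ} (Ω : Set (E N)) (p : E N → ℝ) (q lam : ℝ) (a : E N → E N → E N)
    (f : E N → ℝ → ℝ) (h v : E N → ℝ) : Prop :=
  (∀ᵐ x ∂(volume.restrict Ω), 0 ≤ v x) ∧ ∃ G : E N → E N, MemX Ω p q v G ∧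
    ∀ (φ : E N → ℝ) (H : E N → E N), MemX Ω p q φ H →
      (∀ᵐ x ∂(volume.restrict Ω), 0 ≤ φ x) →
      rhsForm Ω q lam f h v φ ≤ lhsForm Ω q lam a v G φ H

end WeakComparison

/-!
The comparison rests on Picone's inequality for the potential `A(x, ·)`, which is homogeneous of
degree `p(x)`: for `1 < q ≤ p(x)` the diffusion terms, tested with `(v^q - w^q)⁺ v^{1-q}` for the
subsolution and with `(v^q - w^q)⁺ w^{1-q}` for the supersolution, have a nonnegative difference
(`IsEllipticPotential.picone`). On `{v > w}` the sources compare in the opposite direction,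
because `f(x, s) / s^{q-1}` is nonincreasing and the terms containing `h` cancel. What remains is
`∫ ((v^q - w^q)⁺)² ≤ 0`.

Two obstacles are in the way. First, the test functions have to belong to `W₀^{1,p(x)}(Ω)`. This
space is only accessible through approximation by test functions, and the chain rule `MemW0.comp`
is proved for functions which are smooth near the essential range. Therefore `v` and `w` are
replaced by `v + ε` and `w + ε`, and the positive part by a smooth function `softPos δ`, which
vanishes where the positive part does and is homogeneous of degree one up to an error `δ`; that
error contributes `δ ε^{-q}`, which tends to zero for `δ = ε^{q+1}`. The resulting inequality is
`integral_comparisonIntegrand_le`. Secondly, the limit `ε → 0` under the integral gives the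
desired inequality only if `w > 0` almost everywhere: where `w = 0 < v`, the terms containing `h`
do not cancel, and `f(x, w) (w + ε)^{1-q} = 0` does not dominate `f(x, v) (v + ε)^{1-q}`.

The positivity of `w` is a strong maximum principle
(`IsSublinearSupersolution.ae_eq_zero_or_ae_pos`), which is proved without regularity theory or a
Harnack inequality. By the monotonicity and the positivity of `f`, locally
`-div a(x, ∇w) ≥ b w^{q-1} - B w^{2q-1}` with `b > 0`. Testing with `ζ (w + ε)^{-σ}`, where `ζ` is a cutoff function,
bounds `∫ ζ |∇w|^{p(x)} w^{-σ-1}` and `∫ ζ w^{q-1-σ}` by an integral over the support of `ζ`,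
which Young's inequality estimates by negative moments of lower order. As `q < p(x)`, each such
step gains a fixed amount, and so all negative moments are finite
(`IsSublinearSupersolution.exists_hasNegativeMoments_ge`). Consequently the gradients of
`w / (w + ε)` tend to zero locally in `L¹`, and the indicator function of `{w > 0}` has a vanishing weak
gradient. It is constant because `Ω` is connected (`IsWeakGradient.exists_ae_eq_const`), and the
constant is `1` since `w` is nontrivial.
-/

namespace WeakComparison

/-! ### Modulars of a bounded variable exponent -/

/-- A continuous exponent with values in `[1, P]` on a bounded open set. -/
structure IsBoundedExponent {N : ℕ} (Ω : Set (E N)) (p : E N → ℝ) (P : ℝ) : Prop where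
  isOpen : IsOpen Ω
  isBounded : Bornology.IsBounded Ω
  continuousOn : ContinuousOn p Ω
  one_le : ∀ x ∈ Ω, 1 ≤ p x
  le : ∀ x ∈ Ω, p x ≤ P

section Modular

variable {N : ℕ} {F : Type*} [NormedAddCommGroup F] {Ω : Set (E N)} {p : E N → ℝ} {P : ℝ}

theorem IsBoundedExponent.aemeasurable (hp : IsBoundedExponent Ω p P) :
    AEMeasurable p (volume.restrict Ω) :=
  hp.continuousOn.aemeasurable hp.isOpen.measurableSet

theorem IsBoundedExponent.volume_lt_top (hp : IsBoundedExponent Ω p P) : volume Ω < ∞ :=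
  hp.isBounded.measure_lt_top

theorem IsBoundedExponent.isFiniteMeasure (hp : IsBoundedExponent Ω p P) :
    IsFiniteMeasure (volume.restrict Ω) :=
  ⟨by simpa using hp.volume_lt_top⟩

theorem IsBoundedExponent.ae_mem (hp : IsBoundedExponent Ω p P) :
    ∀ᵐ x ∂(volume.restrict Ω), x ∈ Ω :=
  ae_restrict_mem hp.isOpen.measurableSet

theorem IsBoundedExponent.aemeasurable_rpow (hp : IsBoundedExponent Ω p P) {g : E N → F}
    (hg : AEStronglyMeasurable g (volume.restrict Ω)) :
    AEMeasurable (fun x => ‖g x‖ₑ ^ p x) (volume.restrict Ω) :=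
  hg.enorm.pow hp.aemeasurable

theorem modular_le_of_norm_le (hp : IsBoundedExponent Ω p P) {F' : Type*}
    [NormedAddCommGroup F'] {g : E N → F} {h : E N → F'} {C : ℝ} (hC : 1 ≤ C)
    (hgh : ∀ᵐ x ∂(volume.restrict Ω), ‖g x‖ ≤ C * ‖h x‖) :
    modular Ω p g ≤ ENNReal.ofReal C ^ P * modular Ω p h := by
  have hC' : (1 : ℝ≥0∞) ≤ ENNReal.ofReal C := by simpa using ENNReal.ofReal_le_ofReal hC
  unfold modular
  rw [← lintegral_const_mul' _ _ (ENNReal.rpow_ne_top_of_ne_zero (by positivity) (by simp))]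
  refine lintegral_mono_ae ?_
  filter_upwards [hgh, hp.ae_mem] with x hx hxΩ
  have h1 : ‖g x‖ₑ ≤ ENNReal.ofReal C * ‖h x‖ₑ := by
    rw [← ofReal_norm, ← ofReal_norm, ← ENNReal.ofReal_mul (by linarith)]
    exact ENNReal.ofReal_le_ofReal hx
  have hpx : 0 ≤ p x := by linarith [hp.one_le x hxΩ]
  calc ‖g x‖ₑ ^ p x ≤ (ENNReal.ofReal C * ‖h x‖ₑ) ^ p x := ENNReal.rpow_le_rpow h1 hpx
    _ = ENNReal.ofReal C ^ p x * ‖h x‖ₑ ^ p x := ENNReal.mul_rpow_of_nonneg _ _ hpx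
    _ ≤ _ := by
      gcongr
      exact hp.le x hxΩ

theorem modular_add_le (hp : IsBoundedExponent Ω p P) {g h : E N → F}
    (hg : AEStronglyMeasurable g (volume.restrict Ω)) :
    modular Ω p (fun x => g x + h x) ≤ 2 ^ P * (modular Ω p g + modular Ω p h) := by
  unfold modular
  rw [← lintegral_add_left' (hp.aemeasurable_rpow hg),
    ← lintegral_const_mul' _ _ (ENNReal.rpow_ne_top_of_ne_zero (by positivity) (by simp))]
  refine lintegral_mono_ae ?_
  filter_upwards [hp.ae_mem] with x hxΩ
  have hpx : 0 ≤ p x := by linarith [hp.one_le x hxΩ]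
  have h1 : ‖g x + h x‖ₑ ≤ 2 * max ‖g x‖ₑ ‖h x‖ₑ := by
    rw [two_mul]
    exact (enorm_add_le _ _).trans (add_le_add (le_max_left _ _) (le_max_right _ _))
  calc ‖g x + h x‖ₑ ^ p x ≤ (2 * max ‖g x‖ₑ ‖h x‖ₑ) ^ p x := ENNReal.rpow_le_rpow h1 hpx
    _ = 2 ^ p x * max ‖g x‖ₑ ‖h x‖ₑ ^ p x := ENNReal.mul_rpow_of_nonneg _ _ hpx
    _ ≤ 2 ^ P * (‖g x‖ₑ ^ p x + ‖h x‖ₑ ^ p x) := by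
      gcongr
      · exact one_le_two
      · exact hp.le x hxΩ
      · rcases max_choice ‖g x‖ₑ ‖h x‖ₑ with h | h <;> rw [h]
        · exact le_self_add
        · exact le_add_self

theorem MemLpVar.add (hp : IsBoundedExponent Ω p P) {g h : E N → F}
    (hg : MemLpVar Ω p g) (hh : MemLpVar Ω p h) : MemLpVar Ω p (fun x => g x + h x) :=
  ⟨hg.1.add hh.1, (modular_add_le hp hg.1).trans_lt (ENNReal.mul_lt_top
    (ENNReal.rpow_ne_top_of_ne_zero (by positivity) (by simp)).lt_top
    (ENNReal.add_lt_top.2 ⟨hg.2, hh.2⟩))⟩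

theorem MemLpVar.of_norm_le (hp : IsBoundedExponent Ω p P) {F' : Type*}
    [NormedAddCommGroup F'] {g : E N → F} {h : E N → F'}
    (hg : AEStronglyMeasurable g (volume.restrict Ω)) (hh : MemLpVar Ω p h) {C : ℝ}
    (hgh : ∀ᵐ x ∂(volume.restrict Ω), ‖g x‖ ≤ C * ‖h x‖) : MemLpVar Ω p g := by
  have hgh' : ∀ᵐ x ∂(volume.restrict Ω), ‖g x‖ ≤ max C 1 * ‖h x‖ := by
    filter_upwards [hgh] with x hx
    exact hx.trans (by gcongr; exact le_max_left _ _)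
  exact ⟨hg, (modular_le_of_norm_le hp (le_max_right C 1) hgh').trans_lt (ENNReal.mul_lt_top
    (ENNReal.rpow_ne_top_of_ne_zero (by simp) (by simp)).lt_top hh.2)⟩

theorem MemLpVar.of_bound (hp : IsBoundedExponent Ω p P) {g : E N → F}
    (hg : AEStronglyMeasurable g (volume.restrict Ω)) {C : ℝ}
    (hgC : ∀ᵐ x ∂(volume.restrict Ω), ‖g x‖ ≤ C) : MemLpVar Ω p g := by
  refine MemLpVar.of_norm_le hp (h := fun _ => (1 : ℝ)) (C := C) hg
    ⟨aestronglyMeasurable_const, ?_⟩ (by simpa using hgC)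
  simpa [modular] using hp.volume_lt_top

theorem MemLpVar.integrable_rpow (hp : IsBoundedExponent Ω p P) {g : E N → F}
    (hg : MemLpVar Ω p g) : IntegrableOn (fun x => ‖g x‖ ^ p x) Ω := by
  refine ⟨(hg.1.norm.aemeasurable.pow hp.aemeasurable).aestronglyMeasurable, ?_⟩
  have : ∫⁻ x in Ω, ‖‖g x‖ ^ p x‖ₑ = modular Ω p g := by
    refine lintegral_congr_ae ?_
    filter_upwards [hp.ae_mem] with x hx
    rw [Real.enorm_rpow_of_nonneg (norm_nonneg _) (by linarith [hp.one_le x hx]), enorm_norm]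
  rw [HasFiniteIntegral, this]
  exact hg.2

/-- Small modular forces small `L¹` norm, because `|g| ≤ δ + δ^{1-P} |g|^{p(x)}`. -/
theorem lintegral_enorm_le_add_modular (hp : IsBoundedExponent Ω p P) (g : E N → F) {δ : ℝ≥0∞}
    (hδ0 : δ ≠ 0) (hδ1 : δ ≤ 1) :
    ∫⁻ x in Ω, ‖g x‖ₑ ≤ δ * volume Ω + δ ^ (1 - P) * modular Ω p g := by
  have hδt : δ ≠ ∞ := (hδ1.trans_lt ENNReal.one_lt_top).ne
  unfold modular
  rw [← lintegral_const_mul' _ _ (ENNReal.rpow_ne_top_of_ne_zero hδ0 hδt),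
    ← setLIntegral_const, ← lintegral_add_left measurable_const]
  refine lintegral_mono_ae ?_
  filter_upwards [hp.ae_mem] with x hxΩ
  rcases le_total ‖g x‖ₑ δ with h | h
  · exact h.trans le_self_add
  · refine le_trans ?_ le_add_self
    have hg0 : ‖g x‖ₑ ≠ 0 := fun h0 => hδ0 (by simpa [h0] using h)
    calc ‖g x‖ₑ = ‖g x‖ₑ ^ (1 - p x) * ‖g x‖ₑ ^ p x := by
          rw [← ENNReal.rpow_add _ _ hg0 enorm_ne_top]; simp
      _ ≤ δ ^ (1 - p x) * ‖g x‖ₑ ^ p x := by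
          gcongr ?_ * _
          rw [← neg_sub, ENNReal.rpow_neg, ENNReal.rpow_neg, ENNReal.inv_le_inv]
          exact ENNReal.rpow_le_rpow h (by linarith [hp.one_le x hxΩ])
      _ ≤ δ ^ (1 - P) * ‖g x‖ₑ ^ p x := by
          gcongr ?_ * _
          exact ENNReal.rpow_le_rpow_of_exponent_ge hδ1 (by linarith [hp.le x hxΩ])

theorem MemLpVar.integrableOn (hp : IsBoundedExponent Ω p P) {g : E N → F}
    (hg : MemLpVar Ω p g) : IntegrableOn g Ω := by
  refine ⟨hg.1, ?_⟩
  refine (lintegral_enorm_le_add_modular hp g one_ne_zero le_rfl).trans_lt ?_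
  simpa using ⟨hp.volume_lt_top, hg.2⟩

/-- Functions of small modular have small `L¹` norm. -/
theorem exists_modular_lt_imp_lintegral_le (hp : IsBoundedExponent Ω p P) {ε : ℝ≥0∞}
    (hε : 0 < ε) : ∃ η : ℝ≥0∞, 0 < η ∧ ∀ (F : Type) [NormedAddCommGroup F]
      (g : E N → F), modular Ω p g < η → ∫⁻ x in Ω, ‖g x‖ₑ ≤ ε := by
  have hε2 : ε / 2 ≠ 0 := by simp [hε.ne']
  obtain ⟨δ, hδ0, hδ⟩ : ∃ δ : ℝ≥0∞, 0 < δ ∧ δ * volume Ω < ε / 2 := by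
    obtain ⟨n, hn⟩ := ENNReal.exists_inv_nat_lt
      (a := ε / 2 / (volume Ω + 1)) (by
        simp only [ne_eq, ENNReal.div_eq_zero_iff, not_or]
        exact ⟨by simpa using hε.ne', by simpa using hp.volume_lt_top.ne⟩)
    refine ⟨(n : ℝ≥0∞)⁻¹, by simp, ?_⟩
    calc (n : ℝ≥0∞)⁻¹ * volume Ω ≤ (n : ℝ≥0∞)⁻¹ * (volume Ω + 1) := by gcongr; exact le_self_add
      _ < ε / 2 := by
        rwa [← ENNReal.lt_div_iff_mul_lt (by simp) (by simp)]
  have hδ' : min δ 1 ≠ 0 := by simp [hδ0.ne']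
  have hδt : min δ 1 ≠ ∞ := ((min_le_right δ 1).trans_lt ENNReal.one_lt_top).ne
  have hc0 : (min δ 1) ^ (1 - P) ≠ 0 := (ENNReal.rpow_pos (pos_iff_ne_zero.2 hδ') hδt).ne'
  have hct : (min δ 1) ^ (1 - P) ≠ ∞ := ENNReal.rpow_ne_top_of_ne_zero hδ' hδt
  refine ⟨ε / 2 / (min δ 1) ^ (1 - P), ENNReal.div_pos hε2 hct, fun F _ g hg => ?_⟩
  refine (lintegral_enorm_le_add_modular hp g hδ' (min_le_right _ _)).trans ?_
  calc min δ 1 * volume Ω + (min δ 1) ^ (1 - P) * modular Ω p g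
      ≤ δ * volume Ω + (min δ 1) ^ (1 - P) * (ε / 2 / (min δ 1) ^ (1 - P)) := by
        gcongr
        exact min_le_left _ _
    _ ≤ ε / 2 + ε / 2 := by
        gcongr
        exact ENNReal.mul_div_le
    _ = ε := ENNReal.add_halves ε

end Modular

/-! ### Test functions -/

section TestFunction

variable {N : ℕ} {Ω : Set (E N)}

theorem gradient_apply (φ : E N → ℝ) (x : E N) (i : Fin N) :
    gradient φ x i = fderiv ℝ φ x (EuclideanSpace.single i 1) := by
  rw [← inner_gradient_left, EuclideanSpace.inner_single_right]
  simp

theorem gradient_of_hasFDerivAt_comp {T : ℝ × ℝ → ℝ} {φ ψ : E N → ℝ} {x : E N}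
    (hT : DifferentiableAt ℝ T (φ x, ψ x)) (hφ : DifferentiableAt ℝ φ x)
    (hψ : DifferentiableAt ℝ ψ x) :
    gradient (fun y => T (φ y, ψ y)) x =
      fderiv ℝ T (φ x, ψ x) (1, 0) • gradient φ x + fderiv ℝ T (φ x, ψ x) (0, 1) • gradient ψ x := by
  have h1 : HasFDerivAt (fun y => T (φ y, ψ y))
      ((fderiv ℝ T (φ x, ψ x)).comp ((fderiv ℝ φ x).prod (fderiv ℝ ψ x))) x :=
    HasFDerivAt.comp x (f := fun y => (φ y, ψ y)) hT.hasFDerivAt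
      (hφ.hasFDerivAt.prodMk hψ.hasFDerivAt)
  ext i
  simp only [gradient_apply, h1.fderiv, PiLp.add_apply, PiLp.smul_apply, smul_eq_mul,
    ContinuousLinearMap.comp_apply, ContinuousLinearMap.prod_apply]
  set a := fderiv ℝ φ x (EuclideanSpace.single i 1)
  set b := fderiv ℝ ψ x (EuclideanSpace.single i 1)
  have : (a, b) = a • ((1 : ℝ), (0 : ℝ)) + b • ((0 : ℝ), (1 : ℝ)) := by simp
  rw [this, map_add, map_smul, map_smul, smul_eq_mul, smul_eq_mul, mul_comm a, mul_comm b]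

theorem IsTestFunction.differentiable {φ : E N → ℝ} (hφ : IsTestFunction Ω φ) :
    Differentiable ℝ φ := hφ.1.differentiable (by simp)

theorem IsTestFunction.continuous_fderiv {φ : E N → ℝ} (hφ : IsTestFunction Ω φ) :
    Continuous (fderiv ℝ φ) := hφ.1.continuous_fderiv (by simp)

theorem gradient_eq_zero_of_notMem_tsupport {φ : E N → ℝ} {x : E N} (hx : x ∉ tsupport φ) :
    gradient φ x = 0 := by
  ext i
  rw [gradient_apply, image_eq_zero_of_notMem_tsupport
    (fun h => hx (tsupport_fderiv_subset ℝ h))]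
  simp

theorem IsTestFunction.continuous_gradient {φ : E N → ℝ} (hφ : IsTestFunction Ω φ) :
    Continuous (gradient φ) :=
  (InnerProductSpace.toDual ℝ (E N)).symm.continuous.comp hφ.continuous_fderiv

theorem IsTestFunction.hasCompactSupport_gradient {φ : E N → ℝ} (hφ : IsTestFunction Ω φ) :
    HasCompactSupport (gradient φ) :=
  HasCompactSupport.intro hφ.2.1 fun _ hx => gradient_eq_zero_of_notMem_tsupport hx

theorem IsTestFunction.exists_bound {φ : E N → ℝ} (hφ : IsTestFunction Ω φ) :
    ∃ C, 0 ≤ C ∧ ∀ x, |φ x| ≤ C ∧ ‖gradient φ x‖ ≤ C := by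
  obtain ⟨C₁, h₁⟩ := hφ.2.1.exists_bound_of_continuous hφ.1.continuous
  obtain ⟨C₂, h₂⟩ := hφ.hasCompactSupport_gradient.exists_bound_of_continuous hφ.continuous_gradient
  exact ⟨max C₁ C₂, ((norm_nonneg _).trans (h₁ 0)).trans (le_max_left _ _), fun x =>
    ⟨(h₁ x).trans (le_max_left _ _), (h₂ x).trans (le_max_right _ _)⟩⟩

/-- A smooth cutoff function between a compact set and an open neighbourhood of it. -/
theorem exists_contDiff_cutoff {V : Type*} [NormedAddCommGroup V] [NormedSpace ℝ V]
    [FiniteDimensional ℝ V] {K U : Set V} (hK : IsCompact K) (hU : IsOpen U) (hKU : K ⊆ U) :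
    ∃ χ : V → ℝ, ContDiff ℝ ((⊤ : ℕ∞) : WithTop ℕ∞) χ ∧ HasCompactSupport χ ∧ tsupport χ ⊆ U ∧
      (∀ᶠ x in 𝓝ˢ K, χ x = 1) ∧ ∀ x, χ x ∈ Icc (0 : ℝ) 1 := by
  obtain ⟨L, hL, hKL, hLU⟩ := exists_compact_between hK hU hKU
  obtain ⟨χ, h1, h0, hr⟩ := exists_contMDiffMap_one_nhds_of_subset_interior
    (n := ⊤) (modelWithCornersSelf ℝ V) hK.isClosed hKL
  have hsup : tsupport χ ⊆ L :=
    closure_minimal (fun x hx => by_contra fun hxL => hx (h0 x hxL)) hL.isClosed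
  exact ⟨χ, χ.contMDiff.contDiff, hL.of_isClosed_subset (isClosed_tsupport _) hsup,
    hsup.trans hLU, h1, hr⟩

theorem exists_isTestFunction_cutoff (hΩ : IsOpen Ω) {K : Set (E N)} (hK : IsCompact K)
    (hKΩ : K ⊆ Ω) : ∃ ζ : E N → ℝ, IsTestFunction Ω ζ ∧ (∀ x ∈ K, ζ x = 1) ∧
      ∀ x, ζ x ∈ Icc (0 : ℝ) 1 := by
  obtain ⟨χ, h1, h2, h3, h4, h5⟩ := exists_contDiff_cutoff hK hΩ hKΩ
  exact ⟨χ, ⟨h1, h2, h3⟩, fun x hx => h4.self_of_nhdsSet x hx, h5⟩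

/-- Integration by parts for two smooth functions, one of which is a test function. -/
theorem IsTestFunction.integral_mul_gradient {ψ φ : E N → ℝ} (hψ : IsTestFunction Ω ψ)
    (hφ : IsTestFunction Ω φ) (i : Fin N) :
    ∫ x in Ω, ψ x * gradient φ x i = - ∫ x in Ω, gradient ψ x i * φ x := by
  have hz : ∀ x, x ∉ Ω → φ x = 0 ∧ gradient φ x = 0 := fun x hx =>
    ⟨image_eq_zero_of_notMem_tsupport fun h => hx (hφ.2.2 h),
      gradient_eq_zero_of_notMem_tsupport fun h => hx (hφ.2.2 h)⟩
  rw [setIntegral_eq_integral_of_forall_compl_eq_zero, setIntegral_eq_integral_of_forall_compl_eq_zero]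
  · simp only [gradient_apply]
    have hc := fun (θ : E N → ℝ) (hθ : IsTestFunction Ω θ) =>
      (hθ.continuous_fderiv.clm_apply continuous_const :
        Continuous fun x => fderiv ℝ θ x (EuclideanSpace.single i 1))
    refine integral_mul_fderiv_eq_neg_fderiv_mul_of_integrable ?_ ?_ ?_
      (fun x _ => hψ.differentiable x) (fun x _ => hφ.differentiable x)
    · exact ((hc ψ hψ).mul hφ.1.continuous).integrable_of_hasCompactSupport hφ.2.1.mul_left
    · exact (hψ.1.continuous.mul (hc φ hφ)).integrable_of_hasCompactSupport hψ.2.1.mul_right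
    · exact (hψ.1.continuous.mul hφ.1.continuous).integrable_of_hasCompactSupport hψ.2.1.mul_right
  · intro x hx; simp [(hz x hx).1]
  · intro x hx; simp [(hz x hx).2]

end TestFunction

/-! ### The space `W₀^{1,p(x)}` and the chain rule -/

section Sobolev

variable {N : ℕ} {Ω : Set (E N)} {p : E N → ℝ} {P : ℝ}

theorem IsTestFunction.memLpVar (hp : IsBoundedExponent Ω p P) {φ : E N → ℝ}
    (hφ : IsTestFunction Ω φ) : MemLpVar Ω p φ := by
  obtain ⟨C, -, hC⟩ := hφ.exists_bound
  exact MemLpVar.of_bound hp hφ.1.continuous.aestronglyMeasurable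
    (Eventually.of_forall fun x => (hC x).1)

theorem IsTestFunction.memLpVar_gradient (hp : IsBoundedExponent Ω p P) {φ : E N → ℝ}
    (hφ : IsTestFunction Ω φ) : MemLpVar Ω p (gradient φ) := by
  obtain ⟨C, -, hC⟩ := hφ.exists_bound
  exact MemLpVar.of_bound hp hφ.continuous_gradient.aestronglyMeasurable
    (Eventually.of_forall fun x => (hC x).2)

theorem enorm_setIntegral_mul_le {f g : E N → ℝ} {C : ℝ} (hg : ∀ x, |g x| ≤ C) :
    ‖∫ x in Ω, f x * g x‖ₑ ≤ ENNReal.ofReal C * ∫⁻ x in Ω, ‖f x‖ₑ := by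
  refine (enorm_integral_le_lintegral_enorm _).trans ?_
  rw [← lintegral_const_mul' _ _ ENNReal.ofReal_ne_top]
  refine lintegral_mono fun x => ?_
  rw [enorm_mul, mul_comm]
  gcongr
  rw [← ofReal_norm]
  exact ENNReal.ofReal_le_ofReal (hg x)

theorem integrableOn_mul_of_bound {f g : E N → ℝ} {C : ℝ} (hf : IntegrableOn f Ω)
    (hg : Continuous g) (hC : ∀ x, |g x| ≤ C) : IntegrableOn (fun x => f x * g x) Ω :=
  Integrable.mul_bdd hf hg.aestronglyMeasurable (Eventually.of_forall hC)

theorem norm_coord_le (x : E N) (i : Fin N) : |x i| ≤ ‖x‖ := PiLp.norm_apply_le x i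

theorem IntegrableOn.coord {G : E N → E N} (hG : IntegrableOn G Ω) (i : Fin N) :
    IntegrableOn (fun x => G x i) Ω :=
  (EuclideanSpace.proj (𝕜 := ℝ) i).integrable_comp hG

/-- A modular limit of test functions and of their gradients belongs to `W₀^{1,p(x)}(Ω)`: the weak
gradient identity passes to the limit. -/
theorem MemW0.of_approx (hp : IsBoundedExponent Ω p P) {u : E N → ℝ} {G : E N → E N}
    (hu : MemLpVar Ω p u) (hG : MemLpVar Ω p G)
    (happ : ∀ ε : ℝ≥0∞, 0 < ε → ∃ φ : E N → ℝ, IsTestFunction Ω φ ∧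
      modular Ω p (fun x => u x - φ x) < ε ∧ modular Ω p (fun x => G x - gradient φ x) < ε) :
    MemW0 Ω p u G := by
  refine ⟨⟨hu, hG, (hu.integrableOn hp).locallyIntegrableOn, (hG.integrableOn hp).locallyIntegrableOn,
    fun φ hφ i => ?_⟩, happ⟩
  obtain ⟨C, hC0, hC⟩ := hφ.exists_bound
  rw [← sub_eq_zero, ← enorm_eq_zero]
  refine le_antisymm (ENNReal.le_of_forall_pos_le_add fun ε hε _ => ?_) zero_le
  obtain ⟨η, hη, hηε⟩ : ∃ η : ℝ≥0∞, 0 < η ∧ ENNReal.ofReal C * η + ENNReal.ofReal C * η ≤ ε := by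
    refine ⟨ENNReal.ofReal (ε / (2 * (C + 1))), by
      rw [ENNReal.ofReal_pos]; positivity, ?_⟩
    rw [← ENNReal.ofReal_mul hC0, ← ENNReal.ofReal_add (by positivity) (by positivity),
      ← ENNReal.ofReal_coe_nnreal]
    refine ENNReal.ofReal_le_ofReal ?_
    have : (0 : ℝ) < ε := hε
    have h2 : C * (ε / (2 * (C + 1))) + C * (ε / (2 * (C + 1))) = ε * (C / (C + 1)) := by
      field_simp; ring
    rw [h2]
    exact mul_le_of_le_one_right this.le ((div_le_one (by positivity)).2 (by linarith))
  obtain ⟨δ, hδ, hδη⟩ := exists_modular_lt_imp_lintegral_le hp hη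
  obtain ⟨ψ, hψ, h1, h2⟩ := happ δ hδ
  have hu1 := hu.integrableOn hp
  have hG1 := IntegrableOn.coord (hG.integrableOn hp) i
  have hψ1 := (hψ.memLpVar hp).integrableOn hp
  have hψ2 := IntegrableOn.coord ((hψ.memLpVar_gradient hp).integrableOn hp) i
  have hcφ : Continuous fun x => gradient φ x i :=
    (EuclideanSpace.proj (𝕜 := ℝ) i).continuous.comp hφ.continuous_gradient
  have hbφ : ∀ x, |gradient φ x i| ≤ C := fun x => (norm_coord_le _ i).trans (hC x).2
  have hbφ' : ∀ x, |φ x| ≤ C := fun x => (hC x).1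
  have key : (∫ x in Ω, u x * gradient φ x i) - - ∫ x in Ω, G x i * φ x =
      (∫ x in Ω, (u x - ψ x) * gradient φ x i) + ∫ x in Ω, (G x i - gradient ψ x i) * φ x := by
    simp only [sub_mul]
    rw [integral_sub (integrableOn_mul_of_bound hu1 hcφ hbφ)
        (integrableOn_mul_of_bound hψ1 hcφ hbφ),
      integral_sub (integrableOn_mul_of_bound hG1 hφ.1.continuous hbφ')
        (integrableOn_mul_of_bound hψ2 hφ.1.continuous hbφ'),
      hψ.integral_mul_gradient hφ i]
    ring
  rw [key, zero_add]
  refine (enorm_add_le _ _).trans (le_trans (add_le_add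
    ((enorm_setIntegral_mul_le hbφ).trans ?_) ((enorm_setIntegral_mul_le hbφ').trans ?_)) hηε)
  · gcongr
    exact hδη _ _ h1
  · gcongr
    refine le_trans (lintegral_mono fun x => ?_) (hδη _ _ h2)
    rw [← ofReal_norm, ← ofReal_norm]
    exact ENNReal.ofReal_le_ofReal (norm_coord_le (G x - gradient ψ x) i)

theorem IsTestFunction.memW0 (hp : IsBoundedExponent Ω p P) {φ : E N → ℝ}
    (hφ : IsTestFunction Ω φ) : MemW0 Ω p φ (gradient φ) := by
  refine MemW0.of_approx hp (hφ.memLpVar hp) (hφ.memLpVar_gradient hp) fun ε hε => ⟨φ, hφ, ?_⟩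
  have : ∀ (F : Type) [NormedAddCommGroup F], modular Ω p (fun _ => (0 : F)) = 0 := by
    intro F _
    unfold modular
    refine (lintegral_congr_ae (g := fun _ => 0) ?_).trans lintegral_zero
    filter_upwards [hp.ae_mem] with x hx
    simp [ENNReal.zero_rpow_of_pos (lt_of_lt_of_le one_pos (hp.one_le x hx))]
  simpa [this] using hε

theorem modular_congr {F : Type*} [NormedAddCommGroup F] {g h : E N → F}
    (hgh : ∀ᵐ x ∂(volume.restrict Ω), g x = h x) : modular Ω p g = modular Ω p h := by
  refine lintegral_congr_ae ?_
  filter_upwards [hgh] with x hx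
  rw [hx]

theorem MemW0.congr (hp : IsBoundedExponent Ω p P) {u u' : E N → ℝ} {G G' : E N → E N}
    (h : MemW0 Ω p u G) (hu : ∀ᵐ x ∂(volume.restrict Ω), u x = u' x)
    (hG : ∀ᵐ x ∂(volume.restrict Ω), G x = G' x) : MemW0 Ω p u' G' := by
  refine MemW0.of_approx hp ⟨h.memLp.1.congr hu, (modular_congr hu).symm ▸ h.memLp.2⟩
    ⟨h.memLp_grad.1.congr hG, (modular_congr hG).symm ▸ h.memLp_grad.2⟩ fun ε hε => ?_
  obtain ⟨φ, hφ, h1, h2⟩ := h.approx ε hε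
  refine ⟨φ, hφ, ?_, ?_⟩
  · rwa [← modular_congr (g := fun x => u x - φ x)]
    filter_upwards [hu] with x hx
    rw [hx]
  · rwa [← modular_congr (g := fun x => G x - gradient φ x)]
    filter_upwards [hG] with x hx
    rw [hx]

/-- Summable modulars force convergence almost everywhere. -/
theorem ae_tendsto_of_tsum_modular_ne_top (hp : IsBoundedExponent Ω p P) {u : E N → ℝ}
    {φ : ℕ → E N → ℝ} (hu : AEStronglyMeasurable u (volume.restrict Ω))
    (hφ : ∀ n, AEStronglyMeasurable (φ n) (volume.restrict Ω))
    (hs : ∑' n, modular Ω p (fun x => u x - φ n x) ≠ ∞) :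
    ∀ᵐ x ∂(volume.restrict Ω), Tendsto (fun n => φ n x) atTop (𝓝 (u x)) := by
  unfold modular at hs
  rw [← lintegral_tsum (f := fun n x => ‖u x - φ n x‖ₑ ^ p x)
    fun n => hp.aemeasurable_rpow (hu.sub (hφ n))] at hs
  have hm : AEMeasurable (fun x => ∑' n, ‖u x - φ n x‖ₑ ^ p x) (volume.restrict Ω) :=
    AEMeasurable.tsum fun n => hp.aemeasurable_rpow (hu.sub (hφ n))
  filter_upwards [ae_lt_top' hm hs, hp.ae_mem] with x hx hxΩ
  have h0 := ENNReal.tendsto_atTop_zero_of_tsum_ne_top hx.ne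
  have hpx : 0 < p x := lt_of_lt_of_le one_pos (hp.one_le x hxΩ)
  have h1 : Tendsto (fun n => ‖u x - φ n x‖ₑ) atTop (𝓝 0) := by
    have := (ENNReal.continuous_rpow_const (y := (p x)⁻¹)).tendsto 0 |>.comp h0
    simpa [Function.comp_def, ENNReal.rpow_rpow_inv hpx.ne', ENNReal.zero_rpow_of_pos, hpx]
      using this
  rw [tendsto_iff_edist_tendsto_0]
  simpa [edist_eq_enorm_sub, enorm_sub_rev] using h1

/-- The chain rule in `W₀^{1,p(x)}(Ω)` for a smooth function of two variables with bounded
derivatives: composing the approximating test functions gives approximating test functions. -/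
theorem MemW0.comp_of_bounded_fderiv (hp : IsBoundedExponent Ω p P) {u v : E N → ℝ}
    {G H : E N → E N} (hu : MemW0 Ω p u G) (hv : MemW0 Ω p v H) {T : ℝ × ℝ → ℝ}
    (hT : ContDiff ℝ ((⊤ : ℕ∞) : WithTop ℕ∞) T) {L : ℝ} (hL : ∀ z, ‖fderiv ℝ T z‖ ≤ L)
    (hT0 : T 0 = 0) :
    MemW0 Ω p (fun x => T (u x, v x)) (fun x => fderiv ℝ T (u x, v x) (1, 0) • G x +
      fderiv ℝ T (u x, v x) (0, 1) • H x) := by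
  have hL0 : 0 ≤ L := (norm_nonneg _).trans (hL 0)
  have hTd : Differentiable ℝ T := hT.differentiable (by simp)
  have hTc : Continuous (fderiv ℝ T) := hT.continuous_fderiv (by simp)
  have hLip : ∀ z w, |T z - T w| ≤ L * (|z.1 - w.1| + |z.2 - w.2|) := by
    intro z w
    have := Convex.norm_image_sub_le_of_norm_fderiv_le (𝕜 := ℝ) (f := T) (s := univ) (C := L)
      (fun x _ => hTd x) (fun x _ => hL x) convex_univ (mem_univ w) (mem_univ z)
    rw [Real.norm_eq_abs] at this
    refine this.trans (mul_le_mul_of_nonneg_left ?_ hL0)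
    rw [Prod.norm_def]
    exact max_le (le_add_of_nonneg_right (abs_nonneg _)) (le_add_of_nonneg_left (abs_nonneg _))
  have hb : ∀ z (e : ℝ × ℝ), ‖e‖ ≤ 1 → |fderiv ℝ T z e| ≤ L := fun z e he =>
    ((fderiv ℝ T z).le_opNorm e).trans <|
      (mul_le_mul (hL z) he (norm_nonneg _) hL0).trans (mul_one L).le
  have he1 : ‖((1 : ℝ), (0 : ℝ))‖ ≤ 1 := by simp [Prod.norm_def]
  have he2 : ‖((0 : ℝ), (1 : ℝ))‖ ≤ 1 := by simp [Prod.norm_def]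
  have hum := hu.memLp.1
  have hvm := hv.memLp.1
  have huv : AEStronglyMeasurable (fun x => (u x, v x)) (volume.restrict Ω) := hum.prodMk hvm
  have hDm : ∀ e : ℝ × ℝ, AEStronglyMeasurable (fun x => fderiv ℝ T (u x, v x) e)
      (volume.restrict Ω) := fun e =>
    (hTc.clm_apply continuous_const).comp_aestronglyMeasurable huv
  have hmem1 : MemLpVar Ω p (fun x => T (u x, v x)) := by
    refine MemLpVar.of_norm_le hp (h := fun x => |u x| + |v x|) (C := L)
      (hT.continuous.comp_aestronglyMeasurable huv) (MemLpVar.add hp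
        (MemLpVar.of_norm_le hp hum.norm hu.memLp (C := 1) (by simp))
        (MemLpVar.of_norm_le hp hvm.norm hv.memLp (C := 1) (by simp))) ?_
    refine Eventually.of_forall fun x => ?_
    have := hLip (u x, v x) 0
    rw [hT0] at this
    simp only [sub_zero, Prod.fst_zero, Prod.snd_zero] at this
    rwa [Real.norm_eq_abs, Real.norm_eq_abs, abs_of_nonneg (by positivity : 0 ≤ |u x| + |v x|)]
  have hmem2 : ∀ (K : E N → E N) (e : ℝ × ℝ), MemLpVar Ω p K → ‖e‖ ≤ 1 →
      MemLpVar Ω p (fun x => fderiv ℝ T (u x, v x) e • K x) := fun K e hK he =>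
    MemLpVar.of_norm_le hp ((hDm e).smul hK.1) hK (C := L) (Eventually.of_forall fun x => by
      rw [norm_smul]; gcongr; exact hb _ _ he)
  -- approximating sequences with summable modulars
  choose φ hφ hφ1 hφ2 using fun n : ℕ => hu.approx (2⁻¹ ^ n) (by simp [pos_iff_ne_zero])
  choose ψ hψ hψ1 hψ2 using fun n : ℕ => hv.approx (2⁻¹ ^ n) (by simp [pos_iff_ne_zero])
  have hgeo : (∑' n : ℕ, (2⁻¹ : ℝ≥0∞) ^ n) ≠ ∞ := by
    rw [ENNReal.tsum_geometric]; simp [ENNReal.one_sub_inv_two]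
  have hgeo0 : Tendsto (fun n : ℕ => (2⁻¹ : ℝ≥0∞) ^ n) atTop (𝓝 0) :=
    ENNReal.tendsto_atTop_zero_of_tsum_ne_top hgeo
  have hae1 := ae_tendsto_of_tsum_modular_ne_top hp hum
    (fun n => (hφ n).1.continuous.aestronglyMeasurable)
    (ne_top_of_le_ne_top hgeo (ENNReal.tsum_le_tsum fun n => (hφ1 n).le))
  have hae2 := ae_tendsto_of_tsum_modular_ne_top hp hvm
    (fun n => (hψ n).1.continuous.aestronglyMeasurable)
    (ne_top_of_le_ne_top hgeo (ENNReal.tsum_le_tsum fun n => (hψ1 n).le))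
  have hφm : ∀ n, AEStronglyMeasurable (φ n) (volume.restrict Ω) :=
    fun n => (hφ n).1.continuous.aestronglyMeasurable
  have hψm : ∀ n, AEStronglyMeasurable (ψ n) (volume.restrict Ω) :=
    fun n => (hψ n).1.continuous.aestronglyMeasurable
  have hDnm : ∀ n (e : ℝ × ℝ), AEStronglyMeasurable (fun x => fderiv ℝ T (φ n x, ψ n x) e)
      (volume.restrict Ω) := fun n e =>
    (hTc.clm_apply continuous_const).comp_aestronglyMeasurable ((hφm n).prodMk (hψm n))
  -- the coefficients converge, and multiply a fixed gradient
  have hlim : ∀ (K : E N → E N) (e : ℝ × ℝ), MemLpVar Ω p K → ‖e‖ ≤ 1 →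
      Tendsto (fun n => modular Ω p fun x =>
        (fderiv ℝ T (u x, v x) e - fderiv ℝ T (φ n x, ψ n x) e) • K x) atTop (𝓝 0) := by
    intro K e hK he
    unfold modular
    rw [← lintegral_zero (μ := volume.restrict Ω) (α := E N)]
    have hK2 : MemLpVar Ω p fun x => (2 * L) • K x :=
      MemLpVar.of_norm_le hp (hK.1.const_smul (2 * L)) hK (C := 2 * L) (Eventually.of_forall fun x => by
        rw [norm_smul, Real.norm_of_nonneg (by positivity)])
    refine tendsto_lintegral_of_dominated_convergence' (fun x => ‖(2 * L) • K x‖ₑ ^ p x)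
      (fun n => hp.aemeasurable_rpow (((hDm e).sub (hDnm n e)).smul hK.1)) (fun n => ?_)
      hK2.2.ne ?_
    · filter_upwards [hp.ae_mem] with x hx
      refine ENNReal.rpow_le_rpow ?_ (by linarith [hp.one_le x hx])
      rw [← ofReal_norm, ← ofReal_norm, norm_smul, norm_smul]
      refine ENNReal.ofReal_le_ofReal (mul_le_mul_of_nonneg_right ?_ (norm_nonneg _))
      rw [Real.norm_of_nonneg (by positivity : 0 ≤ 2 * L), two_mul]
      exact (norm_sub_le _ _).trans (add_le_add (hb _ _ he) (hb _ _ he))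
    · filter_upwards [hp.ae_mem, hae1, hae2] with x hx h1 h2
      have hpx : 0 < p x := lt_of_lt_of_le one_pos (hp.one_le x hx)
      have h3 : Tendsto (fun n => fderiv ℝ T (φ n x, ψ n x) e) atTop
          (𝓝 (fderiv ℝ T (u x, v x) e)) :=
        ((hTc.clm_apply continuous_const).tendsto (u x, v x)).comp (h1.prodMk_nhds h2)
      have h4 : Tendsto (fun n => ‖(fderiv ℝ T (u x, v x) e - fderiv ℝ T (φ n x, ψ n x) e) • K x‖ₑ)
          atTop (𝓝 0) := by
        have := ((tendsto_const_nhds (x := fderiv ℝ T (u x, v x) e)).sub h3).smul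
          (tendsto_const_nhds (x := K x))
        simpa using this.enorm
      simpa [Function.comp_def, ENNReal.zero_rpow_of_pos hpx] using
        ((ENNReal.continuous_rpow_const (y := p x)).tendsto 0).comp h4
  -- the gradients converge, and are multiplied by bounded coefficients
  have hlim2 : ∀ (K : E N → E N) (e : ℝ × ℝ) (κ : ℕ → E N → E N), MemLpVar Ω p K → ‖e‖ ≤ 1 →
      (∀ n, modular Ω p (fun x => K x - κ n x) < 2⁻¹ ^ n) →
      Tendsto (fun n => modular Ω p fun x => (fderiv ℝ T (u x, v x) e) • K x -
        fderiv ℝ T (φ n x, ψ n x) e • κ n x) atTop (𝓝 0) := by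
    intro K e κ hK he hκ
    have hle : ∀ n, modular Ω p (fun x => (fderiv ℝ T (u x, v x) e) • K x -
        fderiv ℝ T (φ n x, ψ n x) e • κ n x) ≤ 2 ^ P * (modular Ω p (fun x =>
        (fderiv ℝ T (u x, v x) e - fderiv ℝ T (φ n x, ψ n x) e) • K x) +
        ENNReal.ofReal (max L 1) ^ P * 2⁻¹ ^ n) := by
      intro n
      have h1 := modular_add_le hp (g := fun x =>
        (fderiv ℝ T (u x, v x) e - fderiv ℝ T (φ n x, ψ n x) e) • K x)
        (h := fun x => fderiv ℝ T (φ n x, ψ n x) e • (K x - κ n x))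
        (((hDm e).sub (hDnm n e)).smul hK.1)
      have h2 : modular Ω p (fun x => fderiv ℝ T (φ n x, ψ n x) e • (K x - κ n x)) ≤
          ENNReal.ofReal (max L 1) ^ P * 2⁻¹ ^ n :=
        (modular_le_of_norm_le hp (h := fun x => K x - κ n x) (le_max_right L 1)
          (Eventually.of_forall fun x => by
            rw [norm_smul]
            gcongr
            exact (hb _ _ he).trans (le_max_left _ _))).trans (by gcongr; exact (hκ n).le)
      refine (Eq.trans_le ?_ h1).trans (by gcongr)
      congr 1
      ext1 x
      rw [sub_smul, smul_sub]
      abel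
    refine tendsto_of_tendsto_of_tendsto_of_le_of_le tendsto_const_nhds ?_ (fun _ => zero_le) hle
    have hc : ENNReal.ofReal (max L 1) ^ P ≠ ∞ :=
      ENNReal.rpow_ne_top_of_ne_zero (by simp) (by simp)
    have hc2 : (2 : ℝ≥0∞) ^ P ≠ ∞ := ENNReal.rpow_ne_top_of_ne_zero (by simp) (by simp)
    have := ENNReal.Tendsto.const_mul ((hlim K e hK he).add
      (ENNReal.Tendsto.const_mul hgeo0 (Or.inr hc))) (Or.inr hc2)
    simpa using this
  refine MemW0.of_approx hp hmem1
    (MemLpVar.add hp (hmem2 G _ hu.memLp_grad he1) (hmem2 H _ hv.memLp_grad he2)) fun ε hε => ?_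
  have hA : Tendsto (fun n => modular Ω p fun x => T (u x, v x) - T (φ n x, ψ n x)) atTop (𝓝 0) := by
    have hle : ∀ n, modular Ω p (fun x => T (u x, v x) - T (φ n x, ψ n x)) ≤
        ENNReal.ofReal (max L 1) ^ P * (2 ^ P * (2⁻¹ ^ n + 2⁻¹ ^ n)) := by
      intro n
      have h1 := modular_le_of_norm_le hp (g := fun x => T (u x, v x) - T (φ n x, ψ n x))
        (h := fun x => |u x - φ n x| + |v x - ψ n x|) (le_max_right L 1)
        (Eventually.of_forall fun x => by
          rw [Real.norm_eq_abs, Real.norm_of_nonneg (by positivity)]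
          exact (hLip _ _).trans (by gcongr; exact le_max_left _ _))
      refine h1.trans ?_
      gcongr
      refine (modular_add_le hp (hum.sub (hφm n)).norm).trans ?_
      gcongr
      · refine le_of_eq_of_le ?_ (hφ1 n).le
        simp [modular]
      · refine le_of_eq_of_le ?_ (hψ1 n).le
        simp [modular]
    refine tendsto_of_tendsto_of_tendsto_of_le_of_le tendsto_const_nhds ?_ (fun _ => zero_le) hle
    have hc : ENNReal.ofReal (max L 1) ^ P ≠ ∞ :=
      ENNReal.rpow_ne_top_of_ne_zero (by simp) (by simp)
    have hc2 : (2 : ℝ≥0∞) ^ P ≠ ∞ := ENNReal.rpow_ne_top_of_ne_zero (by simp) (by simp)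
    have := ENNReal.Tendsto.const_mul (ENNReal.Tendsto.const_mul (hgeo0.add hgeo0)
      (Or.inr hc2)) (Or.inr hc)
    simpa using this
  have hB : Tendsto (fun n => modular Ω p fun x => (fderiv ℝ T (u x, v x) (1, 0) • G x +
      fderiv ℝ T (u x, v x) (0, 1) • H x) - gradient (fun y => T (φ n y, ψ n y)) x)
      atTop (𝓝 0) := by
    have h1 := hlim2 G (1, 0) (fun n => gradient (φ n)) hu.memLp_grad he1 hφ2
    have h2 := hlim2 H (0, 1) (fun n => gradient (ψ n)) hv.memLp_grad he2 hψ2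
    have hc2 : (2 : ℝ≥0∞) ^ P ≠ ∞ := ENNReal.rpow_ne_top_of_ne_zero (by simp) (by simp)
    have h3 := ENNReal.Tendsto.const_mul (h1.add h2) (Or.inr hc2)
    rw [add_zero, mul_zero] at h3
    refine tendsto_of_tendsto_of_tendsto_of_le_of_le tendsto_const_nhds h3 (fun _ => zero_le)
      fun n => ?_
    refine le_of_eq_of_le ?_ (modular_add_le hp (((hDm _).smul hu.memLp_grad.1).sub
      ((hDnm n _).smul (hφ n).continuous_gradient.aestronglyMeasurable)))
    congr 1
    ext1 x
    rw [gradient_of_hasFDerivAt_comp (hTd _) ((hφ n).differentiable x) ((hψ n).differentiable x)]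
    abel
  obtain ⟨n, h1, h2⟩ := ((hA.eventually (gt_mem_nhds hε)).and (hB.eventually (gt_mem_nhds hε))).exists
  refine ⟨fun y => T (φ n y, ψ n y), ⟨hT.comp ((hφ n).1.prodMk (hψ n).1), ?_⟩, h1, h2⟩
  have hcs : ∀ x, x ∉ tsupport (φ n) ∪ tsupport (ψ n) → T (φ n x, ψ n x) = 0 := fun x hx => by
    rw [mem_union, not_or] at hx
    rw [image_eq_zero_of_notMem_tsupport hx.1, image_eq_zero_of_notMem_tsupport hx.2]
    exact hT0
  refine ⟨HasCompactSupport.intro ((hφ n).2.1.isCompact.union (hψ n).2.1.isCompact) hcs, ?_⟩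
  refine (closure_minimal (fun x hx => by_contra fun h => Function.mem_support.1 hx (hcs x h))
    ((isClosed_tsupport _).union (isClosed_tsupport _))).trans
    (union_subset (hφ n).2.2 (hψ n).2.2)

/-- The chain rule in `W₀^{1,p(x)}(Ω)` for a function of two variables which is smooth near a
compact set containing the essential range. -/
theorem MemW0.comp (hp : IsBoundedExponent Ω p P) {u v : E N → ℝ}
    {G H : E N → E N} (hu : MemW0 Ω p u G) (hv : MemW0 Ω p v H) {T D₁ D₂ : ℝ × ℝ → ℝ}
    {K U : Set (ℝ × ℝ)} (hK : IsCompact K) (hU : IsOpen U) (hKU : K ⊆ U)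
    (hT : ContDiffOn ℝ ((⊤ : ℕ∞) : WithTop ℕ∞) T U)
    (hD : ∀ z ∈ K, HasFDerivAt T
      (D₁ z • ContinuousLinearMap.fst ℝ ℝ ℝ + D₂ z • ContinuousLinearMap.snd ℝ ℝ ℝ) z)
    (hT0 : T 0 = 0)
    (huv : ∀ᵐ x ∂(volume.restrict Ω), (u x, v x) ∈ K) :
    MemW0 Ω p (fun x => T (u x, v x))
      (fun x => D₁ (u x, v x) • G x + D₂ (u x, v x) • H x) := by
  obtain ⟨χ, hχ, hχc, hχU, hχ1, -⟩ := exists_contDiff_cutoff hK hU hKU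
  have hS : ContDiff ℝ ((⊤ : ℕ∞) : WithTop ℕ∞) (fun z => χ z * T z) := by
    refine contDiff_iff_contDiffAt.2 fun z => ?_
    by_cases hz : z ∈ tsupport χ
    · exact hχ.contDiffAt.mul (hT.contDiffAt (hU.mem_nhds (hχU hz)))
    · refine contDiffAt_const (c := (0 : ℝ)) |>.congr_of_eventuallyEq ?_
      filter_upwards [(isClosed_tsupport χ).isOpen_compl.mem_nhds hz] with y hy
      rw [image_eq_zero_of_notMem_tsupport hy, zero_mul]
  have hSc : HasCompactSupport (fun z => χ z * T z) := hχc.mul_right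
  obtain ⟨L, hL⟩ := (hSc.fderiv ℝ).exists_bound_of_continuous (hS.continuous_fderiv (by simp))
  have hEq : ∀ z ∈ K, (fun y => χ y * T y) =ᶠ[𝓝 z] T := fun z hz => by
    filter_upwards [hχ1.filter_mono (nhds_le_nhdsSet hz)] with y hy
    rw [hy, one_mul]
  refine (MemW0.comp_of_bounded_fderiv hp hu hv hS hL (by simp [hT0])).congr hp ?_ ?_
  · filter_upwards [huv] with x hx using (hEq _ hx).eq_of_nhds
  · filter_upwards [huv] with x hx
    rw [(hEq _ hx).fderiv_eq, (hD _ hx).fderiv]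
    simp

end Sobolev

/-! ### Functions with vanishing weak gradient -/

section ZeroGradient

variable {N : ℕ} {Ω : Set (E N)}

/-- On a ball compactly contained in `Ω`, the mollifications of a function with vanishing weak
gradient are constant. -/
theorem IsWeakGradient.exists_ae_eq_const_ball {F : E N → ℝ} (hF : IsWeakGradient Ω F 0) {y : E N}
    {r : ℝ} (hr : 0 < r) (hy : Metric.closedBall y (2 * r) ⊆ Ω) :
    ∃ c, ∀ᵐ x ∂(volume.restrict (Metric.ball y r)), F x = c := by
  set g : E N → ℝ := (Metric.closedBall y (2 * r)).indicator F with hg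
  have hgi : Integrable g :=
    (hF.1.integrableOn_compact_subset hy (isCompact_closedBall _ _)).integrable_indicator
      measurableSet_closedBall
  let φ : ℕ → ContDiffBump (0 : E N) := fun n =>
    { rIn := r / (2 * (n + 1)), rOut := r / (n + 1), rIn_pos := by positivity
      rIn_lt_rOut := by
        refine div_lt_div_of_pos_left hr (by positivity) ?_
        have : (0 : ℝ) < n + 1 := by positivity
        linarith }
  have hout : Tendsto (fun n => (φ n).rOut) atTop (𝓝 0) := by
    have := (tendsto_one_div_add_atTop_nhds_zero_nat (𝕜 := ℝ)).const_mul r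
    simpa [φ, div_eq_mul_inv] using this
  have hconv := ContDiffBump.ae_convolution_tendsto_right_of_locallyIntegrable (μ := volume)
    (K := 2) hout (Eventually.of_forall fun n => by
      simp only [φ]
      apply le_of_eq
      field_simp) hgi.locallyIntegrable
  set ψ : ℕ → E N → ℝ := fun n => (φ n).normed volume with hψ
  have hψs : ∀ n, ContDiff ℝ ((⊤ : ℕ∞) : WithTop ℕ∞) (ψ n) := fun n => (φ n).contDiff_normed
  have hψc : ∀ n, HasCompactSupport (ψ n) := fun n => (φ n).hasCompactSupport_normed
  -- each mollification is constant on the ball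
  have hconst : ∀ n, ∀ x ∈ Metric.ball y r,
      (convolution (ψ n) g (ContinuousLinearMap.lsmul ℝ ℝ) volume) x =
      (convolution (ψ n) g (ContinuousLinearMap.lsmul ℝ ℝ) volume) y := by
    intro n x hx
    have hd : ∀ z, HasFDerivAt (convolution (ψ n) g (ContinuousLinearMap.lsmul ℝ ℝ) volume)
        (convolution (fderiv ℝ (ψ n)) g ((ContinuousLinearMap.lsmul ℝ ℝ).precompL (E N)) volume z)
        z := fun z => (hψc n).hasFDerivAt_convolution_left _ ((hψs n).of_le (by simp))
          hgi.locallyIntegrable z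
    have hzero : ∀ z ∈ Metric.ball y r, fderiv ℝ (convolution (ψ n) g
        (ContinuousLinearMap.lsmul ℝ ℝ) volume) z = 0 := by
      intro z hz
      have hdc : Continuous (fderiv ℝ (ψ n)) := (hψs n).continuous_fderiv (by simp)
      have hce : ConvolutionExists (fderiv ℝ (ψ n)) g
          ((ContinuousLinearMap.lsmul ℝ ℝ).precompL (E N)) volume :=
        ((hψc n).fderiv ℝ).convolutionExists_left _ hdc hgi.locallyIntegrable
      rw [(hd z).fderiv]
      -- the reflected and translated kernel is a test function
      have hsupp : tsupport (fun t => ψ n (z - t)) ⊆ Metric.closedBall y (2 * r) := by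
        refine closure_minimal (fun t ht => ?_) Metric.isClosed_closedBall
        have h1 : z - t ∈ Function.support (ψ n) := ht
        rw [hψ] at h1
        simp only [(φ n).support_normed_eq, Metric.mem_ball, dist_zero_right] at h1
        have h2 : (φ n).rOut ≤ r := div_le_self hr.le (by linarith [n.cast_nonneg (α := ℝ)])
        have h3 : dist t z < r := by
          rw [dist_comm, dist_eq_norm]; exact h1.trans_le h2
        rw [Metric.mem_ball] at hz
        rw [Metric.mem_closedBall]
        linarith [dist_triangle t z y]
      have htest : IsTestFunction Ω (fun t => ψ n (z - t)) := by
        refine ⟨(hψs n).comp (contDiff_const.sub contDiff_id), ?_, hsupp.trans hy⟩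
        exact (isCompact_closedBall _ _).of_isClosed_subset (isClosed_tsupport _) hsupp
      have hgrad : ∀ t, ∀ i, gradient (fun t => ψ n (z - t)) t i =
          - fderiv ℝ (ψ n) (z - t) (EuclideanSpace.single i 1) := by
        intro t i
        have h1 : HasFDerivAt (fun t => ψ n (z - t))
            ((fderiv ℝ (ψ n) (z - t)).comp (- ContinuousLinearMap.id ℝ (E N))) t :=
          HasFDerivAt.comp t (((hψs n).differentiable (by simp) _).hasFDerivAt)
            ((hasFDerivAt_id t).const_sub z)
        rw [gradient_apply, h1.fderiv]
        simp
      refine ContinuousLinearMap.coe_injective ((EuclideanSpace.basisFun (Fin N) ℝ).toBasis.ext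
        fun i => ?_)
      have hsupp0 : ∀ t, t ∉ Ω → F t * gradient (fun t => ψ n (z - t)) t i = 0 := by
        intro t ht
        rw [gradient_eq_zero_of_notMem_tsupport fun h => ht (htest.2.2 h)]
        simp
      have h2 := hF.2.2 _ htest i
      simp only [Pi.zero_apply, PiLp.zero_apply, zero_mul, integral_zero, neg_zero] at h2
      rw [setIntegral_eq_integral_of_forall_compl_eq_zero hsupp0] at h2
      simp only [OrthonormalBasis.coe_toBasis, EuclideanSpace.basisFun_apply,
        ContinuousLinearMap.coe_coe, zero_apply]
      have h3 : (convolution (fderiv ℝ (ψ n)) g ((ContinuousLinearMap.lsmul ℝ ℝ).precompL (E N))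
          volume z) (EuclideanSpace.single i 1) =
          ∫ t, fderiv ℝ (ψ n) (z - t) (EuclideanSpace.single i 1) * g t := by
        rw [convolution_eq_swap, ContinuousLinearMap.integral_apply]
        · rfl
        · exact (convolutionExistsAt_iff_integrable_swap).1 (hce z)
      rw [h3]
      have h4 : (fun t => fderiv ℝ (ψ n) (z - t) (EuclideanSpace.single i 1) * g t) =
          fun t => - (F t * gradient (fun t => ψ n (z - t)) t i) := by
        ext1 t
        by_cases ht : t ∈ Metric.closedBall y (2 * r)
        · rw [hg, indicator_of_mem ht, hgrad]; ring
        · have hΩ : t ∉ tsupport (fun t => ψ n (z - t)) := fun h => ht (hsupp h)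
          rw [hg, indicator_of_notMem ht, gradient_eq_zero_of_notMem_tsupport hΩ]
          simp
      rw [h4, integral_neg, h2, neg_zero]
    exact (convex_ball y r).is_const_of_fderivWithin_eq_zero (𝕜 := ℝ)
      (fun z hz => (hd z).differentiableAt.differentiableWithinAt)
      (fun z hz => by rw [fderivWithin_of_isOpen Metric.isOpen_ball hz, hzero z hz])
      hx (Metric.mem_ball_self hr)
  have hae : ∀ᵐ x ∂(volume.restrict (Metric.ball y r)),
      Tendsto (fun n => (convolution (ψ n) g (ContinuousLinearMap.lsmul ℝ ℝ) volume) y) atTop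
        (𝓝 (F x)) := by
    filter_upwards [ae_restrict_mem measurableSet_ball, ae_restrict_of_ae hconv] with x hx hlim
    have h1 : g x = F x := indicator_of_mem
      (Metric.ball_subset_closedBall.trans (Metric.closedBall_subset_closedBall (by linarith)) hx) F
    rw [h1] at hlim
    exact hlim.congr fun n => hconst n x hx
  have hne : (ae (volume.restrict (Metric.ball y r))).NeBot := by
    rw [ae_neBot, ne_eq, Measure.restrict_eq_zero]
    exact (Metric.measure_ball_pos volume y hr).ne'
  obtain ⟨x₀, hx₀⟩ := hae.exists
  refine ⟨F x₀, ?_⟩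
  filter_upwards [hae] with x hx using tendsto_nhds_unique hx hx₀

/-- A function whose weak gradient vanishes on a connected open set is constant there. -/
theorem IsWeakGradient.exists_ae_eq_const (hΩ : IsOpen Ω) (hc : IsConnected Ω) {F : E N → ℝ}
    (hF : IsWeakGradient Ω F 0) : ∃ c, ∀ᵐ x ∂(volume.restrict Ω), F x = c := by
  have hloc : ∀ y ∈ Ω, ∃ r > 0, Metric.ball y r ⊆ Ω ∧
      ∃ c, ∀ᵐ x ∂(volume.restrict (Metric.ball y r)), F x = c := by
    intro y hy
    obtain ⟨r, hr, hyr⟩ := Metric.nhds_basis_closedBall.mem_iff.1 (hΩ.mem_nhds hy)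
    refine ⟨r / 2, by positivity, (Metric.ball_subset_closedBall.trans
      (Metric.closedBall_subset_closedBall (by linarith))).trans hyr,
      hF.exists_ae_eq_const_ball (by positivity) ?_⟩
    rwa [mul_div_cancel₀ _ two_ne_zero]
  obtain ⟨y₀, hy₀⟩ := hc.nonempty
  obtain ⟨r₀, hr₀, hb₀, c₀, hc₀⟩ := hloc y₀ hy₀
  -- `A S` collects the balls on which `F` equals a constant belonging to `S`
  let A : Set ℝ → Set (E N) := fun S => ⋃₀ {B | ∃ y r, B = Metric.ball y r ∧
    ∃ c ∈ S, ∀ᵐ x ∂(volume.restrict (Metric.ball y r)), F x = c}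
  have hAo : ∀ S, IsOpen (A S) := fun S => isOpen_sUnion fun B ⟨y, r, hB, _⟩ => by
    rw [hB]; exact Metric.isOpen_ball
  have hcover : Ω ⊆ A {c₀} ∪ A {c₀}ᶜ := by
    intro y hy
    obtain ⟨r, hr, -, c, hcy⟩ := hloc y hy
    by_cases h : c = c₀
    · exact Or.inl ⟨_, ⟨y, r, rfl, c, h, hcy⟩, Metric.mem_ball_self hr⟩
    · exact Or.inr ⟨_, ⟨y, r, rfl, c, h, hcy⟩, Metric.mem_ball_self hr⟩
  have hdisj : A {c₀} ∩ A {c₀}ᶜ = ∅ := by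
    rw [eq_empty_iff_forall_notMem]
    rintro z ⟨⟨_, ⟨y, r, rfl, c, hcc, h1⟩, hz1⟩, ⟨_, ⟨y', r', rfl, c', hcc', h2⟩, hz2⟩⟩
    have hop : IsOpen (Metric.ball y r ∩ Metric.ball y' r') :=
      Metric.isOpen_ball.inter Metric.isOpen_ball
    have hpos := hop.measure_pos (volume : Measure (E N)) ⟨z, hz1, hz2⟩
    have hne : (ae (volume.restrict (Metric.ball y r ∩ Metric.ball y' r'))).NeBot := by
      rw [ae_neBot, ne_eq, Measure.restrict_eq_zero]
      exact hpos.ne'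
    obtain ⟨x, hx1, hx2⟩ := ((ae_restrict_of_ae_restrict_of_subset inter_subset_left h1).and
      (ae_restrict_of_ae_restrict_of_subset inter_subset_right h2)).exists
    exact hcc' (by rw [← hx2, hx1]; exact hcc)
  have hsub : Ω ⊆ A {c₀} := by
    by_contra hns
    obtain ⟨y, hy, hyn⟩ := not_subset.1 hns
    have hy2 : y ∈ A {c₀}ᶜ := (hcover hy).resolve_left hyn
    obtain ⟨z, -, hz⟩ := hc.isPreconnected _ _ (hAo {c₀}) (hAo {c₀}ᶜ) hcover
      ⟨y₀, hy₀, _, ⟨y₀, r₀, rfl, c₀, rfl, hc₀⟩, Metric.mem_ball_self hr₀⟩ ⟨y, hy, hy2⟩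
    rw [hdisj] at hz
    exact hz
  refine ⟨c₀, ?_⟩
  rw [ae_restrict_iff' hΩ.measurableSet]
  change volume {x | ¬ (x ∈ Ω → F x = c₀)} = 0
  refine measure_null_of_locally_null _ fun x hx => ?_
  have hxΩ : x ∈ Ω := by
    by_contra h
    exact hx fun h' => absurd h' h
  obtain ⟨_, ⟨y, r, rfl, c, hcc, h1⟩, hz1⟩ := hsub hxΩ
  rw [mem_singleton_iff] at hcc
  subst hcc
  refine ⟨_, inter_mem_nhdsWithin _ (Metric.isOpen_ball.mem_nhds hz1), ?_⟩
  rw [ae_restrict_iff' measurableSet_ball] at h1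
  refine measure_mono_null (fun z hz => ?_) (ae_iff.1 h1)
  have hz' : ¬ (z ∈ Ω → F z = c) := hz.1
  exact fun h => hz' fun _ => h hz.2

end ZeroGradient

/-! ### Homogeneous elliptic fields -/

section Field

variable {N : ℕ}

/-- The properties at one point `x` of the potential `F = A(x, ·)` and of `a(x, ·) = ∇F / s`, where
`s = p(x)`, on which the comparison argument rests. The gradient of `F` is described by its
directional derivatives. -/
structure IsEllipticPotential (s γ Γ : ℝ) (F : E N → ℝ) (a : E N → E N) : Prop where
  one_lt : 1 < s
  nonneg : ∀ ξ, 0 ≤ F ξ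
  hasFDerivAt : ∀ ξ η, HasDerivAt (fun t : ℝ => F (ξ + t • η)) (s * inner ℝ (a ξ) η) 0
  homogeneous : ∀ t : ℝ, 0 ≤ t → ∀ ξ, F (t • ξ) = t ^ s * F ξ
  map_zero : a 0 = 0
  differentiableAt : ∀ j, ∀ ξ, ξ ≠ 0 → DifferentiableAt ℝ (fun ζ => a ζ j) ξ
  pos : 0 < γ
  elliptic : ∀ ξ, ξ ≠ 0 → ∀ η : E N, γ * ‖ξ‖ ^ (s - 2) * ‖η‖ ^ 2 ≤
    ∑ i, ∑ j, fderiv ℝ (fun ζ => a ζ j) ξ (EuclideanSpace.single i 1) * η i * η j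
  growth : ∀ ξ, ξ ≠ 0 →
    ∑ i, ∑ j, |fderiv ℝ (fun ζ => a ζ j) ξ (EuclideanSpace.single i 1)| ≤ Γ * ‖ξ‖ ^ (s - 2)

variable {s γ Γ : ℝ} {F : E N → ℝ} {a : E N → E N}

namespace IsEllipticPotential

theorem map_zero' (h : IsEllipticPotential s γ Γ F a) : F 0 = 0 := by
  have := h.homogeneous 0 le_rfl 0
  rwa [zero_smul, Real.zero_rpow (by linarith [h.one_lt]), zero_mul] at this

theorem hasDerivAt_line (h : IsEllipticPotential s γ Γ F a) (ξ η : E N) (t : ℝ) :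
    HasDerivAt (fun t : ℝ => F (ξ + t • η)) (s * inner ℝ (a (ξ + t • η)) η) t := by
  have h1 := h.hasFDerivAt (ξ + t • η) η
  have h2 : HasDerivAt (fun r : ℝ => r - t) 1 t := (hasDerivAt_id t).sub_const t
  have h3 := HasDerivAt.comp t (h₂ := fun r : ℝ => F (ξ + t • η + r • η)) (h := fun r => r - t)
    (by rw [sub_self]; exact h1) h2
  rw [mul_one] at h3
  refine h3.congr_of_eventuallyEq (Eventually.of_forall fun r => ?_)
  simp only [Function.comp_apply]
  congr 1
  rw [sub_smul]; abel

/-- Euler's identity for the potential. -/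
theorem inner_self (h : IsEllipticPotential s γ Γ F a) (ξ : E N) : inner ℝ (a ξ) ξ = F ξ := by
  have h1 := h.hasFDerivAt ξ ξ
  have h2 : HasDerivAt (fun t : ℝ => (1 + t) ^ s * F ξ) (s * F ξ) 0 := by
    have h3 : HasDerivAt (fun t : ℝ => 1 + t) 1 0 := by simpa using (hasDerivAt_id (0 : ℝ)).const_add 1
    have := (h3.rpow_const (p := s) (Or.inl (by norm_num))).mul_const (F ξ)
    simpa using this
  have h4 : HasDerivAt (fun t : ℝ => F (ξ + t • ξ)) (s * F ξ) 0 := by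
    refine h2.congr_of_eventuallyEq ?_
    filter_upwards [Ioi_mem_nhds (show (-1 : ℝ) < 0 by norm_num)] with t ht
    rw [← h.homogeneous (1 + t) (by linarith [mem_Ioi.1 ht]), add_smul, one_smul]
  have := h1.unique h4
  exact mul_left_cancel₀ (by linarith [h.one_lt]) this

theorem map_smul (h : IsEllipticPotential s γ Γ F a) {t : ℝ} (ht : 0 < t) (ξ : E N) :
    a (t • ξ) = t ^ (s - 1) • a ξ := by
  refine ext_inner_right ℝ fun η => ?_
  have h1 := h.hasFDerivAt (t • ξ) η
  have h2 : HasDerivAt (fun r : ℝ => F (t • ξ + r • η))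
      (t ^ s * (s * inner ℝ (a ξ) η) * t⁻¹) 0 := by
    have h3 : HasDerivAt (fun r : ℝ => r * t⁻¹) t⁻¹ 0 := by
      simpa using (hasDerivAt_id (0 : ℝ)).mul_const t⁻¹
    have h4 := HasDerivAt.comp (0 : ℝ) (h₂ := fun r : ℝ => t ^ s * F (ξ + r • η))
      (h := fun r => r * t⁻¹) (by rw [zero_mul]; exact (h.hasFDerivAt ξ η).const_mul _) h3
    refine h4.congr_of_eventuallyEq (Eventually.of_forall fun r => ?_)
    simp only [Function.comp_apply]
    rw [← h.homogeneous t ht.le, smul_add, smul_smul]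
    congr 3
    field_simp
  have h5 := h1.unique h2
  rw [inner_smul_left, Real.rpow_sub ht, Real.rpow_one]
  simp only [conj_trivial]
  refine mul_left_cancel₀ (show s ≠ 0 by linarith [h.one_lt]) (h5.trans ?_)
  field_simp

theorem eq_sum_single (η : E N) : η = ∑ i, η i • EuclideanSpace.single i (1 : ℝ) := by
  ext j
  simp [Pi.single_apply]

theorem fderiv_apply_eq_sum (f : E N → ℝ) (ξ η : E N) :
    fderiv ℝ f ξ η = ∑ i, fderiv ℝ f ξ (EuclideanSpace.single i 1) * η i := by
  conv_lhs => rw [eq_sum_single η]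
  simp [map_sum, mul_comm]

/-- Euler's identity for the field. -/
theorem fderiv_self (h : IsEllipticPotential s γ Γ F a) {ξ : E N} (hξ : ξ ≠ 0) (j : Fin N) :
    ∑ i, fderiv ℝ (fun ζ => a ζ j) ξ (EuclideanSpace.single i 1) * ξ i = (s - 1) * a ξ j := by
  rw [← fderiv_apply_eq_sum]
  have h3 : HasDerivAt (fun t : ℝ => 1 + t) 1 0 := by simpa using (hasDerivAt_id (0 : ℝ)).const_add 1
  have h1 : HasDerivAt (fun t : ℝ => a (ξ + t • ξ) j) (fderiv ℝ (fun ζ => a ζ j) ξ ξ) 0 := by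
    have h4 : HasDerivAt (fun t : ℝ => ξ + t • ξ) ξ 0 := by
      simpa using ((hasDerivAt_id (0 : ℝ)).smul_const ξ).const_add ξ
    have := (h.differentiableAt j ξ hξ).hasFDerivAt
    exact HasFDerivAt.comp_hasDerivAt (0 : ℝ) (by simpa using this) h4
  have h2 : HasDerivAt (fun t : ℝ => (1 + t) ^ (s - 1) * a ξ j) ((s - 1) * a ξ j) 0 := by
    have := (h3.rpow_const (p := s - 1) (Or.inl (by norm_num))).mul_const (a ξ j)
    simpa using this
  refine h1.unique (h2.congr_of_eventuallyEq ?_)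
  filter_upwards [Ioi_mem_nhds (show (-1 : ℝ) < 0 by norm_num)] with t ht
  have h5 : ξ + t • ξ = (1 + t) • ξ := by rw [add_smul, one_smul]
  rw [h5, h.map_smul (by linarith [mem_Ioi.1 ht])]
  simp

theorem norm_rpow_mul {ξ : E N} (hξ : ξ ≠ 0) (r : ℝ) (n : ℕ) :
    ‖ξ‖ ^ r * ‖ξ‖ ^ n = ‖ξ‖ ^ (r + n) := by
  rw [Real.rpow_add (norm_pos_iff.2 hξ), Real.rpow_natCast]

/-- Coercivity of the potential. -/
theorem le_potential (h : IsEllipticPotential s γ Γ F a) (ξ : E N) :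
    γ * ‖ξ‖ ^ s ≤ (s - 1) * F ξ := by
  rcases eq_or_ne ξ 0 with rfl | hξ
  · simp [h.map_zero', Real.zero_rpow (show s ≠ 0 by linarith [h.one_lt])]
  have h1 := h.elliptic ξ hξ ξ
  rw [mul_assoc, norm_rpow_mul hξ, Nat.cast_ofNat, sub_add_cancel, Finset.sum_comm] at h1
  refine h1.trans (le_of_eq ?_)
  simp_rw [← Finset.sum_mul, h.fderiv_self hξ]
  rw [← h.inner_self ξ, PiLp.inner_apply, Finset.mul_sum]
  refine Finset.sum_congr rfl fun j _ => ?_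
  simp only [RCLike.inner_apply, conj_trivial]
  ring

/-- Growth of the field. -/
theorem norm_le (h : IsEllipticPotential s γ Γ F a) (ξ : E N) :
    (s - 1) * ‖a ξ‖ ≤ Γ * ‖ξ‖ ^ (s - 1) := by
  rcases eq_or_ne ξ 0 with rfl | hξ
  · simp [h.map_zero, Real.zero_rpow (show s - 1 ≠ 0 by linarith [h.one_lt])]
  have hs : 0 ≤ s - 1 := by linarith [h.one_lt]
  have hsum : ‖a ξ‖ ≤ ∑ j, |a ξ j| := by
    conv_lhs => rw [eq_sum_single (a ξ)]
    refine (norm_sum_le _ _).trans (Finset.sum_le_sum fun i _ => ?_)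
    rw [norm_smul]; simp
  calc (s - 1) * ‖a ξ‖ ≤ (s - 1) * ∑ j, |a ξ j| := by gcongr
    _ = ∑ j, |∑ i, fderiv ℝ (fun ζ => a ζ j) ξ (EuclideanSpace.single i 1) * ξ i| := by
        rw [Finset.mul_sum]
        refine Finset.sum_congr rfl fun j _ => ?_
        rw [h.fderiv_self hξ, abs_mul, abs_of_nonneg hs]
    _ ≤ ∑ j, ∑ i, |fderiv ℝ (fun ζ => a ζ j) ξ (EuclideanSpace.single i 1)| * ‖ξ‖ := by
        gcongr with j _
        refine (Finset.abs_sum_le_sum_abs _ _).trans (Finset.sum_le_sum fun i _ => ?_)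
        rw [abs_mul]
        gcongr
        exact norm_coord_le ξ i
    _ = (∑ i, ∑ j, |fderiv ℝ (fun ζ => a ζ j) ξ (EuclideanSpace.single i 1)|) * ‖ξ‖ := by
        rw [Finset.sum_comm]; simp_rw [Finset.sum_mul]
    _ ≤ Γ * ‖ξ‖ ^ (s - 2) * ‖ξ‖ := by gcongr; exact h.growth ξ hξ
    _ = Γ * ‖ξ‖ ^ (s - 1) := by
        have := norm_rpow_mul hξ (s - 2) 1
        rw [pow_one] at this
        rw [mul_assoc, this]
        congr 2
        push_cast; ring

/-- The tangent inequality of a convex function, along a segment which avoids the origin. -/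
theorem tangent_le (h : IsEllipticPotential s γ Γ F a) {ξ η : E N}
    (hne : ∀ t ∈ Icc (0 : ℝ) 1, ξ + t • (η - ξ) ≠ 0) :
    F ξ + s * inner ℝ (a ξ) (η - ξ) ≤ F η := by
  set d := η - ξ with hd
  have hs : 0 ≤ s := by linarith [h.one_lt]
  have hder : ∀ t ∈ Icc (0 : ℝ) 1, HasDerivAt (fun t : ℝ => s * inner ℝ (a (ξ + t • d)) d)
      (s * ∑ j, fderiv ℝ (fun ζ => a ζ j) (ξ + t • d) d * d j) t := by
    intro t ht
    have h1 : HasDerivAt (fun t : ℝ => ξ + t • d) d t := by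
      simpa using ((hasDerivAt_id t).smul_const d).const_add ξ
    have h2 : ∀ j, HasDerivAt (fun t : ℝ => a (ξ + t • d) j * d j)
        (fderiv ℝ (fun ζ => a ζ j) (ξ + t • d) d * d j) t := fun j =>
      ((h.differentiableAt j _ (hne t ht)).hasFDerivAt.comp_hasDerivAt t h1).mul_const _
    have h3 := (HasDerivAt.fun_sum fun j (_ : j ∈ Finset.univ) => h2 j).const_mul s
    refine h3.congr_of_eventuallyEq (Eventually.of_forall fun r => ?_)
    simp [PiLp.inner_apply, mul_comm]
  have hmono : MonotoneOn (fun t : ℝ => s * inner ℝ (a (ξ + t • d)) d) (Icc 0 1) := by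
    refine monotoneOn_of_deriv_nonneg (convex_Icc 0 1)
      (fun t ht => (hder t ht).continuousAt.continuousWithinAt)
      (fun t ht => (hder t (interior_subset ht)).differentiableAt.differentiableWithinAt)
      fun t ht => ?_
    rw [(hder t (interior_subset ht)).deriv]
    refine mul_nonneg hs ?_
    have h1 := h.elliptic _ (hne t (interior_subset ht)) d
    rw [Finset.sum_comm] at h1
    simp_rw [← Finset.sum_mul, ← fderiv_apply_eq_sum] at h1
    exact le_trans (mul_nonneg (mul_nonneg h.pos.le (by positivity)) (by positivity)) h1
  obtain ⟨c, hc, hceq⟩ := exists_hasDerivAt_eq_slope (fun t : ℝ => F (ξ + t • d))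
    (fun t => s * inner ℝ (a (ξ + t • d)) d) zero_lt_one
    (fun t _ => (h.hasDerivAt_line ξ d t).continuousAt.continuousWithinAt)
    (fun t _ => h.hasDerivAt_line ξ d t)
  have h0 := hmono (left_mem_Icc.2 zero_le_one) (Ioo_subset_Icc_self hc) hc.1.le
  simp only [zero_smul, add_zero, one_smul, sub_zero, div_one] at hceq h0
  rw [hceq, hd, add_sub_cancel] at h0
  linarith

theorem inner_le_young (h : IsEllipticPotential s γ Γ F a) (ξ η : E N) :
    s * inner ℝ (a ξ) η ≤ (s - 1) * F ξ + F η := by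
  have hs : 0 ≤ s - 1 := by linarith [h.one_lt]
  rcases eq_or_ne ξ 0 with rfl | hξ
  · simp [h.map_zero, h.map_zero', h.nonneg η]
  by_cases hne : ∀ t ∈ Icc (0 : ℝ) 1, ξ + t • (η - ξ) ≠ 0
  · have := h.tangent_le hne
    rw [inner_sub_right, h.inner_self] at this
    linarith
  -- otherwise `η` is a nonpositive multiple of `ξ`
  · push Not at hne
    obtain ⟨t, ht, h0⟩ := hne
    have ht0 : 0 < t := by
      refine lt_of_le_of_ne ht.1 fun h' => hξ ?_
      rw [← h', zero_smul, add_zero] at h0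
      exact h0
    have hη : η = -(t⁻¹ * (1 - t)) • ξ := by
      have h1 : t • η = -(1 - t) • ξ := by
        rw [← sub_eq_zero, ← h0]; module
      rw [← inv_smul_smul₀ ht0.ne' η, h1, smul_smul]; congr 1; ring
    have h2 : inner ℝ (a ξ) η ≤ 0 := by
      rw [hη, inner_smul_right, h.inner_self, neg_mul]
      have : 0 ≤ t⁻¹ * (1 - t) * F ξ :=
        mul_nonneg (mul_nonneg (inv_nonneg.2 ht.1) (by linarith [ht.2])) (h.nonneg ξ)
      linarith
    have h3 := h.nonneg ξ
    have h4 := h.nonneg η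
    have h5 : s * inner ℝ (a ξ) η ≤ 0 := mul_nonpos_of_nonneg_of_nonpos (by linarith) h2
    have h6 := mul_nonneg hs h3
    linarith

theorem potential_pos (h : IsEllipticPotential s γ Γ F a) {ξ : E N} (hξ : ξ ≠ 0) : 0 < F ξ := by
  have h1 := h.le_potential ξ
  have h2 : 0 < γ * ‖ξ‖ ^ s := mul_pos h.pos (Real.rpow_pos_of_pos (norm_pos_iff.2 hξ) _)
  exact pos_of_mul_pos_right (h2.trans_le h1) (by linarith [h.one_lt])

/-- The generalized Hölder inequality `a(ξ) · η ≤ X^{s-1} Y` for `F ξ = X^s` and `F η = Y^s`. -/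
theorem inner_le_rpow (h : IsEllipticPotential s γ Γ F a) {ξ η : E N}
    {X Y : ℝ} (hX : 0 < X) (hY : 0 < Y) (hFX : F ξ = X ^ s) (hFY : F η = Y ^ s) :
    inner ℝ (a ξ) η ≤ X ^ (s - 1) * Y := by
  have hs : 0 < s := by linarith [h.one_lt]
  have h1 := h.inner_le_young ξ ((X / Y) • η)
  rw [h.homogeneous _ (by positivity), inner_smul_right, hFX, hFY, Real.div_rpow hX.le hY.le,
    div_mul_cancel₀ _ (Real.rpow_pos_of_pos hY s).ne'] at h1
  have h2 : X ^ s = X ^ (s - 1) * X := by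
    rw [Real.rpow_sub hX, Real.rpow_one]; field_simp
  have h3 : s * X / Y * inner ℝ (a ξ) η ≤ s * X / Y * (X ^ (s - 1) * Y) := by
    have h4 : s * X / Y * (X ^ (s - 1) * Y) = s * X ^ s := by
      rw [h2]; field_simp
    rw [h4]
    calc s * X / Y * inner ℝ (a ξ) η = s * (X / Y * inner ℝ (a ξ) η) := by ring
      _ ≤ (s - 1) * X ^ s + X ^ s := h1
      _ = s * X ^ s := by ring
  exact le_of_mul_le_mul_left h3 (by positivity)

/-- The scalar inequality behind Picone's inequality: Young's inequality with exponents
`q / (q - 1)` and `q` for each term on the left, and `(X^{s-q} - Y^{s-q}) (X^q - Y^q) ≥ 0`, where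
`q ≤ s` enters. -/
theorem scalar_picone {X Y q t : ℝ} (hX : 0 < X) (hY : 0 < Y) (ht : 0 < t) (hq : 1 < q)
    (hqs : q ≤ s) :
    q * t ^ (q - 1) * (X ^ (s - 1) * Y) + q * t⁻¹ ^ (q - 1) * (Y ^ (s - 1) * X) ≤
      X ^ s * (1 + (q - 1) * t ^ q) + Y ^ s * (1 + (q - 1) * t⁻¹ ^ q) := by
  have hconj : (q / (q - 1)).HolderConjugate q := by
    rw [Real.holderConjugate_comm]
    exact Real.HolderConjugate.conjExponent hq
  have young : ∀ {X Y t : ℝ}, 0 < X → 0 < Y → 0 < t →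
      q * t ^ (q - 1) * (X ^ (s - 1) * Y) ≤
        (q - 1) * t ^ q * X ^ s + X ^ (s - q) * Y ^ q := by
    intro X Y t hX hY ht
    have h1 := Real.young_inequality_of_nonneg (a := (t * X) ^ (q - 1)) (b := Y)
      (by positivity) hY.le hconj
    have h2 : ((t * X) ^ (q - 1)) ^ (q / (q - 1)) = t ^ q * X ^ q := by
      rw [← Real.rpow_mul (by positivity), mul_div_cancel₀ _ (by linarith), Real.mul_rpow ht.le hX.le]
    rw [h2, Real.mul_rpow ht.le hX.le] at h1
    have h3 : X ^ (s - 1) = X ^ (s - q) * X ^ (q - 1) := by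
      rw [← Real.rpow_add hX]; congr 1; ring
    have h4 : X ^ s = X ^ (s - q) * X ^ q := by
      rw [← Real.rpow_add hX]; congr 1; ring
    have h5 : 0 < X ^ (s - q) := Real.rpow_pos_of_pos hX _
    rw [h3, h4]
    calc q * t ^ (q - 1) * (X ^ (s - q) * X ^ (q - 1) * Y)
        = q * X ^ (s - q) * (t ^ (q - 1) * X ^ (q - 1) * Y) := by ring
      _ ≤ q * X ^ (s - q) * (t ^ q * X ^ q / (q / (q - 1)) + Y ^ q / q) := by gcongr
      _ = _ := by
        have : q - 1 ≠ 0 := by linarith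
        field_simp
  have h1 := young hX hY ht
  have h2 := young hY hX (inv_pos.2 ht)
  have h3 : 0 ≤ (X ^ (s - q) - Y ^ (s - q)) * (X ^ q - Y ^ q) := by
    rcases le_total X Y with h | h
    · exact mul_nonneg_of_nonpos_of_nonpos
        (sub_nonpos.2 (Real.rpow_le_rpow hX.le h (by linarith)))
        (sub_nonpos.2 (Real.rpow_le_rpow hX.le h (by linarith)))
    · exact mul_nonneg (sub_nonneg.2 (Real.rpow_le_rpow hY.le h (by linarith)))
        (sub_nonneg.2 (Real.rpow_le_rpow hY.le h (by linarith)))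
  have hs4 : ∀ {X : ℝ}, 0 < X → X ^ s = X ^ (s - q) * X ^ q := fun {X} hX => by
    rw [← Real.rpow_add hX]; congr 1; ring
  have h5 := hs4 hX
  have h6 := hs4 hY
  nlinarith

/-- Picone's inequality for the field `a`, in terms of the quotient `t = W / V` of two positive
functions with gradients `η` and `ξ`: the left side collects the mixed terms which arise when
`(V^q - W^q) V^{1-q}` and `(V^q - W^q) W^{1-q}` are used as test functions, the right side the
others. -/
theorem picone (h : IsEllipticPotential s γ Γ F a) (ξ η : E N) {q t : ℝ} (ht : 0 < t) (hq : 1 < q)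
    (hqs : q ≤ s) :
    q * t ^ (q - 1) * inner ℝ (a ξ) η + q * t⁻¹ ^ (q - 1) * inner ℝ (a η) ξ ≤
      F ξ * (1 + (q - 1) * t ^ q) + F η * (1 + (q - 1) * t⁻¹ ^ q) := by
  have hq1 : 0 ≤ q - 1 := by linarith
  have hF := h.nonneg ξ
  have hF' := h.nonneg η
  rcases eq_or_ne ξ 0 with rfl | hξ
  · simp only [h.map_zero, inner_zero_left, inner_zero_right, mul_zero, add_zero]
    positivity
  rcases eq_or_ne η 0 with rfl | hη
  · simp only [h.map_zero, inner_zero_left, inner_zero_right, mul_zero, add_zero]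
    positivity
  have hs : s ≠ 0 := by linarith [h.one_lt]
  have hX := Real.rpow_pos_of_pos (h.potential_pos hξ) s⁻¹
  have hY := Real.rpow_pos_of_pos (h.potential_pos hη) s⁻¹
  have hFX : F ξ = (F ξ ^ s⁻¹) ^ s := (Real.rpow_inv_rpow hF hs).symm
  have hFY : F η = (F η ^ s⁻¹) ^ s := (Real.rpow_inv_rpow hF' hs).symm
  have h1 := h.inner_le_rpow hX hY hFX hFY
  have h2 := h.inner_le_rpow hY hX hFY hFX
  have h3 := scalar_picone (s := s) hX hY ht hq hqs
  rw [← hFX, ← hFY] at h3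
  refine le_trans (add_le_add ?_ ?_) h3
  · exact mul_le_mul_of_nonneg_left h1 (by positivity)
  · exact mul_le_mul_of_nonneg_left h2 (by positivity)

end IsEllipticPotential

/-- The structural conditions provide an elliptic potential at almost every point. -/
theorem ae_isEllipticPotential {Ω : Set (E N)} (hΩ : IsOpen Ω) {p : E N → ℝ}
    (hp : ∀ x ∈ Ω, 1 < p x) {A : E N → E N → ℝ} (hA0 : CondA0 Ω p A)
    (hA1 : CondA1 Ω p (field p A)) : ∃ γ Γ : ℝ, 0 < γ ∧ 0 < Γ ∧
      ∀ᵐ x ∂(volume.restrict Ω), IsEllipticPotential (p x) γ Γ (A x) (field p A x) := by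
  obtain ⟨γ, Γ, hγ, hΓ, hb⟩ := hA1.bounds
  refine ⟨γ, Γ, hγ, hΓ, ?_⟩
  filter_upwards [hA0.homogeneous, ae_restrict_mem hΩ.measurableSet] with x hx hxΩ
  refine ⟨hp x hxΩ, hA0.nonneg x hxΩ, fun ξ η => ?_, hx, ?_, fun j ξ hξ => ?_, hγ,
    fun ξ hξ => (hb x hxΩ ξ hξ).1, fun ξ hξ => (hb x hxΩ ξ hξ).2⟩
  · have h1 := (hA0.differentiable x hxΩ ξ).hasFDerivAt
    have h2 : HasDerivAt (fun t : ℝ => ξ + t • η) η 0 := by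
      simpa using ((hasDerivAt_id (0 : ℝ)).smul_const η).const_add ξ
    have h3 := HasFDerivAt.comp_hasDerivAt (0 : ℝ) (l := A x) (f := fun t : ℝ => ξ + t • η)
      (by simpa using h1) h2
    refine h3.congr_deriv ?_
    symm
    rw [WeakComparison.field, inner_smul_left, inner_gradient_left]
    have : p x ≠ 0 := by linarith [hp x hxΩ]
    simp only [conj_trivial]
    field_simp
  · ext j
    simpa using hA1.map_zero x hxΩ j
  · have h1 : ContDiffAt ℝ 1 (fun z : E N × E N => field p A z.1 z.2 j) (x, ξ) :=
      (hA1.contDiffOn j).contDiffAt ((hΩ.prod isOpen_compl_singleton).mem_nhds ⟨hxΩ, hξ⟩)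
    exact (h1.differentiableAt one_ne_zero).comp ξ (f := fun ζ => (x, ζ))
      ((differentiableAt_const x).prodMk differentiableAt_id)

end Field

/-! ### Measurability and integrability of the terms of the weak formulation -/

theorem aestronglyMeasurable_comp_of_continuousOn {X W Z : Type*} [MeasurableSpace X]
    [TopologicalSpace W] [MeasurableSpace W] [OpensMeasurableSpace W] [TopologicalSpace Z]
    [MeasurableSpace Z] [BorelSpace Z] [TopologicalSpace.PseudoMetrizableSpace Z]
    [SecondCountableTopology Z] {μ : Measure X} {g : W → Z} {S : Set W} (hS : MeasurableSet S)
    (hg : ContinuousOn g S) {k : X → W} (hk : AEMeasurable k μ) (hmem : ∀ᵐ x ∂μ, k x ∈ S) :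
    AEStronglyMeasurable (fun x => g (k x)) μ := by
  classical
  rcases isEmpty_or_nonempty X with hX | ⟨⟨x₀⟩⟩
  · exact (measurable_of_empty _).aemeasurable.aestronglyMeasurable
  have h1 : Measurable (S.piecewise g fun _ => g (k x₀)) :=
    hg.measurable_piecewise continuousOn_const hS
  refine (h1.comp_aemeasurable hk).aestronglyMeasurable.congr ?_
  filter_upwards [hmem] with x hx
  simp [piecewise_eq_of_mem _ _ _ hx]

theorem rpow_sub_one_mul_le {x y s : ℝ} (hx : 0 ≤ x) (hy : 0 ≤ y) (hs : 1 < s) :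
    x ^ (s - 1) * y ≤ x ^ s + y ^ s := by
  have key : ∀ z : ℝ, 0 ≤ z → z ^ (s - 1) * z = z ^ s := fun z hz => by
    rw [← Real.rpow_add_one' hz (by linarith), sub_add_cancel]
  rcases le_total x y with h | h
  · calc x ^ (s - 1) * y ≤ y ^ (s - 1) * y := by gcongr
      _ = y ^ s := key y hy
      _ ≤ _ := le_add_of_nonneg_left (Real.rpow_nonneg hx _)
  · calc x ^ (s - 1) * y ≤ x ^ (s - 1) * x := by gcongr
      _ = x ^ s := key x hx
      _ ≤ _ := le_add_of_nonneg_right (Real.rpow_nonneg hy _)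

/-- A field `a` on `Ω` which at almost every point is elliptic and `(p(x) - 1)`-homogeneous with
potential `A`, for an exponent with values in `[m, P]`, where `m > 1`. -/
structure IsEllipticField {N : ℕ} (Ω : Set (E N)) (p : E N → ℝ) (m P γ Γ : ℝ)
    (A : E N → E N → ℝ) (a : E N → E N → E N) : Prop where
  exponent : IsBoundedExponent Ω p P
  one_lt : 1 < m
  le_exponent : ∀ x ∈ Ω, m ≤ p x
  m_le : m ≤ P
  continuousOn : ContinuousOn (fun z : E N × E N => a z.1 z.2) (Ω ×ˢ univ)
  pos : 0 < γ
  Pos : 0 < Γ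
  potential : ∀ᵐ x ∂(volume.restrict Ω), IsEllipticPotential (p x) γ Γ (A x) (a x)

section EllipticField

variable {N : ℕ} {Ω : Set (E N)} {p : E N → ℝ} {m P γ Γ : ℝ} {A : E N → E N → ℝ}
  {a : E N → E N → E N}

namespace IsEllipticField

theorem aestronglyMeasurable (ha : IsEllipticField Ω p m P γ Γ A a) {G : E N → E N}
    (hG : AEStronglyMeasurable G (volume.restrict Ω)) :
    AEStronglyMeasurable (fun x => a x (G x)) (volume.restrict Ω) :=
  aestronglyMeasurable_comp_of_continuousOn (k := fun x => (x, G x))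
    (ha.exponent.isOpen.measurableSet.prod MeasurableSet.univ) ha.continuousOn
    (aemeasurable_id.prodMk hG.aemeasurable)
    (by filter_upwards [ha.exponent.ae_mem] with x hx using ⟨hx, mem_univ _⟩)

theorem ae_norm_le (ha : IsEllipticField Ω p m P γ Γ A a) :
    ∀ᵐ x ∂(volume.restrict Ω), ∀ ξ, ‖a x ξ‖ ≤ Γ / (m - 1) * ‖ξ‖ ^ (p x - 1) := by
  filter_upwards [ha.potential, ha.exponent.ae_mem] with x hx hxΩ ξ
  have h1 := hx.norm_le ξ
  have hm : 0 < m - 1 := by linarith [ha.one_lt]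
  rw [div_mul_eq_mul_div, le_div_iff₀' hm]
  refine le_trans ?_ h1
  gcongr
  exact ha.le_exponent x hxΩ

theorem ae_le_potential (ha : IsEllipticField Ω p m P γ Γ A a) :
    ∀ᵐ x ∂(volume.restrict Ω), ∀ ξ, γ / (P - 1) * ‖ξ‖ ^ p x ≤ inner ℝ (a x ξ) ξ := by
  filter_upwards [ha.potential, ha.exponent.ae_mem] with x hx hxΩ ξ
  have h1 := hx.le_potential ξ
  have hm : 0 < P - 1 := by linarith [ha.one_lt, ha.m_le]
  rw [hx.inner_self, div_mul_eq_mul_div, div_le_iff₀' hm]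
  refine h1.trans ?_
  have := hx.nonneg ξ
  gcongr
  exact ha.exponent.le x hxΩ

theorem integrable_inner (ha : IsEllipticField Ω p m P γ Γ A a) {G H : E N → E N}
    (hG : MemLpVar Ω p G) (hH : MemLpVar Ω p H) :
    IntegrableOn (fun x => inner ℝ (a x (G x)) (H x)) Ω := by
  have hm : 0 < m - 1 := by linarith [ha.one_lt]
  refine Integrable.mono' (((hG.integrable_rpow ha.exponent).add
    (hH.integrable_rpow ha.exponent)).const_mul (Γ / (m - 1)))
    ((ha.aestronglyMeasurable hG.1).inner hH.1) ?_
  filter_upwards [ha.ae_norm_le, ha.exponent.ae_mem] with x hx hxΩ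
  have hp : 1 < p x := by linarith [ha.one_lt, ha.le_exponent x hxΩ]
  calc ‖inner ℝ (a x (G x)) (H x)‖ ≤ ‖a x (G x)‖ * ‖H x‖ := norm_inner_le_norm _ _
    _ ≤ Γ / (m - 1) * ‖G x‖ ^ (p x - 1) * ‖H x‖ := by gcongr; exact hx _
    _ = Γ / (m - 1) * (‖G x‖ ^ (p x - 1) * ‖H x‖) := by ring
    _ ≤ _ := by
      have := ha.Pos
      exact mul_le_mul_of_nonneg_left
        (rpow_sub_one_mul_le (norm_nonneg _) (norm_nonneg _) hp) (by positivity)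

end IsEllipticField

theorem MemLpVar.smul_of_bound (hp : IsBoundedExponent Ω p P) {k : E N → ℝ} {G : E N → E N}
    (hG : MemLpVar Ω p G) (hk : AEStronglyMeasurable k (volume.restrict Ω)) {C : ℝ}
    (hC : ∀ᵐ x ∂(volume.restrict Ω), |k x| ≤ C) : MemLpVar Ω p (fun x => k x • G x) :=
  MemLpVar.of_norm_le hp (hk.smul hG.1) hG (C := C) (by
    filter_upwards [hC] with x hx
    rw [norm_smul]
    gcongr
    exact hx)

theorem MemW0.memX_of_bound (hp : IsBoundedExponent Ω p P) {u : E N → ℝ} {G : E N → E N}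
    (hu : MemW0 Ω p u G) (q : ℝ) {C : ℝ} (hC : ∀ᵐ x ∂(volume.restrict Ω), |u x| ≤ C) :
    MemX Ω p q u G :=
  haveI := hp.isFiniteMeasure
  ⟨hu, MemLp.of_bound hu.memLp.1 C hC⟩

end EllipticField

/-! ### Bounds for integrals of limits -/

section Fatou

variable {X : Type*} [MeasurableSpace X] {μ : Measure X} {F : ℕ → X → ℝ} {C : ℝ}

theorem lintegral_liminf_ofReal_le (hF : ∀ n, Integrable (F n) μ) (h0 : ∀ n, ∀ᵐ x ∂μ, 0 ≤ F n x)
    (hC : ∀ n, ∫ x, F n x ∂μ ≤ C) :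
    ∫⁻ x, liminf (fun n => ENNReal.ofReal (F n x)) atTop ∂μ ≤ ENNReal.ofReal C := by
  refine (lintegral_liminf_le' fun n => (hF n).1.aemeasurable.ennreal_ofReal).trans ?_
  refine (liminf_le_liminf (v := fun _ => ENNReal.ofReal C) (Eventually.of_forall fun n => ?_)).trans
    (by simp)
  rw [← ofReal_integral_eq_lintegral_ofReal (hF n) (h0 n)]
  exact ENNReal.ofReal_le_ofReal (hC n)

theorem integrable_of_tendsto_of_integral_le {f : X → ℝ} (hF : ∀ n, Integrable (F n) μ)
    (h0 : ∀ n, ∀ᵐ x ∂μ, 0 ≤ F n x) (hC : ∀ n, ∫ x, F n x ∂μ ≤ C)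
    (hlim : ∀ᵐ x ∂μ, Tendsto (fun n => F n x) atTop (𝓝 (f x))) : Integrable f μ := by
  refine ⟨aestronglyMeasurable_of_tendsto_ae _ (fun n => (hF n).1) hlim, ?_⟩
  refine lt_of_le_of_lt ?_ ((lintegral_liminf_ofReal_le hF h0 hC).trans_lt ENNReal.ofReal_lt_top)
  refine lintegral_mono_ae ?_
  filter_upwards [hlim, ae_all_iff.2 h0] with x hx h0x
  rw [(ENNReal.tendsto_ofReal hx).liminf_eq,
    Real.enorm_of_nonneg (ge_of_tendsto' hx h0x)]

theorem ae_not_tendsto_atTop_of_integral_le (hF : ∀ n, Integrable (F n) μ)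
    (h0 : ∀ n, ∀ᵐ x ∂μ, 0 ≤ F n x) (hC : ∀ n, ∫ x, F n x ∂μ ≤ C) :
    ∀ᵐ x ∂μ, ¬ Tendsto (fun n => F n x) atTop atTop := by
  have h1 := ((lintegral_liminf_ofReal_le hF h0 hC).trans_lt ENNReal.ofReal_lt_top).ne
  have hm : AEMeasurable (fun x => liminf (fun n => ENNReal.ofReal (F n x)) atTop) μ :=
    by
      simp only [liminf_eq_iSup_iInf_of_nat]
      exact AEMeasurable.iSup fun n => AEMeasurable.biInf _ (to_countable _) fun i _ =>
        (hF i).1.aemeasurable.ennreal_ofReal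
  filter_upwards [ae_lt_top' hm h1] with x hx h
  have h2 : Tendsto (fun n => ENNReal.ofReal (F n x)) atTop (𝓝 ∞) :=
    ENNReal.tendsto_ofReal_atTop.comp h
  rw [h2.liminf_eq] at hx
  exact lt_irrefl _ hx

end Fatou

/-! ### An energy estimate for supersolutions with a sublinear source -/

section Energy

variable {N : ℕ} {Ω : Set (E N)} {p : E N → ℝ} {m P γ Γ q M : ℝ} {A : E N → E N → ℝ}
  {a : E N → E N → E N} {u : E N → ℝ} {G : E N → E N}

/-- A bounded nonnegative function `u ∈ W₀^{1,p(x)}(Ω)` with gradient `G` such that, on every compact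
subset of `Ω`, `-div a(x, ∇u) ≥ b u^{q-1} - B u^{2q-1}` weakly, for some `b > 0` and `B ≥ 0` which
depend on the compact set. -/
structure IsSublinearSupersolution {N : ℕ} (Ω : Set (E N)) (p : E N → ℝ) (m P γ Γ q M : ℝ)
    (A : E N → E N → ℝ) (a : E N → E N → E N) (u : E N → ℝ) (G : E N → E N) : Prop where
  field : IsEllipticField Ω p m P γ Γ A a
  one_lt_q : 1 < q
  q_lt : q < m
  one_le : 1 ≤ M
  mem : MemW0 Ω p u G
  mem_Icc : ∀ᵐ x ∂(volume.restrict Ω), u x ∈ Icc 0 M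
  ineq : ∀ K, IsCompact K → K ⊆ Ω → ∃ b > 0, ∃ B ≥ 0, ∀ (φ : E N → ℝ) (H : E N → E N),
    MemW0 Ω p φ H → (∀ᵐ x ∂(volume.restrict Ω), 0 ≤ φ x) →
    (∃ C, ∀ᵐ x ∂(volume.restrict Ω), |φ x| ≤ C) → (∀ x ∉ K, φ x = 0) →
    b * ∫ x in Ω, u x ^ (q - 1) * φ x ≤
      B * (∫ x in Ω, u x ^ (2 * q - 1) * φ x) + ∫ x in Ω, inner ℝ (a x (G x)) (H x)

/-- A smooth nonnegative nonincreasing function `g` on `[0, M]`, with derivative `g'`; smoothness is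
required on a neighbourhood of `[0, ∞)`. -/
structure IsDecreasingProfile (M : ℝ) (g g' : ℝ → ℝ) : Prop where
  contDiffOn : ∃ ε > 0, ContDiffOn ℝ ((⊤ : ℕ∞) : WithTop ℕ∞) g (Ioi (-ε))
  continuousOn : ContinuousOn g' (Icc 0 M)
  hasDerivAt : ∀ s ∈ Icc 0 M, HasDerivAt g (g' s) s
  nonneg : ∀ s ∈ Icc 0 M, 0 ≤ g s
  nonpos : ∀ s ∈ Icc 0 M, g' s ≤ 0

theorem MemW0.mul_comp (hp : IsBoundedExponent Ω p P) {ζ : E N → ℝ}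
    (hζ : IsTestFunction Ω ζ) (hζ01 : ∀ x, ζ x ∈ Icc (0 : ℝ) 1) (hu : MemW0 Ω p u G)
    (huM : ∀ᵐ x ∂(volume.restrict Ω), u x ∈ Icc 0 M) {g g' : ℝ → ℝ} {ε : ℝ} (hε : 0 < ε)
    (hg : ContDiffOn ℝ ((⊤ : ℕ∞) : WithTop ℕ∞) g (Ioi (-ε)))
    (hg' : ∀ s ∈ Icc 0 M, HasDerivAt g (g' s) s) :
    MemW0 Ω p (fun x => ζ x * g (u x))
      (fun x => (ζ x * g' (u x)) • G x + g (u x) • gradient ζ x) := by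
  refine MemW0.comp hp hu (hζ.memW0 hp) (T := fun z => z.2 * g z.1) (D₁ := fun z => z.2 * g' z.1)
    (D₂ := fun z => g z.1) (K := Icc 0 M ×ˢ Icc 0 1) (U := Ioi (-ε) ×ˢ univ)
    (isCompact_Icc.prod isCompact_Icc) (isOpen_Ioi.prod isOpen_univ) ?_ ?_ ?_ (by simp) ?_
  · rintro ⟨s, t⟩ ⟨hs, -⟩
    exact ⟨(neg_lt_zero.2 hε).trans_le hs.1, mem_univ _⟩
  · exact contDiff_snd.contDiffOn.mul (hg.comp contDiff_fst.contDiffOn fun z hz => hz.1)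
  · rintro ⟨s, t⟩ ⟨hs, -⟩
    have h1 : HasFDerivAt (fun z : ℝ × ℝ => g z.1) (g' s • ContinuousLinearMap.fst ℝ ℝ ℝ) (s, t) :=
      (hg' s hs).comp_hasFDerivAt (s, t) (f := Prod.fst) hasFDerivAt_fst
    refine (hasFDerivAt_snd.mul h1).congr_fderiv ?_
    ext <;> simp
  · filter_upwards [huM] with x hx using ⟨hx, hζ01 x⟩

theorem ContinuousOn.aestronglyMeasurable_comp_Icc
    (huM : ∀ᵐ x ∂(volume.restrict Ω), u x ∈ Icc 0 M)
    (hu : AEStronglyMeasurable u (volume.restrict Ω)) {k : ℝ → ℝ} (hk : ContinuousOn k (Icc 0 M)) :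
    AEStronglyMeasurable (fun x => k (u x)) (volume.restrict Ω) :=
  aestronglyMeasurable_comp_of_continuousOn measurableSet_Icc hk hu.aemeasurable huM

theorem ContinuousOn.exists_ae_bound_comp_Icc
    (huM : ∀ᵐ x ∂(volume.restrict Ω), u x ∈ Icc 0 M) {k : ℝ → ℝ} (hk : ContinuousOn k (Icc 0 M)) :
    ∃ C, 0 ≤ C ∧ ∀ᵐ x ∂(volume.restrict Ω), |k (u x)| ≤ C := by
  obtain ⟨C, hC⟩ := isCompact_Icc.exists_bound_of_continuousOn hk
  refine ⟨max C 0, le_max_right _ _, ?_⟩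
  filter_upwards [huM] with x hx using (hC _ hx).trans (le_max_left _ _)

namespace IsSublinearSupersolution

theorem aestronglyMeasurable (h : IsSublinearSupersolution Ω p m P γ Γ q M A a u G) :
    AEStronglyMeasurable u (volume.restrict Ω) := h.mem.memLp.1

/-- Testing the inequality with `ζ g(u)`. The absorption term `B u^{2q-1}` only matters where `u` is
not small, which is expressed by the hypothesis on `R`. -/
theorem energy_le (h : IsSublinearSupersolution Ω p m P γ Γ q M A a u G) {ζ : E N → ℝ}
    (hζ : IsTestFunction Ω ζ) (hζ01 : ∀ x, ζ x ∈ Icc (0 : ℝ) 1) :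
    ∃ b > 0, ∃ B ≥ 0, ∀ (g g' : ℝ → ℝ) (R : ℝ), IsDecreasingProfile M g g' → 0 ≤ R →
      (∀ s ∈ Icc 0 M, B * (s ^ (2 * q - 1) * g s) ≤ b * (s ^ (q - 1) * g s) + R) →
      γ / (P - 1) * (∫ x in Ω, ζ x * -g' (u x) * ‖G x‖ ^ p x) +
        b * (∫ x in Ω, ζ x * (u x ^ (q - 1) * g (u x))) ≤
      R * volume.real Ω +
        ∫ x in Ω, g (u x) * (Γ / (m - 1) * ‖G x‖ ^ (p x - 1)) * ‖gradient ζ x‖ := by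
  obtain ⟨b, hb, B, hB, hineq⟩ := h.ineq (tsupport ζ) hζ.2.1 hζ.2.2
  -- half of the source is used to absorb the term `B u^{2q-1}`
  refine ⟨b / 2, half_pos hb, B, hB, fun g g' R hg hR hgR => ?_⟩
  obtain ⟨ε, hε, hgs⟩ := hg.contDiffOn
  have hfin := h.field.exponent.isFiniteMeasure
  have hp := h.field.exponent
  have hm1 : 0 < m - 1 := by linarith [h.field.one_lt]
  have hΓ := h.field.Pos
  have hu := h.mem_Icc
  have hum := h.aestronglyMeasurable
  have hφ := MemW0.mul_comp hp hζ hζ01 h.mem hu hε hgs hg.hasDerivAt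
  have hgc : ContinuousOn g (Icc 0 M) := fun s hs => (hg.hasDerivAt s hs).continuousAt.continuousWithinAt
  have hgm := ContinuousOn.aestronglyMeasurable_comp_Icc hu hum hgc
  have hg'm := ContinuousOn.aestronglyMeasurable_comp_Icc hu hum hg.continuousOn
  obtain ⟨C, hC0, hC⟩ := ContinuousOn.exists_ae_bound_comp_Icc hu hgc
  obtain ⟨C', hC0', hC'⟩ := ContinuousOn.exists_ae_bound_comp_Icc hu hg.continuousOn
  have hζm : AEStronglyMeasurable ζ (volume.restrict Ω) := hζ.1.continuous.aestronglyMeasurable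
  have hφb : ∀ᵐ x ∂(volume.restrict Ω), |ζ x * g (u x)| ≤ C := by
    filter_upwards [hC] with x hx
    rw [abs_mul, abs_of_nonneg (hζ01 x).1]
    exact (mul_le_mul (hζ01 x).2 hx (abs_nonneg _) zero_le_one).trans (one_mul C).le
  have h1 := hineq _ _ hφ (by
    filter_upwards [hu] with x hx using mul_nonneg (hζ01 x).1 (hg.nonneg _ hx)) ⟨C, hφb⟩
    fun x hx => by rw [image_eq_zero_of_notMem_tsupport hx, zero_mul]
  -- integrability of the zeroth order terms
  have hpow : ∀ r : ℝ, 0 ≤ r → IntegrableOn (fun x => u x ^ r * (ζ x * g (u x))) Ω := by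
    intro r hr
    have hc : ContinuousOn (fun s : ℝ => s ^ r) (Icc 0 M) := (Real.continuous_rpow_const hr).continuousOn
    obtain ⟨Cr, hCr0, hCr⟩ := ContinuousOn.exists_ae_bound_comp_Icc hu hc
    have := ContinuousOn.aestronglyMeasurable_comp_Icc hu hum hc
    refine Integrable.of_bound (C := Cr * C) (this.mul (hζm.mul hgm)) ?_
    filter_upwards [hCr, hφb] with x h1 h2
    rw [norm_mul]
    exact mul_le_mul h1 h2 (norm_nonneg _) hCr0
  have hi1 := hpow (q - 1) (by linarith [h.one_lt_q])
  have hi2 := hpow (2 * q - 1) (by linarith [h.one_lt_q])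
  -- splitting of the gradient term
  have hG := h.mem.memLp_grad
  have hm1' : MemLpVar Ω p (fun x => (ζ x * g' (u x)) • G x) :=
    hG.smul_of_bound hp (hζm.mul hg'm) (C := C') (by
      filter_upwards [hC'] with x hx
      rw [abs_mul, abs_of_nonneg (hζ01 x).1]
      exact (mul_le_mul (hζ01 x).2 hx (abs_nonneg _) zero_le_one).trans (one_mul C').le)
  have hm2' : MemLpVar Ω p (fun x => g (u x) • gradient ζ x) :=
    (hζ.memLpVar_gradient hp).smul_of_bound hp hgm hC
  have hsplit : ∫ x in Ω, inner ℝ (a x (G x)) ((ζ x * g' (u x)) • G x + g (u x) • gradient ζ x) =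
      (∫ x in Ω, inner ℝ (a x (G x)) ((ζ x * g' (u x)) • G x)) +
        ∫ x in Ω, inner ℝ (a x (G x)) (g (u x) • gradient ζ x) := by
    rw [← integral_add (h.field.integrable_inner hG hm1') (h.field.integrable_inner hG hm2')]
    simp only [inner_add_right]
  have hGp := hG.integrable_rpow hp
  have hgrad1 : γ / (P - 1) * (∫ x in Ω, ζ x * -g' (u x) * ‖G x‖ ^ p x) ≤
      - ∫ x in Ω, inner ℝ (a x (G x)) ((ζ x * g' (u x)) • G x) := by
    rw [← integral_const_mul, ← integral_neg]
    refine integral_mono_ae ?_ (h.field.integrable_inner hG hm1').neg ?_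
    · refine Integrable.const_mul ?_ _
      refine Integrable.bdd_mul hGp (hζm.mul hg'm.neg) (c := C') ?_
      filter_upwards [hC'] with x hx
      rw [norm_mul, norm_neg, Real.norm_of_nonneg (hζ01 x).1]
      exact (mul_le_mul (hζ01 x).2 hx (abs_nonneg _) zero_le_one).trans (one_mul C').le
    · filter_upwards [h.field.ae_le_potential, hu] with x hx hux
      have h2 : 0 ≤ ζ x * -g' (u x) := mul_nonneg (hζ01 x).1 (by linarith [hg.nonpos _ hux])
      calc γ / (P - 1) * (ζ x * -g' (u x) * ‖G x‖ ^ p x)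
          = ζ x * -g' (u x) * (γ / (P - 1) * ‖G x‖ ^ p x) := by ring
        _ ≤ ζ x * -g' (u x) * inner ℝ (a x (G x)) (G x) := mul_le_mul_of_nonneg_left (hx _) h2
        _ = _ := by
          rw [inner_smul_right]; ring
  have hgrad2 : ∫ x in Ω, inner ℝ (a x (G x)) (g (u x) • gradient ζ x) ≤
      ∫ x in Ω, g (u x) * (Γ / (m - 1) * ‖G x‖ ^ (p x - 1)) * ‖gradient ζ x‖ := by
    obtain ⟨L, hL0, hL⟩ := hζ.exists_bound
    refine integral_mono_ae (h.field.integrable_inner hG hm2') ?_ ?_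
    · refine Integrable.mul_bdd (c := L) ?_ hζ.continuous_gradient.norm.aestronglyMeasurable
        (Eventually.of_forall fun x => by rw [norm_norm]; exact (hL x).2)
      refine Integrable.bdd_mul (c := C) ?_ hgm hC
      refine Integrable.const_mul ?_ _
      refine Integrable.mono' (hGp.add (integrable_const 1))
        (hG.1.norm.aemeasurable.pow (hp.aemeasurable.sub_const 1)).aestronglyMeasurable ?_
      filter_upwards [hp.ae_mem] with x hx
      have hpx : 1 < p x := by linarith [h.field.one_lt, h.field.le_exponent x hx]
      rw [Real.norm_of_nonneg (by positivity)]
      simpa using rpow_sub_one_mul_le (norm_nonneg (G x)) zero_le_one hpx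
    · filter_upwards [h.field.ae_norm_le, hu] with x hx hux
      have h2 := hg.nonneg _ hux
      rw [inner_smul_right, mul_assoc]
      refine mul_le_mul_of_nonneg_left ((real_inner_le_norm _ _).trans ?_) h2
      exact mul_le_mul_of_nonneg_right (hx _) (norm_nonneg _)
  -- absorption of the zeroth order term
  have habs : B * (∫ x in Ω, u x ^ (2 * q - 1) * (ζ x * g (u x))) ≤
      b / 2 * (∫ x in Ω, u x ^ (q - 1) * (ζ x * g (u x))) + R * volume.real Ω := by
    have hconst : R * volume.real Ω = ∫ x in Ω, R := by
      rw [setIntegral_const, smul_eq_mul, mul_comm]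
    rw [hconst, ← integral_const_mul, ← integral_const_mul,
      ← integral_add (hi1.const_mul _) (integrable_const R)]
    refine integral_mono_ae (hi2.const_mul _) ((hi1.const_mul _).add (integrable_const R)) ?_
    filter_upwards [hu] with x hux
    have h2 := mul_le_mul_of_nonneg_left (hgR _ hux) (hζ01 x).1
    have h3 : ζ x * R ≤ R := mul_le_of_le_one_left hR (hζ01 x).2
    calc B * (u x ^ (2 * q - 1) * (ζ x * g (u x))) = ζ x * (B * (u x ^ (2 * q - 1) * g (u x))) := by
          ring
      _ ≤ ζ x * (b / 2 * (u x ^ (q - 1) * g (u x)) + R) := h2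
      _ = b / 2 * (u x ^ (q - 1) * (ζ x * g (u x))) + ζ x * R := by ring
      _ ≤ _ := by linarith
  have hcomm : ∫ x in Ω, ζ x * (u x ^ (q - 1) * g (u x)) =
      ∫ x in Ω, u x ^ (q - 1) * (ζ x * g (u x)) := by
    congr 1; ext1 x; ring
  rw [hsplit] at h1
  rw [hcomm]
  linarith

/-- Uniform local bounds for a sequence of profiles, when the cutoff terms are uniformly
integrable. -/
theorem exists_local_bound (h : IsSublinearSupersolution Ω p m P γ Γ q M A a u G)
    {K : Set (E N)} (hK : IsCompact K) (hKΩ : K ⊆ Ω) {g g' : ℕ → ℝ → ℝ}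
    (hg : ∀ n, IsDecreasingProfile M (g n) (g' n))
    (hR : ∀ b > 0, ∀ B ≥ 0, ∃ R ≥ 0, ∀ n, ∀ s ∈ Icc 0 M,
      B * (s ^ (2 * q - 1) * g n s) ≤ b * (s ^ (q - 1) * g n s) + R)
    (hD : ∀ ζ, IsTestFunction Ω ζ → ∃ D : E N → ℝ, IntegrableOn D Ω ∧
      ∀ n, ∀ᵐ x ∂(volume.restrict Ω),
        g n (u x) * (Γ / (m - 1) * ‖G x‖ ^ (p x - 1)) * ‖gradient ζ x‖ ≤ D x) :
    ∃ C, ∀ n, (IntegrableOn (fun x => -g' n (u x) * ‖G x‖ ^ p x) K ∧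
        ∫ x in K, -g' n (u x) * ‖G x‖ ^ p x ≤ C) ∧
      (IntegrableOn (fun x => u x ^ (q - 1) * g n (u x)) K ∧
        ∫ x in K, u x ^ (q - 1) * g n (u x) ≤ C) := by
  have hp := h.field.exponent
  have hfin := hp.isFiniteMeasure
  obtain ⟨ζ, hζ, hζK, hζ01⟩ := exists_isTestFunction_cutoff hp.isOpen hK hKΩ
  obtain ⟨b, hb, B, hB, hen⟩ := h.energy_le hζ hζ01
  obtain ⟨R, hR0, hRn⟩ := hR b hb B hB
  obtain ⟨D, hDi, hDn⟩ := hD ζ hζ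
  have hc : 0 < γ / (P - 1) := div_pos h.field.pos (by linarith [h.field.one_lt, h.field.m_le])
  set S := R * volume.real Ω + ∫ x in Ω, |D x| with hS
  have hS0 : 0 ≤ S := add_nonneg (mul_nonneg hR0 measureReal_nonneg)
    (integral_nonneg fun x => abs_nonneg _)
  have hu := h.mem_Icc
  have hum := h.aestronglyMeasurable
  have hζm : AEStronglyMeasurable ζ (volume.restrict Ω) := hζ.1.continuous.aestronglyMeasurable
  have hGp := h.mem.memLp_grad.integrable_rpow hp
  have hKm : MeasurableSet K := hK.measurableSet
  -- restriction of an integral with cutoff to `K`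
  have hres : ∀ k : E N → ℝ, IntegrableOn k Ω → (∀ᵐ x ∂(volume.restrict Ω), 0 ≤ k x) →
      IntegrableOn k K ∧ ∫ x in K, k x ≤ ∫ x in Ω, ζ x * k x := by
    intro k hk hk0
    refine ⟨hk.mono_set hKΩ, ?_⟩
    have h1 : ∫ x in K, k x = ∫ x in K, ζ x * k x :=
      setIntegral_congr_fun hKm fun x hx => by simp only [hζK x hx, one_mul]
    rw [h1]
    refine setIntegral_mono_set ?_ ?_ (Eventually.of_forall hKΩ)
    · exact Integrable.bdd_mul hk hζm (c := 1) (Eventually.of_forall fun x => by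
        rw [Real.norm_of_nonneg (hζ01 x).1]; exact (hζ01 x).2)
    · filter_upwards [hk0] with x hx using mul_nonneg (hζ01 x).1 hx
  refine ⟨max (S / (γ / (P - 1))) (S / b), fun n => ?_⟩
  have hgn := hg n
  have hgc : ContinuousOn (g n) (Icc 0 M) :=
    fun s hs => (hgn.hasDerivAt s hs).continuousAt.continuousWithinAt
  have hk1 : IntegrableOn (fun x => -g' n (u x) * ‖G x‖ ^ p x) Ω := by
    obtain ⟨C', -, hC'⟩ := ContinuousOn.exists_ae_bound_comp_Icc hu hgn.continuousOn
    exact Integrable.bdd_mul hGp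
      (ContinuousOn.aestronglyMeasurable_comp_Icc hu hum hgn.continuousOn).neg (c := C')
      (by filter_upwards [hC'] with x hx; rwa [norm_neg])
  have hk2 : IntegrableOn (fun x => u x ^ (q - 1) * g n (u x)) Ω := by
    have hcc : ContinuousOn (fun s : ℝ => s ^ (q - 1) * g n s) (Icc 0 M) :=
      (Real.continuous_rpow_const (by linarith [h.one_lt_q])).continuousOn.mul hgc
    obtain ⟨C', -, hC'⟩ := ContinuousOn.exists_ae_bound_comp_Icc hu hcc
    exact Integrable.of_bound (ContinuousOn.aestronglyMeasurable_comp_Icc hu hum hcc) C' hC'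
  have hk1n : ∀ᵐ x ∂(volume.restrict Ω), 0 ≤ -g' n (u x) * ‖G x‖ ^ p x := by
    filter_upwards [hu] with x hx
    exact mul_nonneg (by linarith [hgn.nonpos _ hx]) (by positivity)
  have hk2n : ∀ᵐ x ∂(volume.restrict Ω), 0 ≤ u x ^ (q - 1) * g n (u x) := by
    filter_upwards [hu] with x hx
    exact mul_nonneg (Real.rpow_nonneg hx.1 _) (hgn.nonneg _ hx)
  obtain ⟨i1, l1⟩ := hres _ hk1 hk1n
  obtain ⟨i2, l2⟩ := hres _ hk2 hk2n
  have h1 := hen (g n) (g' n) R hgn hR0 (hRn n)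
  have h2 : ∫ x in Ω, g n (u x) * (Γ / (m - 1) * ‖G x‖ ^ (p x - 1)) * ‖gradient ζ x‖ ≤
      ∫ x in Ω, |D x| := by
    refine integral_mono_of_nonneg ?_ hDi.abs ?_
    · filter_upwards [hu] with x hx
      have := hgn.nonneg _ hx
      have := h.field.Pos
      have : 0 < m - 1 := by linarith [h.field.one_lt]
      simp only [Pi.zero_apply]
      positivity
    · filter_upwards [hDn n] with x hx using hx.trans (le_abs_self _)
  have h3 : 0 ≤ ∫ x in Ω, ζ x * (-g' n (u x) * ‖G x‖ ^ p x) := integral_nonneg_of_ae (by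
    filter_upwards [hk1n] with x hx using mul_nonneg (hζ01 x).1 hx)
  have h4 : 0 ≤ ∫ x in Ω, ζ x * (u x ^ (q - 1) * g n (u x)) := integral_nonneg_of_ae (by
    filter_upwards [hk2n] with x hx using mul_nonneg (hζ01 x).1 hx)
  simp only [mul_assoc] at h1 h2 h3 l1
  have h5 := mul_nonneg hc.le h3
  have h6 := mul_nonneg hb.le h4
  refine ⟨⟨i1, l1.trans (le_trans ?_ (le_max_left _ _))⟩,
    ⟨i2, l2.trans (le_trans ?_ (le_max_right _ _))⟩⟩
  · rw [le_div_iff₀' hc]; linarith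
  · rw [le_div_iff₀' hb]; linarith

end IsSublinearSupersolution

end Energy

/-! ### Negative moments and positivity of supersolutions -/

section Positivity

variable {N : ℕ} {Ω : Set (E N)} {p : E N → ℝ} {m P γ Γ q M : ℝ} {A : E N → E N → ℝ}
  {a : E N → E N → E N} {u : E N → ℝ} {G : E N → E N}

/-- Local integrability of `|∇u|^{p(x)} u^{-s}` and of `u^{q-s}` on the positivity set of `u`, and
vanishing of the gradient `G` of `u` where `u = 0`. As `0 ^ (-s) = 0` and `0 ^ (q - 1) = 0` in `ℝ`,
the zero set of `u` does not contribute to the integrals. -/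
def HasNegativeMoments (Ω : Set (E N)) (p : E N → ℝ) (q : ℝ) (u : E N → ℝ) (G : E N → E N)
    (s : ℝ) : Prop :=
  ∀ K, IsCompact K → K ⊆ Ω → (∀ᵐ x ∂(volume.restrict K), u x = 0 → G x = 0) ∧
    IntegrableOn (fun x => ‖G x‖ ^ p x * u x ^ (-s)) K ∧
    IntegrableOn (fun x => u x ^ (q - 1) * u x ^ (1 - s)) K

/-- A sequence of positive shifts decreasing to zero. -/
noncomputable def shift (n : ℕ) : ℝ := 1 / ((n : ℝ) + 1)

theorem shift_pos (n : ℕ) : 0 < shift n := Nat.one_div_pos_of_nat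

theorem shift_le_one (n : ℕ) : shift n ≤ 1 := by
  unfold shift
  rw [div_le_one (by positivity)]
  linarith [n.cast_nonneg (α := ℝ)]

theorem tendsto_shift : Tendsto shift atTop (𝓝 0) := tendsto_one_div_add_atTop_nhds_zero_nat

theorem tendsto_add_shift (s : ℝ) : Tendsto (fun n => s + shift n) atTop (𝓝 s) := by
  simpa using tendsto_shift.const_add s

theorem tendsto_add_shift_rpow {s : ℝ} (hs : 0 < s) (r : ℝ) :
    Tendsto (fun n => (s + shift n) ^ r) atTop (𝓝 (s ^ r)) :=
  (tendsto_add_shift s).rpow_const (Or.inl hs.ne')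

theorem hasDerivAt_add_rpow {s ε : ℝ} (h : 0 < s + ε) (r : ℝ) :
    HasDerivAt (fun s : ℝ => (s + ε) ^ r) (r * (s + ε) ^ (r - 1)) s := by
  simpa using ((hasDerivAt_id s).add_const ε).rpow_const (p := r) (Or.inl h.ne')

theorem contDiffOn_add_rpow (ε r : ℝ) :
    ContDiffOn ℝ ((⊤ : ℕ∞) : WithTop ℕ∞) (fun s : ℝ => (s + ε) ^ r) (Ioi (-ε)) :=
  (contDiff_id.add contDiff_const).contDiffOn.rpow_const_of_ne fun s hs => by
    have : -ε < s := hs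
    simp only [id]
    linarith

theorem continuousOn_add_rpow {ε : ℝ} (hε : 0 < ε) (r M : ℝ) :
    ContinuousOn (fun s : ℝ => (s + ε) ^ r) (Icc 0 M) := fun s hs =>
  (hasDerivAt_add_rpow (by linarith [hs.1]) r).continuousAt.continuousWithinAt

theorem isDecreasingProfile_rpow_neg (M : ℝ) {ε σ : ℝ} (hε : 0 < ε) (hσ : 0 < σ) :
    IsDecreasingProfile M (fun s => (s + ε) ^ (-σ)) (fun s => -σ * (s + ε) ^ (-σ - 1)) where
  contDiffOn := ⟨ε, hε, contDiffOn_add_rpow ε _⟩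
  continuousOn := (continuousOn_add_rpow hε _ M).const_smul (-σ)
  hasDerivAt s hs := hasDerivAt_add_rpow (by linarith [hs.1]) _
  nonneg s hs := Real.rpow_nonneg (by linarith [hs.1]) _
  nonpos s hs := mul_nonpos_of_nonpos_of_nonneg (by linarith)
    (Real.rpow_nonneg (by linarith [hs.1]) _)

theorem isDecreasingProfile_const_sub_rpow {M ε τ : ℝ} (hε : 0 < ε) (hε1 : ε ≤ 1)
    (hτ : 0 < τ) : IsDecreasingProfile M (fun s => (M + 1) ^ τ - (s + ε) ^ τ)
      (fun s => -(τ * (s + ε) ^ (τ - 1))) where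
  contDiffOn := ⟨ε, hε, contDiffOn_const.sub (contDiffOn_add_rpow ε _)⟩
  continuousOn := ((continuousOn_add_rpow hε _ M).const_smul τ).neg
  hasDerivAt s hs := (hasDerivAt_add_rpow (by linarith [hs.1]) _).const_sub _
  nonneg s hs := sub_nonneg.2
    (Real.rpow_le_rpow (by linarith [hs.1]) (by linarith [hs.2]) hτ.le)
  nonpos s hs := neg_nonpos.2 (mul_nonneg hτ.le (Real.rpow_nonneg (by linarith [hs.1]) _))

namespace IsSublinearSupersolution

/-- The first negative moments: for `s < 1` the bounded profile `C - (u + ε)^{1-s}` is available. -/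
theorem hasNegativeMoments_of_lt_one (h : IsSublinearSupersolution Ω p m P γ Γ q M A a u G) {s : ℝ}
    (hs0 : 0 < s) (hs1 : s < 1) : HasNegativeMoments Ω p q u G s := by
  intro K hK hKΩ
  have hp := h.field.exponent
  have hfin := hp.isFiniteMeasure
  have hM : 0 ≤ M := by linarith [h.one_le]
  have hm1 : 0 < m - 1 := by linarith [h.field.one_lt]
  have hΓ := h.field.Pos
  have hu := h.mem_Icc
  have huK := ae_restrict_of_ae_restrict_of_subset hKΩ hu
  have hτ : 0 < 1 - s := by linarith
  set Q : ℝ := (M + 1) ^ (1 - s) with hQ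
  have hQ0 : 0 ≤ Q := Real.rpow_nonneg (by linarith) _
  have hgQ : ∀ n, ∀ t ∈ Icc 0 M, Q - (t + shift n) ^ (1 - s) ≤ Q := fun n t ht =>
    sub_le_self _ (Real.rpow_nonneg (by linarith [ht.1, shift_pos n]) _)
  have hprof := fun n => isDecreasingProfile_const_sub_rpow (M := M) (shift_pos n) (shift_le_one n) hτ
  obtain ⟨C, hC⟩ := h.exists_local_bound hK hKΩ hprof (by
    intro b hb B hB
    refine ⟨B * (M ^ (2 * q - 1) * Q), by positivity, fun n t ht => ?_⟩
    have h1 := (hprof n).nonneg t ht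
    have h2 : t ^ (2 * q - 1) ≤ M ^ (2 * q - 1) :=
      Real.rpow_le_rpow ht.1 ht.2 (by linarith [h.one_lt_q])
    have h3 := mul_le_mul h2 (hgQ n t ht) h1 (by positivity)
    have h4 : 0 ≤ b * (t ^ (q - 1) * (Q - (t + shift n) ^ (1 - s))) :=
      mul_nonneg hb.le (mul_nonneg (Real.rpow_nonneg ht.1 _) h1)
    have h5 := mul_le_mul_of_nonneg_left h3 hB
    exact h5.trans (le_add_of_nonneg_left h4)) (by
    intro ζ hζ
    obtain ⟨L, hL0, hL⟩ := hζ.exists_bound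
    refine ⟨fun x => Q * (Γ / (m - 1)) * L * (‖G x‖ ^ p x + 1),
      ((h.mem.memLp_grad.integrable_rpow hp).add (integrable_const 1)).const_mul _, fun n => ?_⟩
    filter_upwards [hu, hp.ae_mem] with x hx hxΩ
    have hpx : 1 < p x := by linarith [h.field.one_lt, h.field.le_exponent x hxΩ]
    have h1 := rpow_sub_one_mul_le (norm_nonneg (G x)) zero_le_one hpx
    rw [mul_one, Real.one_rpow] at h1
    have h2 := hgQ n _ hx
    have h4 := (hL x).2
    calc _ ≤ Q * (Γ / (m - 1) * (‖G x‖ ^ p x + 1)) * L := by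
            gcongr
      _ = _ := by ring)
  simp only [neg_neg] at hC
  have hF0 : ∀ n, ∀ᵐ x ∂(volume.restrict K),
      0 ≤ (1 - s) * (u x + shift n) ^ (1 - s - 1) * ‖G x‖ ^ p x := fun n => by
    filter_upwards [huK] with x hx
    have : 0 < u x + shift n := by linarith [hx.1, shift_pos n]
    positivity
  have hzero : ∀ᵐ x ∂(volume.restrict K), u x = 0 → G x = 0 := by
    filter_upwards [ae_not_tendsto_atTop_of_integral_le (fun n => (hC n).1.1) hF0
      fun n => (hC n).1.2] with x hx hux
    by_contra hGx
    refine hx ?_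
    have h1 : 0 < ‖G x‖ ^ p x := Real.rpow_pos_of_pos (norm_pos_iff.2 hGx) _
    simp only [hux, zero_add]
    refine Tendsto.atTop_mul_const h1 (Tendsto.const_mul_atTop hτ ?_)
    have h2 : (fun n => shift n ^ (1 - s - 1)) = fun n : ℕ => ((n : ℝ) + 1) ^ s := by
      ext1 n
      rw [shift, one_div, Real.inv_rpow (by positivity), ← Real.rpow_neg (by positivity)]
      congr 1; ring
    rw [h2]
    exact (tendsto_rpow_atTop hs0).comp
      (tendsto_atTop_add_const_right _ _ tendsto_natCast_atTop_atTop)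
  refine ⟨hzero, ?_, ?_⟩
  · have hint : IntegrableOn (fun x => (1 - s) * (‖G x‖ ^ p x * u x ^ (-s))) K := by
      refine integrable_of_tendsto_of_integral_le (fun n => (hC n).1.1) hF0 (fun n => (hC n).1.2) ?_
      filter_upwards [hzero, huK, ae_restrict_of_ae_restrict_of_subset hKΩ hp.ae_mem] with x hx hux hxΩ
      rcases hux.1.eq_or_lt with h0 | h0
      · rw [hx h0.symm, norm_zero, Real.zero_rpow (by
          linarith [h.field.one_lt, h.field.le_exponent x hxΩ])]
        simp
      · have := ((tendsto_add_shift_rpow h0 (1 - s - 1)).const_mul (1 - s)).mul_const (‖G x‖ ^ p x)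
        convert this using 2
        rw [show 1 - s - 1 = -s by ring]; ring
    have := hint.const_mul (1 - s)⁻¹
    refine this.congr (Eventually.of_forall fun x => ?_)
    simp only
    rw [inv_mul_cancel_left₀ hτ.ne']
  · have hc : ContinuousOn (fun t : ℝ => t ^ (q - 1) * t ^ (1 - s)) (Icc 0 M) :=
      ((Real.continuous_rpow_const (by linarith [h.one_lt_q])).mul
        (Real.continuous_rpow_const hτ.le)).continuousOn
    obtain ⟨C', -, hC'⟩ := ContinuousOn.exists_ae_bound_comp_Icc hu hc
    have hint : IntegrableOn (fun x => u x ^ (q - 1) * u x ^ (1 - s)) Ω := Integrable.of_bound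
      (ContinuousOn.aestronglyMeasurable_comp_Icc hu h.aestronglyMeasurable hc) C' hC'
    exact hint.mono_set hKΩ

/-- Young's inequality for the cutoff term: `X^{r-1} w^{-σ}` is bounded by the integrands
`X^r w^{-s}` and `w^{q-s}` of the negative moments of order `s = σ + q / m`, since the surplus
`q (r / m - 1)` in the exponent of `w` is nonnegative for `r ≥ m`. -/
theorem cutoff_term_le {X w M s σ r q m P : ℝ} (hX : 0 ≤ X) (hw : 0 < w) (hwM : w ≤ M) (hM : 1 ≤ M)
    (hr : 1 < r) (hm : 1 < m) (hmr : m ≤ r) (hrP : r ≤ P) (hq : 0 < q) (hσ : σ = s - q / m) :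
    w ^ (-σ) * X ^ (r - 1) ≤ X ^ r * w ^ (-s) + M ^ (q * P) * (w ^ (q - 1) * w ^ (1 - s)) := by
  have hr0 : r ≠ 0 := by linarith
  have h1 := rpow_sub_one_mul_le (x := X * w ^ (-s / r)) (y := w ^ (-σ + s * (r - 1) / r))
    (by positivity) (by positivity) hr
  rw [Real.mul_rpow hX (by positivity), Real.mul_rpow hX (by positivity), ← Real.rpow_mul hw.le,
    ← Real.rpow_mul hw.le, ← Real.rpow_mul hw.le, mul_assoc, ← Real.rpow_add hw] at h1
  have e1 : -s / r * (r - 1) + (-σ + s * (r - 1) / r) = -σ := by ring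
  have e2 : -s / r * r = -s := by field_simp
  have e3 : (-σ + s * (r - 1) / r) * r = q * (r / m - 1) + ((q - 1) + (1 - s)) := by
    rw [hσ]; field_simp; ring
  rw [e1, e2, e3, Real.rpow_add hw, Real.rpow_add hw (q - 1)] at h1
  rw [mul_comm (w ^ (-σ))]
  refine h1.trans ?_
  gcongr
  have h3 : 1 ≤ r / m := (one_le_div (by linarith)).2 hmr
  calc w ^ (q * (r / m - 1)) ≤ M ^ (q * (r / m - 1)) := by
        gcongr
    _ ≤ M ^ (q * P) := by
        apply Real.rpow_le_rpow_of_exponent_le hM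
        gcongr
        have : r / m ≤ r := div_le_self (by linarith) hm.le
        linarith

/-- Improvement of the negative moments: testing with `ζ (u + ε)^{-σ}`, where `σ = s - q / m`, yields
the moments of order `σ + 1`, while the cutoff term is controlled by those of order `s`. The gain
`1 - q / m` is positive because `q < m`. -/
theorem hasNegativeMoments_step (h : IsSublinearSupersolution Ω p m P γ Γ q M A a u G) {s : ℝ}
    (hs : q / m < s) (hmom : HasNegativeMoments Ω p q u G s) :
    HasNegativeMoments Ω p q u G (s + (1 - q / m)) := by
  intro K hK hKΩ
  have hp := h.field.exponent
  have hfin := hp.isFiniteMeasure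
  have hM : 0 < M := by linarith [h.one_le]
  have hm1 : 0 < m - 1 := by linarith [h.field.one_lt]
  have hΓ := h.field.Pos
  have hq1 := h.one_lt_q
  have hu := h.mem_Icc
  have huK := ae_restrict_of_ae_restrict_of_subset hKΩ hu
  set σ := s - q / m with hσ
  have hσ0 : 0 < σ := by linarith
  have hprof := fun n => isDecreasingProfile_rpow_neg M (shift_pos n) hσ0
  have hgle : ∀ n, ∀ t : ℝ, 0 < t → (t + shift n) ^ (-σ) ≤ t ^ (-σ) := fun n t ht =>
    Real.rpow_le_rpow_of_nonpos ht (by linarith [shift_pos n]) (by linarith)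
  obtain ⟨C, hC⟩ := h.exists_local_bound hK hKΩ hprof (by
    intro b hb B hB
    -- below the threshold `δ` the source dominates the absorption
    set δ : ℝ := (b / (B + 1)) ^ q⁻¹ with hδ
    have hδ0 : 0 < δ := by positivity
    refine ⟨B * (M ^ (2 * q - 1) * δ ^ (-σ)), by positivity, fun n t ht => ?_⟩
    have h1 := (hprof n).nonneg t ht
    rcases le_total t δ with htδ | htδ
    · have h2 : t ^ q ≤ b / (B + 1) := by
        have := Real.rpow_le_rpow ht.1 htδ (show 0 ≤ q by linarith)
        rwa [hδ, Real.rpow_inv_rpow (by positivity) (by linarith)] at this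
      have h3 : B * t ^ q ≤ b := by
        rw [le_div_iff₀ (by positivity)] at h2
        nlinarith [Real.rpow_nonneg ht.1 q]
      have h4 : t ^ (2 * q - 1) = t ^ q * t ^ (q - 1) := by
        rw [← Real.rpow_add' ht.1 (by linarith)]; congr 1; ring
      have h5 : 0 ≤ t ^ (q - 1) * (t + shift n) ^ (-σ) := mul_nonneg (Real.rpow_nonneg ht.1 _) h1
      rw [h4]
      calc B * (t ^ q * t ^ (q - 1) * (t + shift n) ^ (-σ))
          = (B * t ^ q) * (t ^ (q - 1) * (t + shift n) ^ (-σ)) := by ring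
        _ ≤ b * (t ^ (q - 1) * (t + shift n) ^ (-σ)) := mul_le_mul_of_nonneg_right h3 h5
        _ ≤ _ := le_add_of_nonneg_right (by positivity)
    · have ht0 : 0 < t := hδ0.trans_le htδ
      have h2 : (t + shift n) ^ (-σ) ≤ δ ^ (-σ) :=
        (hgle n t ht0).trans (Real.rpow_le_rpow_of_nonpos hδ0 htδ (by linarith))
      have h3 : t ^ (2 * q - 1) ≤ M ^ (2 * q - 1) := Real.rpow_le_rpow ht.1 ht.2 (by linarith)
      have h4 := mul_le_mul_of_nonneg_left (mul_le_mul h3 h2 h1 (by positivity)) hB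
      refine h4.trans (le_add_of_nonneg_left ?_)
      exact mul_nonneg hb.le (mul_nonneg (Real.rpow_nonneg ht.1 _) h1)) (by
    intro ζ hζ
    obtain ⟨L, hL0, hL⟩ := hζ.exists_bound
    obtain ⟨hz, hi1, hi2⟩ := hmom (tsupport ζ) hζ.2.1 hζ.2.2
    have hTm : MeasurableSet (tsupport ζ) := (isClosed_tsupport ζ).measurableSet
    refine ⟨(tsupport ζ).indicator fun x => (Γ / (m - 1)) * L * (‖G x‖ ^ p x * u x ^ (-s) +
      M ^ (q * P) * (u x ^ (q - 1) * u x ^ (1 - s))), ?_, fun n => ?_⟩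
    · exact ((integrable_indicator_iff hTm).2 ((hi1.add (hi2.const_mul _)).const_mul _)).integrableOn
    have hz' := ae_restrict_of_ae (s := Ω) ((ae_restrict_iff' hTm).1 hz)
    filter_upwards [hu, hp.ae_mem, hz'] with x hx hxΩ hzx
    have hpx : 1 < p x := by linarith [h.field.one_lt, h.field.le_exponent x hxΩ]
    by_cases hxT : x ∈ tsupport ζ
    · rw [indicator_of_mem hxT]
      rcases hx.1.eq_or_lt with h0 | h0
      · rw [hzx hxT h0.symm, norm_zero, Real.zero_rpow (by linarith : p x - 1 ≠ 0), mul_zero,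
          mul_zero, zero_mul]
        rw [← h0, Real.zero_rpow (by linarith : p x ≠ 0), Real.zero_rpow (by linarith : q - 1 ≠ 0)]
        simp
      · have h1 := cutoff_term_le (norm_nonneg (G x)) h0 hx.2 h.one_le hpx h.field.one_lt
          (h.field.le_exponent x hxΩ) (hp.le x hxΩ) (by linarith) hσ
        have h2 := hgle n _ h0
        have h3 := (hL x).2
        calc (u x + shift n) ^ (-σ) * (Γ / (m - 1) * ‖G x‖ ^ (p x - 1)) * ‖gradient ζ x‖
            ≤ u x ^ (-σ) * (Γ / (m - 1) * ‖G x‖ ^ (p x - 1)) * L := by gcongr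
          _ = Γ / (m - 1) * L * (u x ^ (-σ) * ‖G x‖ ^ (p x - 1)) := by ring
          _ ≤ _ := by gcongr
    · rw [indicator_of_notMem hxT, gradient_eq_zero_of_notMem_tsupport hxT]
      simp)
  have hzero := (hmom K hK hKΩ).1
  have e1 : -(s + (1 - q / m)) = -σ - 1 := by rw [hσ]; ring
  have e2 : 1 - (s + (1 - q / m)) = -σ := by rw [hσ]; ring
  rw [e1, e2]
  refine ⟨hzero, ?_, ?_⟩
  · have hint : IntegrableOn (fun x => σ * (‖G x‖ ^ p x * u x ^ (-σ - 1))) K := by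
      refine integrable_of_tendsto_of_integral_le (fun n => (hC n).1.1) (fun n => ?_)
        (fun n => (hC n).1.2) ?_
      · filter_upwards [huK] with x hx
        have : 0 < u x + shift n := by linarith [hx.1, shift_pos n]
        simp only [neg_mul, neg_neg]
        positivity
      · filter_upwards [hzero, huK, ae_restrict_of_ae_restrict_of_subset hKΩ hp.ae_mem]
          with x hx hux hxΩ
        rcases hux.1.eq_or_lt with h0 | h0
        · rw [hx h0.symm, norm_zero, Real.zero_rpow (by
            linarith [h.field.one_lt, h.field.le_exponent x hxΩ])]
          simp
        · have := ((tendsto_add_shift_rpow h0 (-σ - 1)).const_mul σ).mul_const (‖G x‖ ^ p x)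
          convert this using 2 <;> ring
    have := hint.const_mul σ⁻¹
    refine this.congr (Eventually.of_forall fun x => ?_)
    simp only
    rw [inv_mul_cancel_left₀ hσ0.ne']
  · refine integrable_of_tendsto_of_integral_le (fun n => (hC n).2.1) (fun n => ?_)
      (fun n => (hC n).2.2) ?_
    · filter_upwards [huK] with x hx
      have : 0 < u x + shift n := by linarith [hx.1, shift_pos n]
      exact mul_nonneg (Real.rpow_nonneg hx.1 _) (by positivity)
    · filter_upwards [huK] with x hux
      rcases hux.1.eq_or_lt with h0 | h0
      · simp [← h0, Real.zero_rpow (show q - 1 ≠ 0 by linarith)]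
      · exact (tendsto_add_shift_rpow h0 (-σ)).const_mul _

/-- Negative moments of arbitrarily large order. -/
theorem exists_hasNegativeMoments_ge (h : IsSublinearSupersolution Ω p m P γ Γ q M A a u G)
    (S : ℝ) : ∃ s, S ≤ s ∧ HasNegativeMoments Ω p q u G s := by
  have hm : 0 < m := by linarith [h.field.one_lt]
  have hqm : q / m < 1 := (div_lt_one hm).2 h.q_lt
  have hqm0 : 0 < q / m := div_pos (by linarith [h.one_lt_q]) hm
  obtain ⟨s₀, h1, h2⟩ := exists_between hqm
  have hall : ∀ n : ℕ, HasNegativeMoments Ω p q u G (s₀ + n * (1 - q / m)) := by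
    intro n
    induction n with
    | zero => simpa using h.hasNegativeMoments_of_lt_one (by linarith) h2
    | succ n ih =>
      have h3 : (0 : ℝ) ≤ n * (1 - q / m) := mul_nonneg n.cast_nonneg (by linarith)
      have := h.hasNegativeMoments_step (by linarith) ih
      convert this using 1
      push_cast; ring
  obtain ⟨n, hn⟩ := exists_nat_ge (S / (1 - q / m))
  refine ⟨_, ?_, hall n⟩
  rw [div_le_iff₀ (by linarith)] at hn
  linarith

/-- The weak gradient of `u / (u + ε)` tends to zero locally in `L¹` as `ε → 0`, since
`ε |∇u| / (u + ε)² ≤ ε (1 + |∇u|^{p(x)} u^{-2p(x)})`. Hence the indicator function of the positivity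
set of `u` has a vanishing weak gradient. -/
theorem isWeakGradient_indicator_pos (h : IsSublinearSupersolution Ω p m P γ Γ q M A a u G) :
    IsWeakGradient Ω (fun x => if 0 < u x then (1 : ℝ) else 0) 0 := by
  have hp := h.field.exponent
  have hfin := hp.isFiniteMeasure
  have hM : 0 < M := by linarith [h.one_le]
  have hu := h.mem_Icc
  have hum := h.aestronglyMeasurable
  have hFm : AEStronglyMeasurable (fun x => if 0 < u x then (1 : ℝ) else 0) (volume.restrict Ω) :=
    ((Measurable.ite measurableSet_Ioi measurable_const measurable_const :
      Measurable fun s : ℝ => if 0 < s then (1 : ℝ) else 0).comp_aemeasurable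
      hum.aemeasurable).aestronglyMeasurable
  have hFi : IntegrableOn (fun x => if 0 < u x then (1 : ℝ) else 0) Ω :=
    Integrable.of_bound hFm 1 (Eventually.of_forall fun x => by split_ifs <;> simp)
  refine ⟨hFi.locallyIntegrableOn, (integrable_zero _ _ _).integrableOn.locallyIntegrableOn,
    fun φ hφ i => ?_⟩
  simp only [Pi.zero_apply, PiLp.zero_apply, zero_mul, integral_zero, neg_zero]
  obtain ⟨L, hL0, hL⟩ := hφ.exists_bound
  -- the approximations of the indicator function
  have hder : ∀ n, ∀ s ∈ Icc 0 M, HasDerivAt (fun s => s / (s + shift n))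
      (shift n / (s + shift n) ^ 2) s := fun n s hs => by
    have h0 : s + shift n ≠ 0 := by linarith [hs.1, shift_pos n]
    have := (hasDerivAt_id s).div ((hasDerivAt_id s).add_const (shift n)) h0
    refine this.congr_deriv ?_
    simp only [id]
    ring
  have hmem : ∀ n, MemW0 Ω p (fun x => u x / (u x + shift n))
      (fun x => (shift n / (u x + shift n) ^ 2) • G x + (0 : ℝ) • G x) := fun n => by
    refine MemW0.comp hp h.mem h.mem (T := fun z => z.1 / (z.1 + shift n))
      (D₁ := fun z => shift n / (z.1 + shift n) ^ 2)
      (D₂ := fun _ => 0) (K := Icc 0 M ×ˢ Icc 0 M) (U := Ioi (-shift n) ×ˢ univ)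
      (isCompact_Icc.prod isCompact_Icc) (isOpen_Ioi.prod isOpen_univ) ?_ ?_ ?_ (by simp) ?_
    · rintro ⟨s, t⟩ ⟨hs, -⟩
      exact ⟨(neg_lt_zero.2 (shift_pos n)).trans_le hs.1, mem_univ _⟩
    · refine contDiff_fst.contDiffOn.div (contDiff_fst.add contDiff_const).contDiffOn ?_
      rintro ⟨s, t⟩ ⟨hs, -⟩
      have : -shift n < s := hs
      simp only
      linarith
    · rintro ⟨s, t⟩ ⟨hs, -⟩
      have h1 : HasFDerivAt (fun z : ℝ × ℝ => z.1 / (z.1 + shift n))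
          ((shift n / (s + shift n) ^ 2) • ContinuousLinearMap.fst ℝ ℝ ℝ) (s, t) :=
        (hder n s hs).comp_hasFDerivAt (s, t) (f := Prod.fst) hasFDerivAt_fst
      refine h1.congr_fderiv ?_
      ext <;> simp
    · filter_upwards [hu] with x hx using ⟨hx, hx⟩
  have hid : ∀ n, ∫ x in Ω, u x / (u x + shift n) * gradient φ x i =
      - ∫ x in Ω, (shift n / (u x + shift n) ^ 2) * G x i * φ x := fun n => by
    have := (hmem n).weakGradient.2.2 φ hφ i
    simpa using this
  have hlim1 : Tendsto (fun n => ∫ x in Ω, u x / (u x + shift n) * gradient φ x i) atTop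
      (𝓝 (∫ x in Ω, (if 0 < u x then (1 : ℝ) else 0) * gradient φ x i)) := by
    refine tendsto_integral_of_dominated_convergence (fun _ => L) (fun n => ?_)
      (integrable_const L) (fun n => ?_) ?_
    · exact (hmem n).memLp.1.mul ((EuclideanSpace.proj (𝕜 := ℝ) i).continuous.comp
        hφ.continuous_gradient).aestronglyMeasurable
    · filter_upwards [hu] with x hx
      have h0 : 0 < u x + shift n := by linarith [hx.1, shift_pos n]
      rw [norm_mul, Real.norm_of_nonneg (div_nonneg hx.1 h0.le)]
      have h1 : u x / (u x + shift n) ≤ 1 := (div_le_one h0).2 (by linarith [shift_pos n])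
      exact (mul_le_mul h1 ((norm_coord_le _ i).trans (hL x).2) (abs_nonneg _) zero_le_one).trans
        (one_mul L).le
    · filter_upwards [hu] with x hx
      refine Tendsto.mul_const _ ?_
      rcases hx.1.eq_or_lt with h0 | h0
      · simp [← h0]
      · rw [if_pos h0, ← div_self h0.ne']
        exact tendsto_const_nhds.div (tendsto_add_shift _) h0.ne'
  obtain ⟨s, hs, hmom⟩ := h.exists_hasNegativeMoments_ge (2 * P)
  obtain ⟨hz, hi1, -⟩ := hmom (tsupport φ) hφ.2.1 hφ.2.2
  have hTm : MeasurableSet (tsupport φ) := (isClosed_tsupport φ).measurableSet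
  have hz' := ae_restrict_of_ae (s := Ω) ((ae_restrict_iff' hTm).1 hz)
  have hlim2 : Tendsto (fun n => ∫ x in Ω, (shift n / (u x + shift n) ^ 2) * G x i * φ x) atTop
      (𝓝 (∫ x in Ω, (0 : ℝ))) := by
    refine tendsto_integral_of_dominated_convergence ((tsupport φ).indicator fun x =>
      (1 + M ^ s * (‖G x‖ ^ p x * u x ^ (-s))) * L) (fun n => ?_) ?_ (fun n => ?_) ?_
    · have h1 : AEStronglyMeasurable (fun x => shift n / (u x + shift n) ^ 2)
          (volume.restrict Ω) := by
        refine ContinuousOn.aestronglyMeasurable_comp_Icc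
          (k := fun t => shift n / (t + shift n) ^ 2) hu hum ?_
        refine continuousOn_const.div ((continuousOn_id.add continuousOn_const).pow 2) fun t ht => ?_
        have : 0 < t + shift n := by linarith [ht.1, shift_pos n]
        change (t + shift n) ^ 2 ≠ 0
        positivity
      exact (h1.mul ((EuclideanSpace.proj (𝕜 := ℝ) i).continuous.comp_aestronglyMeasurable
        h.mem.memLp_grad.1)).mul hφ.1.continuous.aestronglyMeasurable
    · have hTfin : IsFiniteMeasure (volume.restrict (tsupport φ)) :=
        ⟨by simpa using hφ.2.1.isCompact.measure_lt_top⟩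
      exact ((integrable_indicator_iff hTm).2
        (((integrable_const 1).add (hi1.const_mul _)).mul_const L)).integrableOn
    · filter_upwards [hu, hp.ae_mem, hz'] with x hx hxΩ hzx
      have hpx : 1 < p x := by linarith [h.field.one_lt, h.field.le_exponent x hxΩ]
      by_cases hxT : x ∈ tsupport φ
      · rw [indicator_of_mem hxT, norm_mul]
        refine mul_le_mul ?_ (hL x).1 (norm_nonneg _) (by have := hx.1; positivity)
        rcases hx.1.eq_or_lt with h0 | h0
        · rw [hzx hxT h0.symm, norm_zero]
          simp only [PiLp.zero_apply, mul_zero, norm_zero]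
          have := hx.1
          positivity
        · have h1 : shift n / (u x + shift n) ^ 2 ≤ (u x ^ 2)⁻¹ := by
            rw [← one_div]
            refine div_le_div₀ zero_le_one (shift_le_one n) (by positivity) ?_
            exact pow_le_pow_left₀ h0.le (by linarith [shift_pos n]) 2
          have h2 : ‖shift n / (u x + shift n) ^ 2 * G x i‖ ≤ (u x ^ 2)⁻¹ * ‖G x‖ := by
            have := shift_pos n
            rw [norm_mul, Real.norm_of_nonneg (by positivity)]
            exact mul_le_mul h1 (norm_coord_le _ i) (norm_nonneg _) (by positivity)
          refine h2.trans ?_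
          have h3 := rpow_sub_one_mul_le (y := (u x ^ 2)⁻¹ * ‖G x‖) zero_le_one (by positivity) hpx
          rw [Real.one_rpow, Real.one_rpow, one_mul] at h3
          refine h3.trans ?_
          gcongr
          rw [Real.mul_rpow (by positivity) (norm_nonneg _)]
          have h4 : ((u x ^ 2)⁻¹) ^ p x = u x ^ (s - 2 * p x) * u x ^ (-s) := by
            rw [← Real.rpow_add h0, ← Real.rpow_natCast, ← Real.rpow_neg h0.le, ← Real.rpow_mul h0.le]
            congr 1; push_cast; ring
          have h5 : u x ^ (s - 2 * p x) ≤ M ^ s := by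
            have h6 : 0 ≤ s - 2 * p x := by linarith [hp.le x hxΩ]
            exact (Real.rpow_le_rpow h0.le hx.2 h6).trans
              (Real.rpow_le_rpow_of_exponent_le h.one_le (by linarith))
          rw [h4]
          calc u x ^ (s - 2 * p x) * u x ^ (-s) * ‖G x‖ ^ p x
              ≤ M ^ s * u x ^ (-s) * ‖G x‖ ^ p x := by gcongr
            _ = _ := by ring
      · rw [indicator_of_notMem hxT, image_eq_zero_of_notMem_tsupport hxT]
        simp
    · filter_upwards [hu, hz'] with x hx hzx
      by_cases hxT : x ∈ tsupport φ
      · rcases hx.1.eq_or_lt with h0 | h0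
        · rw [hzx hxT h0.symm]; simp
        · have h1 : Tendsto (fun n => shift n / (u x + shift n) ^ 2) atTop (𝓝 (0 / u x ^ 2)) :=
            tendsto_shift.div ((tendsto_add_shift _).pow 2) (by positivity)
          rw [zero_div] at h1
          simpa using (h1.mul_const (G x i)).mul_const (φ x)
      · rw [image_eq_zero_of_notMem_tsupport hxT]; simp
  rw [integral_zero] at hlim2
  have hlim3 := hlim2.neg
  simp only [← hid, neg_zero] at hlim3
  exact tendsto_nhds_unique hlim1 hlim3

/-- The strong maximum principle in its almost everywhere form. -/
theorem ae_eq_zero_or_ae_pos (h : IsSublinearSupersolution Ω p m P γ Γ q M A a u G)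
    (hΩ : IsConnected Ω) :
    (∀ᵐ x ∂(volume.restrict Ω), u x = 0) ∨ ∀ᵐ x ∂(volume.restrict Ω), 0 < u x := by
  obtain ⟨c, hc⟩ := h.isWeakGradient_indicator_pos.exists_ae_eq_const h.field.exponent.isOpen hΩ
  by_cases hc0 : c = 0
  · left
    filter_upwards [hc, h.mem_Icc] with x hx hux
    by_contra hne
    rw [if_pos (lt_of_le_of_ne hux.1 (Ne.symm hne)), hc0] at hx
    exact one_ne_zero hx
  · right
    filter_upwards [hc] with x hx
    by_contra hne
    rw [if_neg hne] at hx
    exact hc0 hx.symm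

end IsSublinearSupersolution

end Positivity

/-! ### A smooth substitute for the positive part -/

/-- The function `s e^{-δ/s}` for `s > 0`, extended by zero: a smooth approximation of the positive
part of `s` as `δ → 0`, which vanishes where the positive part does. -/
noncomputable def softPos (δ s : ℝ) : ℝ := s * expNegInvGlue (s / δ)

/-- The derivative of `softPos δ`. At `s = 0` it is zero, in accordance with `0⁻¹ = 0`. -/
noncomputable def softPosDeriv (δ s : ℝ) : ℝ :=
  expNegInvGlue (s / δ) + s / δ * ((s / δ)⁻¹ ^ 2 * expNegInvGlue (s / δ))

theorem expNegInvGlue_le_one (x : ℝ) : expNegInvGlue x ≤ 1 := by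
  unfold expNegInvGlue
  split_ifs with h
  · exact zero_le_one
  · exact Real.exp_le_one_iff.2 (neg_nonpos.2 (inv_nonneg.2 (not_le.1 h).le))

theorem hasDerivAt_softPos (δ s : ℝ) : HasDerivAt (softPos δ) (softPosDeriv δ s) s := by
  have h1 : HasDerivAt expNegInvGlue ((s / δ)⁻¹ ^ 2 * expNegInvGlue (s / δ)) (s / δ) := by
    simpa using expNegInvGlue.hasDerivAt_polynomial_eval_inv_mul 1 (s / δ)
  have h2 : HasDerivAt (fun s : ℝ => s / δ) (1 / δ) s := (hasDerivAt_id s).div_const δ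
  have h3 := (hasDerivAt_id s).mul (h1.comp s h2)
  refine h3.congr_deriv ?_
  simp only [softPosDeriv, id, Function.comp_apply]
  ring

theorem contDiff_softPos (δ : ℝ) : ContDiff ℝ ((⊤ : ℕ∞) : WithTop ℕ∞) (softPos δ) :=
  contDiff_id.mul (expNegInvGlue.contDiff.comp (contDiff_id.div_const δ))

theorem softPos_of_nonpos {δ s : ℝ} (hδ : 0 < δ) (hs : s ≤ 0) : softPos δ s = 0 := by
  rw [softPos, expNegInvGlue.zero_of_nonpos (div_nonpos_of_nonpos_of_nonneg hs hδ.le), mul_zero]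

theorem softPos_nonneg {δ : ℝ} (hδ : 0 < δ) (s : ℝ) : 0 ≤ softPos δ s := by
  rcases le_total s 0 with h | h
  · rw [softPos_of_nonpos hδ h]
  · exact mul_nonneg h (expNegInvGlue.nonneg _)

theorem softPos_le {δ s : ℝ} (hs : 0 ≤ s) : softPos δ s ≤ s :=
  mul_le_of_le_one_right hs (expNegInvGlue_le_one _)

theorem softPosDeriv_nonneg {δ : ℝ} (hδ : 0 < δ) (s : ℝ) : 0 ≤ softPosDeriv δ s := by
  rcases le_total s 0 with h | h
  · rw [softPosDeriv, expNegInvGlue.zero_of_nonpos (div_nonpos_of_nonpos_of_nonneg h hδ.le)]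
    simp
  · have := expNegInvGlue.nonneg (s / δ)
    unfold softPosDeriv
    positivity

/-- The defect of homogeneity of `softPos δ` is at most `δ`. -/
theorem softPos_defect {δ : ℝ} (hδ : 0 < δ) (s : ℝ) :
    ∃ e, 0 ≤ e ∧ e ≤ δ ∧ softPos δ s = s * softPosDeriv δ s - e := by
  refine ⟨δ * expNegInvGlue (s / δ), mul_nonneg hδ.le (expNegInvGlue.nonneg _),
    mul_le_of_le_one_right hδ.le (expNegInvGlue_le_one _), ?_⟩
  rcases eq_or_ne s 0 with rfl | hs
  · simp [softPos, expNegInvGlue.zero_of_nonpos]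
  · rw [softPos, softPosDeriv]
    field_simp
    ring

theorem tendsto_softPos {δ S : ℕ → ℝ} {s : ℝ} (hs : 0 < s) (hδ : ∀ n, 0 < δ n)
    (hδ0 : Tendsto δ atTop (𝓝 0)) (hS : Tendsto S atTop (𝓝 s)) :
    Tendsto (fun n => softPos (δ n) (S n)) atTop (𝓝 s) := by
  have h1 : Tendsto (fun n => Real.exp (-(δ n / S n))) atTop (𝓝 1) := by
    have h2 := (hδ0.div hS hs.ne').neg
    rw [zero_div, neg_zero] at h2
    simpa [Function.comp_def] using (Real.continuous_exp.tendsto 0).comp h2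
  have h3 := hS.mul h1
  rw [mul_one] at h3
  refine h3.congr' ?_
  filter_upwards [hS.eventually (lt_mem_nhds hs)] with n hn
  rw [softPos, expNegInvGlue, if_neg (not_le.2 (div_pos hn (hδ n))), inv_div]

/-! ### Picone's inequality for the regularized test functions -/

section Picone

variable {N : ℕ}

/-- The pointwise form of the diffusion terms tested with `β(V^q - W^q) V^{1-q}` and
`β(V^q - W^q) W^{1-q}`: by Picone's inequality their difference is nonnegative up to the defect of
homogeneity of `β = softPos δ`. -/
theorem IsEllipticPotential.picone_softPos {s γ Γ : ℝ} {F : E N → ℝ} {a : E N → E N}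
    (h : IsEllipticPotential s γ Γ F a) (ξ η : E N) {q V W ε δ : ℝ} (hq : 1 < q) (hqs : q ≤ s)
    (hε : 0 < ε) (hV : 0 < V) (hW : ε ≤ W) (hδ : 0 < δ) :
    -((q - 1) * δ * ε ^ (-q) * F η) ≤
      inner ℝ (a ξ) ((softPosDeriv δ (V ^ q - W ^ q) * (q * V ^ (q - 1)) * V ^ (1 - q) +
        softPos δ (V ^ q - W ^ q) * ((1 - q) * V ^ (1 - q - 1))) • ξ +
        (-(softPosDeriv δ (V ^ q - W ^ q) * (q * W ^ (q - 1)) * V ^ (1 - q))) • η) -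
      inner ℝ (a η) ((softPosDeriv δ (V ^ q - W ^ q) * (q * V ^ (q - 1)) * W ^ (1 - q)) • ξ +
        (-(softPosDeriv δ (V ^ q - W ^ q) * (q * W ^ (q - 1)) * W ^ (1 - q)) +
        softPos δ (V ^ q - W ^ q) * ((1 - q) * W ^ (1 - q - 1))) • η) := by
  have hW0 : 0 < W := hε.trans_le hW
  obtain ⟨e, he0, heδ, he⟩ := softPos_defect hδ (V ^ q - W ^ q)
  have hb := softPosDeriv_nonneg hδ (V ^ q - W ^ q)
  set b := softPosDeriv δ (V ^ q - W ^ q)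
  rw [he]
  have hpic := h.picone ξ η (div_pos hW0 hV) hq hqs
  rw [inv_div, Real.div_rpow hW0.le hV.le, Real.div_rpow hV.le hW0.le, Real.div_rpow hW0.le hV.le,
    Real.div_rpow hV.le hW0.le] at hpic
  have e1 : V ^ (1 - q) = (V ^ (q - 1))⁻¹ := by rw [← Real.rpow_neg hV.le]; congr 1; ring
  have e2 : W ^ (1 - q) = (W ^ (q - 1))⁻¹ := by rw [← Real.rpow_neg hW0.le]; congr 1; ring
  have e3 : V ^ (1 - q - 1) = (V ^ q)⁻¹ := by rw [← Real.rpow_neg hV.le]; congr 1; ring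
  have e4 : W ^ (1 - q - 1) = (W ^ q)⁻¹ := by rw [← Real.rpow_neg hW0.le]; congr 1; ring
  have hV1 := Real.rpow_pos_of_pos hV (q - 1)
  have hW1 := Real.rpow_pos_of_pos hW0 (q - 1)
  have hVq := Real.rpow_pos_of_pos hV q
  have hWq := Real.rpow_pos_of_pos hW0 q
  have hWε : (W ^ q)⁻¹ ≤ ε ^ (-q) := by
    rw [Real.rpow_neg hε.le]
    exact inv_anti₀ (Real.rpow_pos_of_pos hε q) (Real.rpow_le_rpow hε.le hW (by linarith))
  have hFη := h.nonneg η
  have hFξ := h.nonneg ξ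
  have hrem : (q - 1) * e * (W ^ q)⁻¹ * F η ≤ (q - 1) * δ * ε ^ (-q) * F η := by
    have : 0 ≤ q - 1 := by linarith
    gcongr
  have hrem2 : 0 ≤ (q - 1) * e * (V ^ q)⁻¹ * F ξ := by
    have : 0 ≤ q - 1 := by linarith
    positivity
  have hpicb := mul_le_mul_of_nonneg_left hpic hb
  simp only [inner_add_right, inner_smul_right, h.inner_self]
  rw [e1, e2, e3, e4]
  set X := inner ℝ (a ξ) η
  set Y := inner ℝ (a η) ξ
  have key : (b * (q * V ^ (q - 1)) * (V ^ (q - 1))⁻¹ +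
      ((V ^ q - W ^ q) * b - e) * ((1 - q) * (V ^ q)⁻¹)) * F ξ +
      -(b * (q * W ^ (q - 1)) * (V ^ (q - 1))⁻¹) * X -
      (b * (q * V ^ (q - 1)) * (W ^ (q - 1))⁻¹ * Y +
      (-(b * (q * W ^ (q - 1)) * (W ^ (q - 1))⁻¹) +
      ((V ^ q - W ^ q) * b - e) * ((1 - q) * (W ^ q)⁻¹)) * F η) =
      b * (F ξ * (1 + (q - 1) * (W ^ q / V ^ q)) + F η * (1 + (q - 1) * (V ^ q / W ^ q))) -
      b * (q * (W ^ (q - 1) / V ^ (q - 1)) * X + q * (V ^ (q - 1) / W ^ (q - 1)) * Y) +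
      (q - 1) * e * (V ^ q)⁻¹ * F ξ - (q - 1) * e * (W ^ q)⁻¹ * F η := by
    field_simp
    ring
  rw [key]
  linarith

end Picone

/-! ### The structural conditions -/

section Comparison

variable {N : ℕ} {Ω : Set (E N)} {p : E N → ℝ} {m P γ Γ q lam M : ℝ} {A : E N → E N → ℝ}
  {a : E N → E N → E N} {f : E N → ℝ → ℝ} {h v w : E N → ℝ}

/-- The structural conditions in the form used here, with uniform bounds for the exponent. -/
theorem exists_isEllipticField (hΩ : IsOpen Ω) (hΩne : Ω.Nonempty) (hΩb : Bornology.IsBounded Ω)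
    (hpc : ContinuousOn p (closure Ω)) (hp1 : ∀ x ∈ closure Ω, 1 < p x)
    (hqp : ∀ x ∈ closure Ω, q < p x) (hA0 : CondA0 Ω p A)
    (hA1 : CondA1 Ω p (WeakComparison.field p A)) :
    ∃ m P γ Γ, q < m ∧ IsEllipticField Ω p m P γ Γ A (WeakComparison.field p A) := by
  have hcpt : IsCompact (closure Ω) := hΩb.isCompact_closure
  obtain ⟨x₀, hx₀, hmin⟩ := hcpt.exists_isMinOn hΩne.closure hpc
  obtain ⟨x₁, hx₁, hmax⟩ := hcpt.exists_isMaxOn hΩne.closure hpc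
  obtain ⟨γ, Γ, hγ, hΓ, hpot⟩ := ae_isEllipticPotential hΩ
    (fun x hx => hp1 x (subset_closure hx)) hA0 hA1
  refine ⟨p x₀, p x₁, γ, Γ, hqp x₀ hx₀, ⟨hΩ, hΩb, hpc.mono subset_closure,
    fun x hx => (hp1 x (subset_closure hx)).le, fun x hx => hmax (subset_closure hx)⟩, hp1 x₀ hx₀,
    fun x hx => hmin (subset_closure hx), hmin hx₁, ?_, hγ, hΓ, hpot⟩
  exact (PiLp.continuous_toLp 2 _).comp_continuousOn (continuousOn_pi.2 hA1.continuousOn)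

theorem CondF0.exists_bound (hf : CondF0 Ω f) (hΩb : Bornology.IsBounded Ω) (M : ℝ) :
    ∃ C, 0 ≤ C ∧ ∀ x ∈ Ω, ∀ s ∈ Icc 0 M, |f x s| ≤ C := by
  obtain ⟨C, hC⟩ := (hΩb.isCompact_closure.prod isCompact_Icc).exists_bound_of_continuousOn
    (hf.continuousOn.mono (prod_mono_right (Icc_subset_Ici_self : Icc 0 M ⊆ Ici 0)))
  exact ⟨max C 0, le_max_right _ _, fun x hx s hs =>
    (hC (x, s) ⟨subset_closure hx, hs⟩).trans (le_max_left _ _)⟩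

theorem CondF0.aestronglyMeasurable (hf : CondF0 Ω f) (hΩ : IsOpen Ω)
    (hvm : AEStronglyMeasurable v (volume.restrict Ω))
    (hv0 : ∀ᵐ x ∂(volume.restrict Ω), 0 ≤ v x) :
    AEStronglyMeasurable (fun x => f x (v x)) (volume.restrict Ω) :=
  aestronglyMeasurable_comp_of_continuousOn (k := fun x => (x, v x))
    (isClosed_closure.measurableSet.prod measurableSet_Ici) hf.continuousOn
    (aemeasurable_id.prodMk hvm.aemeasurable)
    (by filter_upwards [hv0, ae_restrict_mem hΩ.measurableSet] with x h1 h2 using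
      ⟨subset_closure h2, h1⟩)

/-- On compact subsets of `Ω`, the nonlinearity is bounded below by a multiple of `s^{q-1}`. -/
theorem CondF1.exists_le (hf0 : CondF0 Ω f) (hf1 : CondF1 Ω q f) (hq : 1 < q) (hM : 0 < M)
    {K : Set (E N)} (hK : IsCompact K) (hKΩ : K ⊆ Ω) :
    ∃ c > 0, ∀ x ∈ K, ∀ s ∈ Icc 0 M, c * s ^ (q - 1) ≤ f x s := by
  rcases K.eq_empty_or_nonempty with rfl | hne
  · exact ⟨1, one_pos, fun x hx => hx.elim⟩
  have hc : ContinuousOn (fun x => f x M) K :=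
    hf0.continuousOn.comp (f := fun x : E N => (x, M)) (by fun_prop)
      fun x hx => ⟨subset_closure (hKΩ hx), hM.le⟩
  obtain ⟨x₀, hx₀, hmin⟩ := hK.exists_isMinOn hne hc
  have hMq := Real.rpow_pos_of_pos hM (q - 1)
  refine ⟨f x₀ M / M ^ (q - 1), div_pos (hf0.pos x₀ (hKΩ hx₀) M hM) hMq, fun x hx s hs => ?_⟩
  rcases hs.1.eq_or_lt with h0 | h0
  · rw [← h0, hf0.map_zero x (subset_closure (hKΩ hx)), Real.zero_rpow (by linarith), mul_zero]
  · have h1 := hf1 x (hKΩ hx) (mem_Ioi.2 h0) (mem_Ioi.2 hM) hs.2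
    rw [← le_div_iff₀ (Real.rpow_pos_of_pos h0 _)]
    refine le_trans ?_ h1
    have : f x₀ M ≤ f x M := hmin hx
    simp only
    gcongr

theorem integrableOn_mul_of_bounds [IsFiniteMeasure (volume.restrict Ω)] {k φ : E N → ℝ}
    (hk : AEStronglyMeasurable k (volume.restrict Ω))
    (hφ : AEStronglyMeasurable φ (volume.restrict Ω)) {C D : ℝ}
    (hkC : ∀ᵐ x ∂(volume.restrict Ω), |k x| ≤ C) (hφD : ∀ᵐ x ∂(volume.restrict Ω), |φ x| ≤ D) :
    IntegrableOn (fun x => k x * φ x) Ω :=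
  (Integrable.of_bound hk C hkC).mul_bdd hφ hφD

/-- The term containing `h` is dropped, and `f` is estimated by `CondF1.exists_le`. -/
theorem IsSupersolution.exists_isSublinearSupersolution
    (ha : IsEllipticField Ω p m P γ Γ A a) (hq : 1 < q) (hqm : q < m) (hlam : 0 < lam)
    (hf0 : CondF0 Ω f) (hf1 : CondF1 Ω q f)
    (hh0 : ∀ᵐ x ∂(volume.restrict Ω), 0 ≤ h x) (hM : 1 ≤ M)
    (hwM : ∀ᵐ x ∂(volume.restrict Ω), w x ∈ Icc 0 M)
    (hw : IsSupersolution Ω p q lam a f h w) :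
    ∃ G, IsSublinearSupersolution Ω p m P γ Γ q M A a w G := by
  obtain ⟨hw0, G, hG, hsup⟩ := hw
  refine ⟨G, ha, hq, hqm, hM, hG.toMemW0, hwM, fun K hK hKΩ => ?_⟩
  obtain ⟨c, hc, hcf⟩ := CondF1.exists_le hf0 hf1 hq (by linarith : 0 < M) hK hKΩ
  refine ⟨c, hc, 1 / lam, by positivity, fun φ H hφ hφ0 ⟨D, hφD⟩ hφK => ?_⟩
  have hp := ha.exponent
  have hfin := hp.isFiniteMeasure
  have hwm := hG.memLp.1
  have h1 := hsup φ H (hφ.memX_of_bound hp q hφD) hφ0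
  unfold rhsForm lhsForm at h1
  have h2 : 0 ≤ ∫ x in Ω, h x * w x ^ (q - 1) * φ x := integral_nonneg_of_ae (by
    filter_upwards [hh0, hφ0, hw0] with x a1 a2 a3
    exact mul_nonneg (mul_nonneg a1 (Real.rpow_nonneg a3 _)) a2)
  have h3 : c * ∫ x in Ω, w x ^ (q - 1) * φ x ≤ ∫ x in Ω, f x (w x) * φ x := by
    rw [← integral_const_mul]
    obtain ⟨Cf, -, hCf⟩ := hf0.exists_bound hp.isBounded M
    have hcont : ContinuousOn (fun s : ℝ => s ^ (q - 1)) (Icc 0 M) :=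
      (Real.continuous_rpow_const (by linarith)).continuousOn
    obtain ⟨C, -, hC⟩ := ContinuousOn.exists_ae_bound_comp_Icc hwM hcont
    refine integral_mono_ae ((integrableOn_mul_of_bounds
      (ContinuousOn.aestronglyMeasurable_comp_Icc hwM hwm hcont) hφ.memLp.1 hC hφD).const_mul c)
      (integrableOn_mul_of_bounds (C := Cf) (hf0.aestronglyMeasurable hp.isOpen hwm hw0)
        hφ.memLp.1 (by
          filter_upwards [hwM, hp.ae_mem] with x a1 a2 using hCf x a2 _ a1) hφD) ?_
    filter_upwards [hwM, hφ0] with x a1 a2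
    by_cases hx : x ∈ K
    · rw [← mul_assoc]
      exact mul_le_mul_of_nonneg_right (hcf x hx _ a1) a2
    · rw [hφK x hx]; simp
  have h4 : lam * (c * ∫ x in Ω, w x ^ (q - 1) * φ x) ≤ lam * (1 / lam *
      (∫ x in Ω, w x ^ (2 * q - 1) * φ x) + ∫ x in Ω, inner ℝ (a x (G x)) (H x)) := by
    have h5 := mul_le_mul_of_nonneg_left h3 hlam.le
    have h6 : lam * (1 / lam * (∫ x in Ω, w x ^ (2 * q - 1) * φ x)) =
        ∫ x in Ω, w x ^ (2 * q - 1) * φ x := by field_simp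
    rw [mul_add, h6]
    linarith
  exact le_of_mul_le_mul_left h4 hlam

/-! ### The test functions of Picone type -/

/-- The test functions `β((v+ε)^q - (w+ε)^q) (v+ε)^{1-q}` for the subsolution `v` and
`β((v+ε)^q - (w+ε)^q) (w+ε)^{1-q}` for the supersolution `w`, where `β = softPos δ`. -/
theorem memW0_picone (hp : IsBoundedExponent Ω p P) {G H : E N → E N}
    (hv : MemW0 Ω p v G) (hw : MemW0 Ω p w H)
    (hvM : ∀ᵐ x ∂(volume.restrict Ω), v x ∈ Icc 0 M)
    (hwM : ∀ᵐ x ∂(volume.restrict Ω), w x ∈ Icc 0 M) {ε : ℝ} (hε : 0 < ε) (δ : ℝ) :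
    MemW0 Ω p
      (fun x => softPos δ ((v x + ε) ^ q - (w x + ε) ^ q) * (v x + ε) ^ (1 - q))
      (fun x => (softPosDeriv δ ((v x + ε) ^ q - (w x + ε) ^ q) * (q * (v x + ε) ^ (q - 1)) *
          (v x + ε) ^ (1 - q) + softPos δ ((v x + ε) ^ q - (w x + ε) ^ q) *
          ((1 - q) * (v x + ε) ^ (1 - q - 1))) • G x +
        (-(softPosDeriv δ ((v x + ε) ^ q - (w x + ε) ^ q) * (q * (w x + ε) ^ (q - 1)) *
          (v x + ε) ^ (1 - q))) • H x) ∧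
    MemW0 Ω p
      (fun x => softPos δ ((v x + ε) ^ q - (w x + ε) ^ q) * (w x + ε) ^ (1 - q))
      (fun x => (softPosDeriv δ ((v x + ε) ^ q - (w x + ε) ^ q) * (q * (v x + ε) ^ (q - 1)) *
          (w x + ε) ^ (1 - q)) • G x +
        (-(softPosDeriv δ ((v x + ε) ^ q - (w x + ε) ^ q) * (q * (w x + ε) ^ (q - 1)) *
          (w x + ε) ^ (1 - q)) + softPos δ ((v x + ε) ^ q - (w x + ε) ^ q) *
          ((1 - q) * (w x + ε) ^ (1 - q - 1))) • H x) := by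
  have hKU : Icc 0 M ×ˢ Icc 0 M ⊆ Ioi (-ε) ×ˢ Ioi (-ε) := by
    rintro ⟨s, t⟩ ⟨hs, ht⟩
    exact ⟨(neg_lt_zero.2 hε).trans_le hs.1, (neg_lt_zero.2 hε).trans_le ht.1⟩
  have hc1 : ∀ r : ℝ, ContDiffOn ℝ ((⊤ : ℕ∞) : WithTop ℕ∞) (fun z : ℝ × ℝ => (z.1 + ε) ^ r)
      (Ioi (-ε) ×ˢ Ioi (-ε)) := fun r =>
    (contDiffOn_add_rpow ε r).comp contDiff_fst.contDiffOn fun z hz => hz.1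
  have hc2 : ∀ r : ℝ, ContDiffOn ℝ ((⊤ : ℕ∞) : WithTop ℕ∞) (fun z : ℝ × ℝ => (z.2 + ε) ^ r)
      (Ioi (-ε) ×ˢ Ioi (-ε)) := fun r =>
    (contDiffOn_add_rpow ε r).comp contDiff_snd.contDiffOn fun z hz => hz.2
  have hc3 := (contDiff_softPos δ).comp_contDiffOn ((hc1 q).sub (hc2 q))
  have h1 : ∀ z ∈ Icc 0 M ×ˢ Icc 0 M, ∀ r : ℝ, HasFDerivAt (fun z : ℝ × ℝ => (z.1 + ε) ^ r)
      ((r * (z.1 + ε) ^ (r - 1)) • ContinuousLinearMap.fst ℝ ℝ ℝ) z := fun z hz r =>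
    (hasDerivAt_add_rpow (by linarith [hz.1.1]) r).comp_hasFDerivAt z (f := Prod.fst)
      hasFDerivAt_fst
  have h2 : ∀ z ∈ Icc 0 M ×ˢ Icc 0 M, ∀ r : ℝ, HasFDerivAt (fun z : ℝ × ℝ => (z.2 + ε) ^ r)
      ((r * (z.2 + ε) ^ (r - 1)) • ContinuousLinearMap.snd ℝ ℝ ℝ) z := fun z hz r =>
    (hasDerivAt_add_rpow (by linarith [hz.2.1]) r).comp_hasFDerivAt z (f := Prod.snd)
      hasFDerivAt_snd
  have h3 := fun (z : ℝ × ℝ) (hz : z ∈ Icc 0 M ×ˢ Icc 0 M) =>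
    (hasDerivAt_softPos δ ((z.1 + ε) ^ q - (z.2 + ε) ^ q)).comp_hasFDerivAt z
      (f := fun z : ℝ × ℝ => (z.1 + ε) ^ q - (z.2 + ε) ^ q) ((h1 z hz q).sub (h2 z hz q))
  have hmem : ∀ᵐ x ∂(volume.restrict Ω), (v x, w x) ∈ Icc 0 M ×ˢ Icc 0 M := by
    filter_upwards [hvM, hwM] with x hx hy using ⟨hx, hy⟩
  constructor
  · refine MemW0.comp hp hv hw
      (T := fun z => softPos δ ((z.1 + ε) ^ q - (z.2 + ε) ^ q) * (z.1 + ε) ^ (1 - q))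
      (D₁ := fun z => softPosDeriv δ ((z.1 + ε) ^ q - (z.2 + ε) ^ q) * (q * (z.1 + ε) ^ (q - 1)) *
        (z.1 + ε) ^ (1 - q) + softPos δ ((z.1 + ε) ^ q - (z.2 + ε) ^ q) *
        ((1 - q) * (z.1 + ε) ^ (1 - q - 1)))
      (D₂ := fun z => -(softPosDeriv δ ((z.1 + ε) ^ q - (z.2 + ε) ^ q) *
        (q * (z.2 + ε) ^ (q - 1)) * (z.1 + ε) ^ (1 - q)))
      (isCompact_Icc.prod isCompact_Icc) (isOpen_Ioi.prod isOpen_Ioi) hKU (hc3.mul (hc1 (1 - q)))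
      (fun z hz => ((h3 z hz).mul (h1 z hz (1 - q))).congr_fderiv ?_) (by simp [softPos]) hmem
    ext <;> simp <;> ring
  · refine MemW0.comp hp hv hw
      (T := fun z => softPos δ ((z.1 + ε) ^ q - (z.2 + ε) ^ q) * (z.2 + ε) ^ (1 - q))
      (D₁ := fun z => softPosDeriv δ ((z.1 + ε) ^ q - (z.2 + ε) ^ q) * (q * (z.1 + ε) ^ (q - 1)) *
        (z.2 + ε) ^ (1 - q))
      (D₂ := fun z => -(softPosDeriv δ ((z.1 + ε) ^ q - (z.2 + ε) ^ q) *
        (q * (z.2 + ε) ^ (q - 1)) * (z.2 + ε) ^ (1 - q)) +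
        softPos δ ((z.1 + ε) ^ q - (z.2 + ε) ^ q) * ((1 - q) * (z.2 + ε) ^ (1 - q - 1)))
      (isCompact_Icc.prod isCompact_Icc) (isOpen_Ioi.prod isOpen_Ioi) hKU (hc3.mul (hc2 (1 - q)))
      (fun z hz => ((h3 z hz).mul (h2 z hz (1 - q))).congr_fderiv ?_) (by simp [softPos]) hmem
    ext <;> simp <;> ring

end Comparison

/-! ### The zeroth order terms and their limit -/

section Integrand

/-- The quotient `(s / (s + ε))^{q-1}`. -/
noncomputable def shiftRatio (q ε s : ℝ) : ℝ := (s / (s + ε)) ^ (q - 1)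

/-- A lower bound for the zeroth order terms of the sub- and the supersolution inequality tested
with the functions of Picone type, where `k = f(x, v)`. -/
noncomputable def comparisonIntegrand (q lam ε δ v w h k : ℝ) : ℝ :=
  softPos δ ((v + ε) ^ q - (w + ε) ^ q) *
    ((v ^ q * shiftRatio q ε v - w ^ q * shiftRatio q ε w) -
      (h + lam * (k / v ^ (q - 1))) * (shiftRatio q ε v - shiftRatio q ε w))

variable {q lam ε δ v w h k l M C : ℝ}

theorem shiftRatio_eq (hε : 0 < ε) (hv : 0 ≤ v) :
    shiftRatio q ε v = v ^ (q - 1) * (v + ε) ^ (1 - q) := by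
  rw [shiftRatio, Real.div_rpow hv (by linarith), div_eq_mul_inv, ← Real.rpow_neg (by linarith)]
  congr 2; ring

theorem shiftRatio_nonneg (hε : 0 < ε) (hv : 0 ≤ v) : 0 ≤ shiftRatio q ε v :=
  Real.rpow_nonneg (div_nonneg hv (by linarith)) _

theorem shiftRatio_le_one (hq : 1 < q) (hε : 0 < ε) (hv : 0 ≤ v) : shiftRatio q ε v ≤ 1 :=
  Real.rpow_le_one (div_nonneg hv (by linarith)) ((div_le_one (by linarith)).2 (by linarith))
    (by linarith)

theorem shiftRatio_mono (hq : 1 < q) (hε : 0 < ε) (hw : 0 ≤ w) (hwv : w ≤ v) :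
    shiftRatio q ε w ≤ shiftRatio q ε v := by
  refine Real.rpow_le_rpow (div_nonneg hw (by linarith)) ?_ (by linarith)
  rw [div_le_div_iff₀ (by linarith) (by linarith)]
  nlinarith

theorem tendsto_shiftRatio (hv : 0 < v) :
    Tendsto (fun n => shiftRatio q (shift n) v) atTop (𝓝 1) := by
  have h1 : Tendsto (fun n => v / (v + shift n)) atTop (𝓝 (v / v)) :=
    tendsto_const_nhds.div (tendsto_add_shift v) hv.ne'
  rw [div_self hv.ne'] at h1
  have h2 := h1.rpow_const (p := q - 1) (Or.inl one_ne_zero)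
  rwa [Real.one_rpow] at h2

theorem softPos_sub_eq_zero (hq : 1 < q) (hε : 0 < ε) (hδ : 0 < δ) (hv : 0 ≤ v) (hvw : v ≤ w) :
    softPos δ ((v + ε) ^ q - (w + ε) ^ q) = 0 :=
  softPos_of_nonpos hδ (sub_nonpos.2 (Real.rpow_le_rpow (by linarith) (by linarith) (by linarith)))

theorem softPos_sub_le (hq : 1 < q) (hε : 0 < ε) (hδ : 0 < δ) (hv : 0 ≤ v) (hw : 0 ≤ w) :
    softPos δ ((v + ε) ^ q - (w + ε) ^ q) ≤ (v + ε) ^ q := by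
  rcases le_total v w with h | h
  · rw [softPos_sub_eq_zero hq hε hδ hv h]
    exact Real.rpow_nonneg (by linarith) _
  · refine (softPos_le (sub_nonneg.2 (Real.rpow_le_rpow (by linarith) (by linarith)
      (by linarith)))).trans (sub_le_self _ (Real.rpow_nonneg (by linarith) _))

theorem rpow_mul_rpow_one_sub (hv : 0 < v) : v ^ q * v ^ (1 - q) = v := by
  rw [← Real.rpow_add hv]; simp

/-- The monotonicity of `s ↦ f(x, s) / s^{q-1}` enters here, for `k = f(x, v)` and `l = f(x, w)`. -/
theorem comparisonIntegrand_le (hq : 1 < q) (hlam : 0 ≤ lam) (hε : 0 < ε) (hδ : 0 < δ)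
    (hv : 0 ≤ v) (hw : 0 < w) (hkl : w < v → k / v ^ (q - 1) ≤ l / w ^ (q - 1)) :
    comparisonIntegrand q lam ε δ v w h k ≤
      v ^ (2 * q - 1) * (softPos δ ((v + ε) ^ q - (w + ε) ^ q) * (v + ε) ^ (1 - q)) -
      w ^ (2 * q - 1) * (softPos δ ((v + ε) ^ q - (w + ε) ^ q) * (w + ε) ^ (1 - q)) -
      (h * v ^ (q - 1) * (softPos δ ((v + ε) ^ q - (w + ε) ^ q) * (v + ε) ^ (1 - q)) -
      h * w ^ (q - 1) * (softPos δ ((v + ε) ^ q - (w + ε) ^ q) * (w + ε) ^ (1 - q))) -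
      lam * (k * (softPos δ ((v + ε) ^ q - (w + ε) ^ q) * (v + ε) ^ (1 - q)) -
      l * (softPos δ ((v + ε) ^ q - (w + ε) ^ q) * (w + ε) ^ (1 - q))) := by
  rcases le_or_gt v w with hvw | hvw
  · simp [comparisonIntegrand, softPos_sub_eq_zero hq hε hδ hv hvw]
  have hv0 : 0 < v := hw.trans hvw
  rw [comparisonIntegrand, shiftRatio_eq hε hv, shiftRatio_eq hε hw.le]
  have hB := softPos_nonneg hδ ((v + ε) ^ q - (w + ε) ^ q)
  set B := softPos δ ((v + ε) ^ q - (w + ε) ^ q)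
  have e : ∀ s : ℝ, 0 < s → s ^ (2 * q - 1) = s ^ q * s ^ (q - 1) := fun s hs => by
    rw [← Real.rpow_add hs]; congr 1; ring
  rw [e v hv0, e w hw]
  have hVq := Real.rpow_pos_of_pos hv0 (q - 1)
  have hWq := Real.rpow_pos_of_pos hw (q - 1)
  have hW1 : 0 < (w + ε) ^ (1 - q) := Real.rpow_pos_of_pos (by linarith) _
  have h1 : k / v ^ (q - 1) * v ^ (q - 1) = k := div_mul_cancel₀ _ hVq.ne'
  have h2 : k / v ^ (q - 1) * w ^ (q - 1) ≤ l := by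
    have := mul_le_mul_of_nonneg_right (hkl hvw) hWq.le
    rwa [div_mul_cancel₀ _ hWq.ne'] at this
  have h3 : lam * (k / v ^ (q - 1) * w ^ (q - 1)) * (B * (w + ε) ^ (1 - q)) ≤
      lam * l * (B * (w + ε) ^ (1 - q)) := by gcongr
  have h4 : lam * k * (B * (v + ε) ^ (1 - q)) =
      lam * (k / v ^ (q - 1) * v ^ (q - 1)) * (B * (v + ε) ^ (1 - q)) := by rw [h1]
  linarith

theorem abs_comparisonIntegrand_le (hq : 1 < q) (hlam : 0 ≤ lam) (hε : 0 < ε) (hε1 : ε ≤ 1)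
    (hδ : 0 < δ) (hv : v ∈ Icc 0 M) (hw : w ∈ Icc 0 M) (hh : 0 ≤ h) (hk : |k| ≤ C) :
    |comparisonIntegrand q lam ε δ v w h k| ≤
      (M + 1) ^ q * (M ^ q + h) + lam * (C * (M + 1)) := by
  have hM : 0 ≤ M := hv.1.trans hv.2
  have hC : 0 ≤ C := (abs_nonneg _).trans hk
  have hR : 0 ≤ (M + 1) ^ q * (M ^ q + h) + lam * (C * (M + 1)) := by positivity
  rcases le_or_gt v w with hvw | hvw
  · simpa [comparisonIntegrand, softPos_sub_eq_zero hq hε hδ hv.1 hvw] using hR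
  have hv0 : 0 < v := hw.1.trans_lt hvw
  have hB := softPos_nonneg hδ ((v + ε) ^ q - (w + ε) ^ q)
  have hB1 := softPos_sub_le hq hε hδ hv.1 hw.1
  have hVM : (v + ε) ^ q ≤ (M + 1) ^ q :=
    Real.rpow_le_rpow (by linarith) (by linarith [hv.2]) (by linarith)
  rw [comparisonIntegrand]
  have hP0 := shiftRatio_nonneg (q := q) hε hv.1
  have hQ0 := shiftRatio_nonneg (q := q) hε hw.1
  have hP1 := shiftRatio_le_one hq hε hv.1
  have hQ1 := shiftRatio_le_one hq hε hw.1
  have hPQ := shiftRatio_mono hq hε hw.1 hvw.le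
  have hPeq := shiftRatio_eq (q := q) hε hv.1
  set B := softPos δ ((v + ε) ^ q - (w + ε) ^ q)
  set P := shiftRatio q ε v
  set Q := shiftRatio q ε w
  have hvq : v ^ q ≤ M ^ q := Real.rpow_le_rpow hv.1 hv.2 (by linarith)
  have hwq : w ^ q ≤ M ^ q := Real.rpow_le_rpow hw.1 hw.2 (by linarith)
  have hv1 := Real.rpow_nonneg hv.1 q
  have hw1 := Real.rpow_nonneg hw.1 q
  have hM1 := Real.rpow_nonneg hM q
  have hVq := Real.rpow_pos_of_pos hv0 (q - 1)
  have h1 : |v ^ q * P - w ^ q * Q| ≤ M ^ q := by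
    have a1 : v ^ q * P ≤ M ^ q := (mul_le_of_le_one_right hv1 hP1).trans hvq
    have a2 : w ^ q * Q ≤ M ^ q := (mul_le_of_le_one_right hw1 hQ1).trans hwq
    have a3 := mul_nonneg hv1 hP0
    have a4 := mul_nonneg hw1 hQ0
    rw [abs_le]; constructor <;> linarith
  have h2 : |h * (P - Q)| ≤ h := by
    rw [abs_mul, abs_of_nonneg hh, abs_of_nonneg (sub_nonneg.2 hPQ)]
    exact mul_le_of_le_one_right hh (by linarith)
  have h3 : |B * (k / v ^ (q - 1)) * (P - Q)| ≤ C * (M + 1) := by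
    have hVp : 0 < (v + ε) ^ (1 - q) := Real.rpow_pos_of_pos (by linarith) _
    rw [abs_mul, abs_mul, abs_div, abs_of_nonneg hB, abs_of_pos hVq,
      abs_of_nonneg (sub_nonneg.2 hPQ)]
    calc B * (|k| / v ^ (q - 1)) * (P - Q) ≤ B * (|k| / v ^ (q - 1)) * P := by
          gcongr
          linarith
      _ = |k| * (B * (v + ε) ^ (1 - q)) := by
          rw [hPeq]; field_simp
      _ ≤ C * ((v + ε) ^ q * (v + ε) ^ (1 - q)) := by gcongr
      _ ≤ C * (M + 1) := by
          rw [rpow_mul_rpow_one_sub (by linarith)]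
          gcongr
          exact hv.2
  have e : B * ((v ^ q * P - w ^ q * Q) - (h + lam * (k / v ^ (q - 1))) * (P - Q)) =
      B * ((v ^ q * P - w ^ q * Q) - h * (P - Q)) - lam * (B * (k / v ^ (q - 1)) * (P - Q)) := by
    ring
  rw [e]
  refine (abs_sub _ _).trans (add_le_add ?_ ?_)
  · rw [abs_mul, abs_of_nonneg hB]
    exact mul_le_mul (hB1.trans hVM) ((abs_sub _ _).trans (add_le_add h1 h2)) (abs_nonneg _)
      (Real.rpow_nonneg (by linarith) _)
  · rw [abs_mul, abs_of_nonneg hlam]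
    gcongr

theorem tendsto_comparisonIntegrand (hq : 1 < q) (hv : 0 ≤ v) (hw : 0 < w) {δ : ℕ → ℝ}
    (hδ : ∀ n, 0 < δ n) (hδ0 : Tendsto δ atTop (𝓝 0)) :
    Tendsto (fun n => comparisonIntegrand q lam (shift n) (δ n) v w h k) atTop
      (𝓝 (max (v ^ q - w ^ q) 0 ^ 2)) := by
  rcases le_or_gt v w with hvw | hvw
  · have h1 : v ^ q - w ^ q ≤ 0 := sub_nonpos.2 (Real.rpow_le_rpow hv hvw (by linarith))
    rw [max_eq_right h1]
    refine (tendsto_const_nhds (x := (0 : ℝ))).congr (fun n => ?_) |>.trans (by simp)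
    rw [comparisonIntegrand, softPos_sub_eq_zero hq (shift_pos n) (hδ n) hv hvw, zero_mul]
  · have hv0 : 0 < v := hw.trans hvw
    have h1 : 0 < v ^ q - w ^ q := sub_pos.2 (Real.rpow_lt_rpow hw.le hvw (by linarith))
    rw [max_eq_left h1.le]
    have hB := tendsto_softPos h1 hδ hδ0
      ((tendsto_add_shift_rpow hv0 q).sub (tendsto_add_shift_rpow hw q))
    have hP := tendsto_shiftRatio (q := q) hv0
    have hQ := tendsto_shiftRatio (q := q) hw
    have := hB.mul (((hP.const_mul (v ^ q)).sub (hQ.const_mul (w ^ q))).sub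
      ((hP.sub hQ).const_mul (h + lam * (k / v ^ (q - 1)))))
    have e : (v ^ q - w ^ q) ^ 2 = (v ^ q - w ^ q) * (v ^ q * 1 - w ^ q * 1 -
        (h + lam * (k / v ^ (q - 1))) * (1 - 1)) := by ring
    rw [e]
    exact this

end Integrand

/-! ### The comparison argument -/

section Comparison

variable {N : ℕ} {Ω : Set (E N)} {p : E N → ℝ} {m P γ Γ q lam M : ℝ} {A : E N → E N → ℝ}
  {a : E N → E N → E N} {f : E N → ℝ → ℝ} {h v w : E N → ℝ}

theorem aestronglyMeasurable_comparisonIntegrand {k : E N → ℝ} {μ : Measure (E N)} (ε δ : ℝ)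
    (hv : AEStronglyMeasurable v μ) (hw : AEStronglyMeasurable w μ)
    (hh : AEStronglyMeasurable h μ) (hk : AEStronglyMeasurable k μ) :
    AEStronglyMeasurable (fun x => comparisonIntegrand q lam ε δ (v x) (w x) (h x) (k x)) μ := by
  have hv' := hv.aemeasurable
  have hw' := hw.aemeasurable
  have hh' := hh.aemeasurable
  have hk' := hk.aemeasurable
  have hr : ∀ u : E N → ℝ, AEMeasurable u μ → AEMeasurable (fun x => shiftRatio q ε (u x)) μ :=
    fun u hu => (hu.div (hu.add_const ε)).pow_const _
  have hB : AEMeasurable (fun x => softPos δ ((v x + ε) ^ q - (w x + ε) ^ q)) μ :=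
    (contDiff_softPos δ).continuous.measurable.comp_aemeasurable
      (((hv'.add_const ε).pow_const q).sub ((hw'.add_const ε).pow_const q))
  exact (hB.mul ((((hv'.pow_const q).mul (hr v hv')).sub ((hw'.pow_const q).mul (hr w hw'))).sub
    ((hh'.add ((hk'.div (hv'.pow_const _)).const_mul lam)).mul
      ((hr v hv').sub (hr w hw'))))).aestronglyMeasurable

/-- The sub- and the supersolution inequality tested with the functions of Picone type. -/
theorem integral_comparisonIntegrand_le (ha : IsEllipticField Ω p m P γ Γ A a) (hq : 1 < q)
    (hqm : q < m) (hlam : 0 < lam) (hf0 : CondF0 Ω f) (hf1 : CondF1 Ω q f)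
    (hh : IntegrableOn h Ω) (hh0 : ∀ᵐ x ∂(volume.restrict Ω), 0 ≤ h x)
    (hvM : ∀ᵐ x ∂(volume.restrict Ω), v x ∈ Icc 0 M)
    (hwM : ∀ᵐ x ∂(volume.restrict Ω), w x ∈ Icc 0 M)
    (hwpos : ∀ᵐ x ∂(volume.restrict Ω), 0 < w x) {G H : E N → E N}
    (hG : MemX Ω p q v G) (hH : MemX Ω p q w H)
    (hsub : ∀ (φ : E N → ℝ) (K : E N → E N), MemX Ω p q φ K →
      (∀ᵐ x ∂(volume.restrict Ω), 0 ≤ φ x) → lhsForm Ω q lam a v G φ K ≤ rhsForm Ω q lam f h v φ)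
    (hsup : ∀ (φ : E N → ℝ) (K : E N → E N), MemX Ω p q φ K →
      (∀ᵐ x ∂(volume.restrict Ω), 0 ≤ φ x) → rhsForm Ω q lam f h w φ ≤ lhsForm Ω q lam a w H φ K)
    {ε δ : ℝ} (hε : 0 < ε) (hε1 : ε ≤ 1) (hδ : 0 < δ) :
    ∫ x in Ω, comparisonIntegrand q lam ε δ (v x) (w x) (h x) (f x (v x)) ≤
      lam * ((q - 1) * δ * ε ^ (-q) * ∫ x in Ω, inner ℝ (a x (H x)) (H x)) := by
  have hp := ha.exponent
  have hfin := hp.isFiniteMeasure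
  have hvm := hG.memLp.1
  have hwm := hH.memLp.1
  have hv0 : ∀ᵐ x ∂(volume.restrict Ω), 0 ≤ v x := hvM.mono fun x hx => hx.1
  have hw0 : ∀ᵐ x ∂(volume.restrict Ω), 0 ≤ w x := hwM.mono fun x hx => hx.1
  obtain ⟨hφ, hψ⟩ := memW0_picone (q := q) hp hG.toMemW0 hH.toMemW0 hvM hwM hε δ
  set φ : E N → ℝ := fun x => softPos δ ((v x + ε) ^ q - (w x + ε) ^ q) * (v x + ε) ^ (1 - q)
    with hφdef
  set ψ : E N → ℝ := fun x => softPos δ ((v x + ε) ^ q - (w x + ε) ^ q) * (w x + ε) ^ (1 - q)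
    with hψdef
  -- bounds for the test functions
  have hBle : ∀ᵐ x ∂(volume.restrict Ω),
      softPos δ ((v x + ε) ^ q - (w x + ε) ^ q) ≤ (M + 1) ^ q := by
    filter_upwards [hvM, hwM] with x hx hy
    exact (softPos_sub_le hq hε hδ hx.1 hy.1).trans
      (Real.rpow_le_rpow (by linarith [hx.1]) (by linarith [hx.2]) (by linarith))
  have hbound : ∀ u : E N → ℝ, (∀ᵐ x ∂(volume.restrict Ω), 0 ≤ u x) →
      ∀ᵐ x ∂(volume.restrict Ω),
      0 ≤ softPos δ ((v x + ε) ^ q - (w x + ε) ^ q) * (u x + ε) ^ (1 - q) ∧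
      |softPos δ ((v x + ε) ^ q - (w x + ε) ^ q) * (u x + ε) ^ (1 - q)| ≤
        (M + 1) ^ q * ε ^ (1 - q) := by
    intro u hu
    filter_upwards [hu, hBle] with x hx hB
    have h1 := softPos_nonneg hδ ((v x + ε) ^ q - (w x + ε) ^ q)
    have h2 : 0 ≤ (u x + ε) ^ (1 - q) := Real.rpow_nonneg (by linarith) _
    have h3 : (u x + ε) ^ (1 - q) ≤ ε ^ (1 - q) :=
      Real.rpow_le_rpow_of_nonpos hε (by linarith) (by linarith)
    refine ⟨mul_nonneg h1 h2, ?_⟩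
    rw [abs_of_nonneg (mul_nonneg h1 h2)]
    exact mul_le_mul hB h3 h2 (h1.trans hB)
  have hφ0 : ∀ᵐ x ∂(volume.restrict Ω), 0 ≤ φ x := (hbound v hv0).mono fun x hx => hx.1
  have hψ0 : ∀ᵐ x ∂(volume.restrict Ω), 0 ≤ ψ x := (hbound w hw0).mono fun x hx => hx.1
  have hφb : ∀ᵐ x ∂(volume.restrict Ω), |φ x| ≤ (M + 1) ^ q * ε ^ (1 - q) :=
    (hbound v hv0).mono fun x hx => hx.2
  have hψb : ∀ᵐ x ∂(volume.restrict Ω), |ψ x| ≤ (M + 1) ^ q * ε ^ (1 - q) :=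
    (hbound w hw0).mono fun x hx => hx.2
  have hs1 := hsub _ _ (hφ.memX_of_bound hp q hφb) hφ0
  have hs2 := hsup _ _ (hψ.memX_of_bound hp q hψb) hψ0
  -- integrability of the zeroth order terms
  have hpow : ∀ r : ℝ, 0 ≤ r → ContinuousOn (fun s : ℝ => s ^ r) (Icc 0 M) := fun r hr =>
    (Real.continuous_rpow_const hr).continuousOn
  have hi1 : ∀ u χ : E N → ℝ, AEStronglyMeasurable u (volume.restrict Ω) →
      (∀ᵐ x ∂(volume.restrict Ω), u x ∈ Icc 0 M) → AEStronglyMeasurable χ (volume.restrict Ω) →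
      (∀ᵐ x ∂(volume.restrict Ω), |χ x| ≤ (M + 1) ^ q * ε ^ (1 - q)) →
      IntegrableOn (fun x => u x ^ (2 * q - 1) * χ x) Ω ∧
      IntegrableOn (fun x => h x * u x ^ (q - 1) * χ x) Ω ∧
      IntegrableOn (fun x => f x (u x) * χ x) Ω := by
    intro u χ hum huM hχm hχ
    have c1 := hpow (2 * q - 1) (by linarith)
    have c2 := hpow (q - 1) (by linarith)
    obtain ⟨C₁, -, hC₁⟩ := ContinuousOn.exists_ae_bound_comp_Icc huM c1
    obtain ⟨C₂, -, hC₂⟩ := ContinuousOn.exists_ae_bound_comp_Icc huM c2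
    obtain ⟨Cf, -, hCf⟩ := hf0.exists_bound hp.isBounded M
    refine ⟨integrableOn_mul_of_bounds
      (ContinuousOn.aestronglyMeasurable_comp_Icc huM hum c1) hχm hC₁ hχ,
      Integrable.mul_bdd (Integrable.mul_bdd hh
        (ContinuousOn.aestronglyMeasurable_comp_Icc huM hum c2) hC₂) hχm hχ,
      integrableOn_mul_of_bounds (C := Cf)
        (hf0.aestronglyMeasurable hp.isOpen hum (huM.mono fun x hx => hx.1)) hχm ?_ hχ⟩
    filter_upwards [huM, hp.ae_mem] with x a1 a2 using hCf x a2 _ a1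
  obtain ⟨i1, i3, i5⟩ := hi1 v φ hvm hvM hφ.memLp.1 hφb
  obtain ⟨i2, i4, i6⟩ := hi1 w ψ hwm hwM hψ.memLp.1 hψb
  have hJ : IntegrableOn
      (fun x => comparisonIntegrand q lam ε δ (v x) (w x) (h x) (f x (v x))) Ω := by
    obtain ⟨Cf, -, hCf⟩ := hf0.exists_bound hp.isBounded M
    refine Integrable.mono' (g := fun x => (M + 1) ^ q * (M ^ q + h x) + lam * (Cf * (M + 1)))
      ((((integrable_const _).add hh).const_mul _).add (integrable_const _))
      (aestronglyMeasurable_comparisonIntegrand ε δ hvm hwm hh.1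
        (hf0.aestronglyMeasurable hp.isOpen hvm hv0)) ?_
    filter_upwards [hvM, hwM, hh0, hp.ae_mem] with x a1 a2 a3 a4
    exact abs_comparisonIntegrand_le hq hlam.le hε hε1 hδ a1 a2 a3 (hCf x a4 _ a1)
  have hle : ∫ x in Ω, comparisonIntegrand q lam ε δ (v x) (w x) (h x) (f x (v x)) ≤
      (∫ x in Ω, v x ^ (2 * q - 1) * φ x) - (∫ x in Ω, w x ^ (2 * q - 1) * ψ x) -
      ((∫ x in Ω, h x * v x ^ (q - 1) * φ x) - ∫ x in Ω, h x * w x ^ (q - 1) * ψ x) -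
      lam * ((∫ x in Ω, f x (v x) * φ x) - ∫ x in Ω, f x (w x) * ψ x) := by
    have j1 : IntegrableOn (fun x => v x ^ (2 * q - 1) * φ x - w x ^ (2 * q - 1) * ψ x) Ω :=
      i1.sub i2
    have j2 : IntegrableOn
        (fun x => h x * v x ^ (q - 1) * φ x - h x * w x ^ (q - 1) * ψ x) Ω := i3.sub i4
    have j3 : IntegrableOn (fun x => lam * (f x (v x) * φ x - f x (w x) * ψ x)) Ω :=
      (i5.sub i6).const_mul lam
    have j4 : IntegrableOn (fun x => v x ^ (2 * q - 1) * φ x - w x ^ (2 * q - 1) * ψ x -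
        (h x * v x ^ (q - 1) * φ x - h x * w x ^ (q - 1) * ψ x)) Ω := j1.sub j2
    rw [← integral_sub i1 i2, ← integral_sub i3 i4, ← integral_sub i5 i6, ← integral_const_mul,
      ← integral_sub j1 j2, ← integral_sub j4 j3]
    refine integral_mono_ae hJ (j4.sub j3) ?_
    filter_upwards [hv0, hwpos, hp.ae_mem] with x a1 a2 a3
    exact comparisonIntegrand_le hq hlam.le hε hδ a1 a2 fun hwv =>
      hf1 x a3 (mem_Ioi.2 a2) (mem_Ioi.2 (a2.trans hwv)) hwv.le
  -- the diffusion terms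
  have hdiff := integral_mono_ae
    (((ha.integrable_inner hH.memLp_grad hH.memLp_grad).const_mul
      ((q - 1) * δ * ε ^ (-q))).neg)
    ((ha.integrable_inner hG.memLp_grad hφ.memLp_grad).sub
      (ha.integrable_inner hH.memLp_grad hψ.memLp_grad)) (by
    filter_upwards [ha.potential, hv0, hw0, hp.ae_mem] with x a1 a2 a3 a4
    have := a1.picone_softPos (G x) (H x) (V := v x + ε) (W := w x + ε) (ε := ε) (δ := δ) hq
      (hqm.le.trans (ha.le_exponent x a4)) hε (by linarith) (by linarith) hδ
    simpa [a1.inner_self] using this)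
  rw [integral_neg', integral_const_mul, integral_sub'
    (ha.integrable_inner hG.memLp_grad hφ.memLp_grad)
    (ha.integrable_inner hH.memLp_grad hψ.memLp_grad)] at hdiff
  have hdiff' := mul_le_mul_of_nonneg_left hdiff hlam.le
  unfold lhsForm rhsForm at hs1 hs2
  rw [mul_sub] at hdiff'
  rw [mul_neg] at hdiff'
  rw [mul_sub] at hle
  linarith

/-- Comparison of a subsolution with an almost everywhere positive supersolution. -/
theorem ae_le_of_ae_pos (ha : IsEllipticField Ω p m P γ Γ A a) (hq : 1 < q)
    (hqm : q < m) (hlam : 0 < lam) (hf0 : CondF0 Ω f) (hf1 : CondF1 Ω q f)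
    (hh : IntegrableOn h Ω) (hh0 : ∀ᵐ x ∂(volume.restrict Ω), 0 ≤ h x)
    (hvM : ∀ᵐ x ∂(volume.restrict Ω), v x ∈ Icc 0 M)
    (hwM : ∀ᵐ x ∂(volume.restrict Ω), w x ∈ Icc 0 M)
    (hwpos : ∀ᵐ x ∂(volume.restrict Ω), 0 < w x)
    (hv : IsSubsolution Ω p q lam a f h v) (hw : IsSupersolution Ω p q lam a f h w) :
    ∀ᵐ x ∂(volume.restrict Ω), v x ≤ w x := by
  obtain ⟨hv0, G, hG, hsub⟩ := hv
  obtain ⟨-, H, hH, hsup⟩ := hw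
  have hp := ha.exponent
  have hfin := hp.isFiniteMeasure
  -- this choice makes the remainder `δ ε^{-q}` equal to `ε`
  set δ : ℕ → ℝ := fun n => shift n ^ (q + 1) with hδdef
  have hδ : ∀ n, 0 < δ n := fun n => Real.rpow_pos_of_pos (shift_pos n) _
  have hδ0 : Tendsto δ atTop (𝓝 0) := by
    have := tendsto_shift.rpow_const (p := q + 1) (Or.inr (by linarith))
    rwa [Real.zero_rpow (by linarith)] at this
  set S := ∫ x in Ω, inner ℝ (a x (H x)) (H x) with hS
  have hle : ∀ n, ∫ x in Ω, comparisonIntegrand q lam (shift n) (δ n) (v x) (w x) (h x)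
      (f x (v x)) ≤ lam * ((q - 1) * shift n * S) := by
    intro n
    have h1 := integral_comparisonIntegrand_le ha hq hqm hlam hf0 hf1 hh hh0 hvM hwM hwpos hG hH
      hsub hsup (shift_pos n) (shift_le_one n) (hδ n)
    have h2 : δ n * shift n ^ (-q) = shift n := by
      rw [hδdef, ← Real.rpow_add (shift_pos n)]; simp
    rwa [mul_assoc (q - 1), h2] at h1
  obtain ⟨Cf, -, hCf⟩ := hf0.exists_bound hp.isBounded M
  have hlim : Tendsto (fun n => ∫ x in Ω, comparisonIntegrand q lam (shift n) (δ n) (v x) (w x)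
      (h x) (f x (v x))) atTop (𝓝 (∫ x in Ω, max (v x ^ q - w x ^ q) 0 ^ 2)) := by
    refine tendsto_integral_of_dominated_convergence
      (fun x => (M + 1) ^ q * (M ^ q + h x) + lam * (Cf * (M + 1)))
      (fun n => aestronglyMeasurable_comparisonIntegrand _ _ hG.memLp.1 hH.memLp.1 hh.1
        (hf0.aestronglyMeasurable hp.isOpen hG.memLp.1 hv0))
      ((((integrable_const _).add hh).const_mul _).add (integrable_const _)) (fun n => ?_) ?_
    · filter_upwards [hvM, hwM, hh0, hp.ae_mem] with x a1 a2 a3 a4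
      exact abs_comparisonIntegrand_le hq hlam.le (shift_pos n) (shift_le_one n) (hδ n) a1 a2 a3
        (hCf x a4 _ a1)
    · filter_upwards [hv0, hwpos] with x a1 a2 using tendsto_comparisonIntegrand hq a1 a2 hδ hδ0
  have hlim' : Tendsto (fun n => lam * ((q - 1) * shift n * S)) atTop (𝓝 0) := by
    have := (((tendsto_shift.const_mul (q - 1)).mul_const S).const_mul lam)
    simpa using this
  have hint0 : ∫ x in Ω, max (v x ^ q - w x ^ q) 0 ^ 2 ≤ 0 :=
    le_of_tendsto_of_tendsto' hlim hlim' hle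
  have hint : IntegrableOn (fun x => max (v x ^ q - w x ^ q) 0 ^ 2) Ω := by
    refine Integrable.of_bound ((((hG.memLp.1.aemeasurable.pow_const q).sub
      (hH.memLp.1.aemeasurable.pow_const q)).max aemeasurable_const).pow_const 2).aestronglyMeasurable
      ((M ^ q) ^ 2) ?_
    filter_upwards [hvM, hwM] with x a1 a2
    rw [Real.norm_of_nonneg (sq_nonneg _)]
    refine pow_le_pow_left₀ (le_max_right _ _) (max_le ?_ (Real.rpow_nonneg (a1.1.trans a1.2) _)) 2
    exact (sub_le_self _ (Real.rpow_nonneg a2.1 _)).trans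
      (Real.rpow_le_rpow a1.1 a1.2 (by linarith))
  have hzero := (integral_eq_zero_iff_of_nonneg_ae
    (Eventually.of_forall fun x => sq_nonneg (max (v x ^ q - w x ^ q) 0)) hint).1
    (le_antisymm hint0 (integral_nonneg fun x => sq_nonneg _))
  filter_upwards [hzero, hv0, hwpos] with x a1 a2 a3
  have h1 : max (v x ^ q - w x ^ q) 0 = 0 := by simpa using a1
  have h2 : v x ^ q ≤ w x ^ q := by
    have := le_max_left (v x ^ q - w x ^ q) 0
    linarith
  exact (Real.rpow_le_rpow_iff a2 a3.le (by linarith)).1 h2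

end Comparison

end WeakComparison

theorem mainTheorem12 {N : ℕ} (hN : 1 ≤ N)
    (Ω : Set (WeakComparison.E N)) (hΩ : WeakComparison.IsSmoothBoundedDomain Ω)
    (p : WeakComparison.E N → ℝ) (hp : WeakComparison.IsC1Closure Ω p)
    (hp1 : ∀ x ∈ closure Ω, 1 < p x)
    (q : ℝ) (hq1 : 1 < q) (hqp : ∀ x ∈ closure Ω, q < p x)
    (lam : ℝ) (hlam : 0 < lam)
    (A : WeakComparison.E N → WeakComparison.E N → ℝ)
    (hA0 : WeakComparison.CondA0 Ω p A)
    (hA1 : WeakComparison.CondA1 Ω p (WeakComparison.field p A))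
    (hA2 : WeakComparison.CondA2 Ω p (WeakComparison.field p A))
    (f : WeakComparison.E N → ℝ → ℝ)
    (hf0 : WeakComparison.CondF0 Ω f) (hf1 : WeakComparison.CondF1 Ω q f)
    (r : ℝ≥0∞) (hr : 2 ≤ r)
    (h : WeakComparison.E N → ℝ) (hh : MemLp h r (volume.restrict Ω))
    (hh0 : ∀ᵐ x ∂(volume.restrict Ω), 0 ≤ h x)
    (v w : WeakComparison.E N → ℝ)
    (hv_bdd : MemLp v ∞ (volume.restrict Ω)) (hw_bdd : MemLp w ∞ (volume.restrict Ω))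
    (hv : WeakComparison.IsSubsolution Ω p q lam (WeakComparison.field p A) f h v)
    (hw : WeakComparison.IsSupersolution Ω p q lam (WeakComparison.field p A) f h w)
    (hw_nontrivial : ¬ (∀ᵐ x ∂(volume.restrict Ω), w x = 0)) :
    ∀ᵐ x ∂(volume.restrict Ω), v x ≤ w x := by
  obtain ⟨m, P, γ, Γ, hqm, ha⟩ := WeakComparison.exists_isEllipticField hΩ.isOpen
    hΩ.isConnected.nonempty hΩ.isBounded hp.1 hp1 hqp hA0 hA1
  have hfin := ha.exponent.isFiniteMeasure
  set M : ℝ := max 1 (max (lpNorm v ∞ (volume.restrict Ω)) (lpNorm w ∞ (volume.restrict Ω)))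
  have hvM : ∀ᵐ x ∂(volume.restrict Ω), v x ∈ Icc 0 M := by
    filter_upwards [hv.1, ae_le_lpNorm_exponent_top hv_bdd] with x h1 h2
    exact ⟨h1, (le_abs_self _).trans (h2.trans ((le_max_left _ _).trans (le_max_right _ _)))⟩
  have hwM : ∀ᵐ x ∂(volume.restrict Ω), w x ∈ Icc 0 M := by
    filter_upwards [hw.1, ae_le_lpNorm_exponent_top hw_bdd] with x h1 h2
    exact ⟨h1, (le_abs_self _).trans (h2.trans ((le_max_right _ _).trans (le_max_right _ _)))⟩
  obtain ⟨G, hG⟩ := hw.exists_isSublinearSupersolution ha hq1 hqm hlam hf0 hf1 hh0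
    (le_max_left _ _) hwM
  have hwpos := (hG.ae_eq_zero_or_ae_pos hΩ.isConnected).resolve_left hw_nontrivial
  exact WeakComparison.ae_le_of_ae_pos ha hq1 hqm hlam hf0 hf1
    (hh.integrable (one_le_two.trans hr)) hh0 hvM hwM hwpos hv hw
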